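/- Conventions. Actions are bit strings. Games are extensive-form games, and "polynomial time" refers to probabilistic Turing machines (PPT: on every input the running time is at most a fixed polynomial in the input length, for all coin tosses). A function $\epsilon$ is negligible if for every $c$, $|\epsilon(n)|<n^{-c}$ for all large $n$. A polynomial-time strategy in a sequence of games $\mathcal G=(G_1,G_2,\dots)$ is a PPT machine that on input $1^n$ and a view outputs an available action of $G_n$ at every view that can be reached. The view of a stateful machine consists of the current information set and of all random bits the machine has used in its earlier moves; the view of a stateless machine is the information set only. A profile $\vec M$ of polynomial-time strategies is a computational Nash equilibrium if for every player $i$ and every polynomial-time (stateful or stateless) strategy $M_i'$ of $i$ there is a negligible $\epsilon$ such that in every $G_n$ the expected utility of $i$ under $\vec M$ is at least that under $(M_i',\vec M_{-i})$ minus $\epsilon(n)$. Commitment schemes. A secure commitment scheme with perfect binding is a pair of PPT machines $C,R$, $R$ deterministic, such that for $k\ge1$: $C(1^k,b,r)$ consists of a $k$-bit commitment string $C_1(1^k,b,r)$ and a $(k-1)$-bit key $C_2(1^k,b,r)$; the ensembles $C_1(1^k,0)$ and $C_1(1^k,1)$ are computationally indistinguishable; $R(C_1(1^k,b,r),C_2(1^k,b,r))=b$,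 and $R(C_1(1^k,b,r),s)\notin\{0,1\}$ for every $s\ne C_2(1^k,b,r)$. It is exponentially hard if there is $c>0$ such that every probabilistic Turing machine with running time at most $2^{ck}$ on inputs $(1^k,x)$, $x\in\{0,1\}^k$, for all large $k$, distinguishes $C_1(1^k,0)$ from $C_1(1^k,1)$ with advantage at most $2^{-ck}$ for all large $k$. The games. In the envelope game $G$, player 1 puts a bit $b$ in an envelope, player 2, not seeing it, chooses a bit $x$, and player 1 then opens or destroys the envelope; player 1 gets $1$ and player 2 gets $-1$ if the envelope is opened and $b\ne x$, and otherwise player 1 gets $-1$ and player 2 gets $1$. Given a commitment scheme, let $\mathcal G'=(G'_1,G'_2,\dots)$ be the following sequence of games of perfect information. In $G'_n$, player 1 first plays a string consisting of $\lceil\log_2 n\rceil$ bits, the binary representation of a key length $\kappa\in\{0,\dots,n-1\}$, followed by a commitment string $C_1(1^{\kappa+1},b,r)$ for some $b,r$; then player 2 plays a bit $x$; then player 1 plays any string $s$ of length at most $n+\lceil\log_2 n\rceil$. Player 1 gets $1$ and player 2 gets $-1$ if $R$ opens the commitment string with key $s$ to a bit different from $x$; otherwise player 1 gets $-1$ and player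 2 gets $1$. Theorem. Let $(C,R)$ be an exponentially hard secure commitment scheme with perfect binding, and let $\mathcal G'$ be the corresponding sequence of commitment games. Then: 1. $\mathcal G'$ has no computational Nash equilibrium consisting of stateless Turing machines. 2. $\mathcal G'$ represents $G$, in the following sense. There are surjective maps $f_n$ from the histories of $G'_n$ onto those of $G$ that preserve length, the player who moves, the initial-segment relation, information sets (histories in the same information set are mapped into the same one, and there the same action is mapped to the same action), and, at terminal histories, the utilities. Moreover there is a map $\mathcal F$ from the mixed strategies $\sigma$ in $G$ with rational probabilities to polynomial-time strategies of the same player in $\mathcal G'$ such that, for profiles $\vec\sigma$ of such strategies: (a) the distribution on terminal histories of $G$ obtained via $f_n$ from the play of $\mathcal F(\vec\sigma)$ in $G'_n$ has negligible $\ell_1$-distance from that of $\vec\sigma$; (b) the action of $G$ to which the action played by $\mathcal F(\sigma_i)$ is mapped can be computed in polynomial time from $1^n$, the view and the random bits used in the move; (c) for every player $i$ and every polynomial-time strategy $M'_i$ there are mixed strategies $\sigma'_1,\sigma'_2,\dots$ of $i$ in $G$ such that the distributions on terminal histories of $G$ obtained from $(M_i',\mathcal F(\vec\sigma_{-i}))$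 in $G'_n$ and from $(\sigma'_n,\vec\sigma_{-i})$ in $G$ are computationally indistinguishable. If it can be decided in polynomial time whether a given string is a commitment string with parameter $1^k$, then $\mathcal G'$ is also a computable uniform sequence of games: action lengths are polynomially bounded in $n$, membership of a history in $G'_n$ is decidable in polynomial time from $1^n$ and the history, and the player to move and the utilities are polynomial-time computable from the history. 3. $\mathcal G'$ has a computational Nash equilibrium consisting of stateful Turing machines. -/

import Mathlib

open Filter

noncomputable section

/-! ## Words, negligible functions -/

/-- The string `1^n`. -/
def unary (n : ℕ) : List Bool := List.replicate n true

/-- A finite sequence of bit strings, written as one word over the alphabet `{0, 1, #}`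
(`none` is the symbol `#`): every string is followed by a `#`. -/
def encode (l : List (List Bool)) : List (Option Bool) :=
  l.flatMap fun s => s.map some ++ [none]

/-- The natural number with the given binary expansion, most significant bit first. -/
def binVal (l : List Bool) : ℕ := l.foldl (fun v b => 2 * v + b.toNat) 0

/-- The integer written as a sign bit (`1` for minus) followed by the absolute value in binary. -/
def intVal : List Bool → ℤ
  | [] => 0
  | s :: l => if s then -(binVal l : ℤ) else (binVal l : ℤ)

/-- The last `w` bits of the binary expansion of `v`, most significant bit first. -/
def bits (w v : ℕ) : List Bool := (List.range w).reverse.map v.testBit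

/-- `ε` tends to `0` faster than every inverse polynomial. -/
def Negligible (ε : ℕ → ℝ) : Prop :=
  ∀ c : ℕ, ∀ᶠ n : ℕ in atTop, |ε n| < ((n : ℝ) ^ c)⁻¹

/-! ## Probabilistic Turing machines -/

/-- A probabilistic Turing machine with input alphabet `{0, 1, #}` and output alphabet `{0, 1}`:
a multi-stack Turing machine (Mathlib's `Turing.FinTM2`) which, before each step, reads the next
bit of a random tape and stores it in its finite control by means of `flip`.
Every bit of the random tape is read only once. -/
structure ProbTM extends Turing.TM2ComputableAux (Option Bool) Bool where
  flip : Bool → tm.σ → tm.σ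

namespace ProbTM

variable (M : ProbTM)

/-- Configurations: control label (`none` once the machine has halted), internal state, stacks. -/
abbrev Config : Type := Turing.TM2.Cfg M.tm.Γ M.tm.Λ M.tm.σ

/-- One step, reading the random bit `b`; there is no next configuration after halting. -/
def step (b : Bool) (c : M.Config) : Option M.Config :=
  Turing.TM2.step M.tm.m ⟨c.l, M.flip b c.var, c.stk⟩

/-- Run from `c` on the random tape `r` until the machine halts or `r` is exhausted. The result is
the last configuration together with the random bits that have been used. -/
def runFrom (c : M.Config) : List Bool → M.Config × List Bool
  | [] => (c, [])
  | b :: r =>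
    match M.step b c with
    | none => (c, [])
    | some c' => ((runFrom c' r).1, b :: (runFrom c' r).2)

/-- The initial configuration on the input word `w`. -/
def start (w : List (Option Bool)) : M.Config :=
  Turing.initList M.tm (w.map M.inputAlphabet.symm)

def run (w : List (Option Bool)) (r : List Bool) : M.Config × List Bool :=
  M.runFrom (M.start w) r

/-- On input `w`, the machine halts within `t` steps, whatever the random bits are. -/
def HaltsWithin (w : List (Option Bool)) (t : ℕ) : Prop :=
  ∀ r : Fin t → Bool, (M.run w (List.ofFn r)).1.l = none

/-- The output on input `w` with random tape `r`, and the random bits used to produce it. -/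
def result (w : List (Option Bool)) (r : List Bool) : List Bool × List Bool :=
  (((M.run w r).1.stk M.tm.k₁).map M.outputAlphabet, (M.run w r).2)

/-- The joint law of the output and of the random bits used, for `t` uniformly random bits. -/
def law (w : List (Option Bool)) (t : ℕ) : PMF (List Bool × List Bool) :=
  (PMF.uniformOfFintype (Fin t → Bool)).map fun r => M.result w (List.ofFn r)

/-- The probability that the output on input `w`, with `t` random bits, is the string `1`. -/
def acceptProb (w : List (Option Bool)) (t : ℕ) : ℝ :=
  (((M.law w t).map Prod.fst) [true]).toReal

end ProbTM

/-- A probabilistic polynomial-time Turing machine: on every input, whatever the random bits are,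
it halts within a number of steps which is polynomial in the length of the input. -/
structure PPT extends ProbTM where
  time : Polynomial ℕ
  halts : ∀ w, toProbTM.HaltsWithin w (time.eval w.length)

namespace PPT

variable (M : PPT)

/-- The random bits available on input `l`, at least as many as the machine uses. -/
abbrev Coins (l : List (List Bool)) : Type := Fin (M.time.eval (encode l).length) → Bool

/-- Output and used random bits on input `l`. -/
def result (l : List (List Bool)) (r : M.Coins l) : List Bool × List Bool :=
  M.toProbTM.result (encode l) (List.ofFn r)

/-- The output on input `l` with random bits `r`. -/
def out (l : List (List Bool)) (r : M.Coins l) : List Bool := (M.result l r).1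

/-- The joint law of the output and of the random bits used, on input `l`. -/
def law (l : List (List Bool)) : PMF (List Bool × List Bool) :=
  M.toProbTM.law (encode l) (M.time.eval (encode l).length)

/-- The probability that the output on input `l` is the string `1`. -/
def acceptProb (l : List (List Bool)) : ℝ :=
  M.toProbTM.acceptProb (encode l) (M.time.eval (encode l).length)

end PPT

/-- Computational indistinguishability of two ensembles of distributions on sequences of bit
strings; a distribution is given by its weight function. -/
def CompIndist (X Y : ℕ → List (List Bool) → ℝ) : Prop :=
  ∀ D : PPT, ∃ ε : ℕ → ℝ, Negligible ε ∧ ∀ n,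
    |∑' x, X n x * D.acceptProb (unary n :: x) - ∑' x, Y n x * D.acceptProb (unary n :: x)| ≤ ε n

/-! ## Commitment schemes -/

/-- The weight function of the law of the commitment string (the first `k` bits of the output of
`C` on input `(1^k, b)`). -/
def commitWeight (C : PPT) (b : Bool) (k : ℕ) (x : List (List Bool)) : ℝ :=
  (((C.law [unary k, [b]]).map fun p => [p.1.take k]) x).toReal

/-- How the receiver opens the commitment string `c` with the key `s`: `some b` if `R` outputs the
bit `b`, and `none` (failure) for any other output. As `R` will be deterministic, the random tape
may be filled with zeros. -/
def openWith (R : PPT) (c s : List Bool) : Option Bool :=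
  match R.out [c, s] (fun _ => false) with
  | [b] => some b
  | _ => none

/-- A secure commitment scheme with perfect binding. On input `(1^k, b)` with `k ≥ 1`, the PPT
machine `C` outputs the `k` bits of the commitment string followed by the `k - 1` bits of the
commitment key. -/
structure CommitmentScheme where
  C : PPT
  R : PPT
  length_out : ∀ k, 1 ≤ k → ∀ b r, (C.out [unary k, [b]] r).length = k + (k - 1)
  R_deterministic : ∀ c s r r', R.out [c, s] r = R.out [c, s] r'
  hides : CompIndist (commitWeight C false) (commitWeight C true)
  opens : ∀ k, 1 ≤ k → ∀ b r,
    openWith R ((C.out [unary k, [b]] r).take k) ((C.out [unary k, [b]] r).drop k) = some b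
  binding : ∀ k, 1 ≤ k → ∀ b r s, s ≠ (C.out [unary k, [b]] r).drop k →
    openWith R ((C.out [unary k, [b]] r).take k) s = none

namespace CommitmentScheme

variable (S : CommitmentScheme)

/-- `c` is a commitment to the bit `b` with security parameter `k` (so with a key of length
`k - 1`). -/
def IsCommitment (k : ℕ) (b : Bool) (c : List Bool) : Prop :=
  ∃ r, c = (S.C.out [unary k, [b]] r).take k

/-- For some `c > 0`, no algorithm with running time `2^(ck)` distinguishes commitments to `0`
from commitments to `1` with probability greater than `2^(-ck)`. -/
def ExponentiallyHard : Prop :=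
  ∃ c : ℝ, 0 < c ∧ ∀ D : ProbTM,
    (∀ᶠ k : ℕ in atTop, ∀ x : List Bool, x.length = k →
      D.HaltsWithin (encode [unary k, x]) ⌊(2 : ℝ) ^ (c * k)⌋₊) →
    ∀ᶠ k : ℕ in atTop,
      |∑' x, commitWeight S.C false k x *
            D.acceptProb (encode (unary k :: x)) ⌊(2 : ℝ) ^ (c * k)⌋₊ -
        ∑' x, commitWeight S.C true k x *
            D.acceptProb (encode (unary k :: x)) ⌊(2 : ℝ) ^ (c * k)⌋₊| ≤ (2 : ℝ) ^ (-(c * k))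

/-- It can be decided in polynomial time whether a string is a commitment string. -/
def Recognizable : Prop :=
  ∃ V : PPT, ∀ k, 1 ≤ k → ∀ c r,
    V.out [unary k, c] r = [true] ↔ ∃ b, S.IsCommitment k b c

end CommitmentScheme

/-! ## Extensive-form games -/

/-- A history is a sequence of actions; actions are bit strings. -/
abbrev History : Type := List (List Bool)

/-- An extensive-form game of finite horizon with `c` players. Two histories at which player `i`
moves are in the same information set of `i` iff they have the same label `info h`; this label is
the representation of the information set that is given to a machine playing the game. `mover` only
matters at nonterminal histories, `u` only at terminal ones. -/
structure ExtGame (c : ℕ) where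
  H : Set History
  nil_mem : [] ∈ H
  prefix_mem : ∀ h a, h ++ [a] ∈ H → h ∈ H
  depth : ℕ
  length_le : ∀ h ∈ H, h.length ≤ depth
  mover : History → Fin c
  u : Fin c → History → ℝ
  info : History → List (List Bool)
  actions_eq : ∀ h h' : History, (∃ a, h ++ [a] ∈ H) → (∃ a, h' ++ [a] ∈ H) →
    mover h = mover h' → info h = info h' → ∀ a, h ++ [a] ∈ H ↔ h' ++ [a] ∈ H

namespace ExtGame

variable {c : ℕ} (G : ExtGame c)

def NonTerminal (h : History) : Prop := ∃ a, h ++ [a] ∈ G.H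

def Terminal (h : History) : Prop := h ∈ G.H ∧ ¬ G.NonTerminal h

/-- The information sets of player `i`, given by their labels. -/
def InfoSet (i : Fin c) : Type :=
  {v : List (List Bool) // ∃ h, G.NonTerminal h ∧ G.mover h = i ∧ G.info h = v}

/-- Deterministic strategies: a choice of an available action at every information set. -/
def DetStrategy (i : Fin c) : Type :=
  (v : G.InfoSet i) → {a : List Bool // ∀ h, G.NonTerminal h → G.mover h = i → G.info h = v.1 →
    h ++ [a] ∈ G.H}

/-- Mixed strategies. -/
abbrev MixedStrategy (i : Fin c) : Type := PMF (G.DetStrategy i)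

open Classical in
/-- The history reached after `k` rounds (or fewer, if a terminal history is reached before). -/
def playDet (s : ∀ i, G.DetStrategy i) : ℕ → History
  | 0 => []
  | k + 1 =>
    if hN : G.NonTerminal (playDet s k) then
      playDet s k ++
        [(s (G.mover (playDet s k)) ⟨G.info (playDet s k), playDet s k, hN, rfl, rfl⟩).1]
    else playDet s k

open Classical in
/-- The probability that the profile `σ` of mixed strategies,
with independent randomizations, ends at the history `h`. -/
def mixedWeight (σ : ∀ i, G.MixedStrategy i) (h : History) : ℝ :=
  ∑' s : ∀ i, G.DetStrategy i,
    (∏ i, (σ i (s i)).toReal) * (if G.playDet s G.depth = h then 1 else 0)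

end ExtGame

/-- All probabilities of the mixed strategy are rational numbers. -/
def RationalWeights {α : Type} (p : PMF α) : Prop := ∀ s, ∃ q : ℚ, (p s).toReal = q

/-! ## Strategies in sequences of games, computational Nash equilibrium -/

/-- A polynomial-time strategy in a sequence of games: a PPT machine. Its input is `(1^n, view)`.
If it is stateful, its view consists of the representation of the information set and of the
randomness that it has used in its earlier moves; if it is stateless, its view is the
representation of the information set alone. In each move it reads fresh random bits. -/
structure Strategy where
  machine : PPT
  stateful : Bool

namespace Strategy

variable (M : Strategy)

/-- The input in the `n`-th game at the information set `v`, after the random bits `r` were used. -/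
def input (n : ℕ) (v : List (List Bool)) (r : List Bool) : List (List Bool) :=
  unary n :: (if M.stateful then r :: v else v)

abbrev Coins (n : ℕ) (v : List (List Bool)) (r : List Bool) : Type := M.machine.Coins (M.input n v r)

/-- The action played and the random bits used for it, when the fresh random bits are `ω`. -/
def act (n : ℕ) (v : List (List Bool)) (r : List Bool) (ω : M.Coins n v r) :
    List Bool × List Bool :=
  M.machine.result (M.input n v r) ω

/-- The joint law of the action played and of the random bits used for it. -/
def move (n : ℕ) (v : List (List Bool)) (r : List Bool) : PMF (List Bool × List Bool) :=
  M.machine.law (M.input n v r)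

end Strategy

/-- `Reachable G n M i h r`: in the `n`-th game `G`, when player `i` plays `M` and the other players
play in any way, it can happen that the history `h` is reached and that player `i` has used the
random bits `r` so far. -/
inductive Reachable {c : ℕ} (G : ExtGame c) (n : ℕ) (M : Strategy) (i : Fin c) :
    History → List Bool → Prop
  | nil : Reachable G n M i [] []
  | other (h : History) (r a : List Bool) : Reachable G n M i h r → G.mover h ≠ i →
      h ++ [a] ∈ G.H → Reachable G n M i (h ++ [a]) r
  | own (h : History) (r : List Bool) (ω : M.Coins n (G.info h) r) : Reachable G n M i h r →
      G.mover h = i → G.NonTerminal h →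
      Reachable G n M i (h ++ [(M.act n (G.info h) r ω).1]) (r ++ (M.act n (G.info h) r ω).2)

/-- `M` is a strategy for player `i` in the sequence of games `𝒢 1, 𝒢 2, …`: at every view that can
be reached it plays an available action. -/
def IsStrategyFor {c : ℕ} (𝒢 : ℕ → ExtGame c) (i : Fin c) (M : Strategy) : Prop :=
  ∀ n, 1 ≤ n → ∀ h r, Reachable (𝒢 n) n M i h r → (𝒢 n).NonTerminal h → (𝒢 n).mover h = i →
    ∀ ω : M.Coins n ((𝒢 n).info h) r, h ++ [(M.act n ((𝒢 n).info h) r ω).1] ∈ (𝒢 n).H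

namespace ExtGame

variable {c : ℕ} (G : ExtGame c)

open Classical in
/-- One round of play: from the current history, and the random bits used so far by each player. -/
def playStep (n : ℕ) (M : Fin c → Strategy) (s : History × (Fin c → List Bool)) :
    PMF (History × (Fin c → List Bool)) :=
  if G.NonTerminal s.1 then
    ((M (G.mover s.1)).move n (G.info s.1) (s.2 (G.mover s.1))).map fun p =>
      (s.1 ++ [p.1],
        Function.update s.2 (G.mover s.1) (s.2 (G.mover s.1) ++ p.2))
  else PMF.pure s

def play (n : ℕ) (M : Fin c → Strategy) : ℕ → PMF (History × (Fin c → List Bool))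
  | 0 => PMF.pure ([], fun _ => [])
  | k + 1 => (play n M k).bind (G.playStep n M)

/-- The distribution on terminal histories induced by the profile `M`, when `G` is the `n`-th game
of a sequence. -/
def terminalLaw (n : ℕ) (M : Fin c → Strategy) : PMF History :=
  (G.play n M G.depth).map Prod.fst

/-- The expected utility of player `i` under the profile `M`. -/
def expectedUtility (n : ℕ) (M : Fin c → Strategy) (i : Fin c) : ℝ :=
  ∑' h, (G.terminalLaw n M h).toReal * G.u i h

end ExtGame

/-- Computational Nash equilibrium: no player has a polynomial-time deviation that gains more than
a negligible amount. -/
def IsCompNash {c : ℕ} (𝒢 : ℕ → ExtGame c) (M : Fin c → Strategy) : Prop :=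
  (∀ i, IsStrategyFor 𝒢 i (M i)) ∧
  ∀ i, ∀ M' : Strategy, IsStrategyFor 𝒢 i M' → ∃ ε : ℕ → ℝ, Negligible ε ∧ ∀ n, 1 ≤ n →
    (𝒢 n).expectedUtility n M i ≥ (𝒢 n).expectedUtility n (Function.update M i M') i - ε n

/-! ## Computable uniform sequences, representation of a finite game -/

/-- Computable uniform sequences of games (computational games). Utilities are computed as fractions
of integers. -/
def IsComputableUniform {c : ℕ} (𝒢 : ℕ → ExtGame c) : Prop :=
  (∃ p : Polynomial ℕ, ∀ n, 1 ≤ n → ∀ h a, h ++ [a] ∈ (𝒢 n).H → a.length ≤ p.eval n) ∧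
  (∃ V : PPT, ∀ n, 1 ≤ n → ∀ h ω, V.out (unary n :: h) ω = [true] ↔ h ∈ (𝒢 n).H) ∧
  (∃ P : PPT, ∀ n, 1 ≤ n → ∀ h, (𝒢 n).NonTerminal h → ∀ ω, binVal (P.out h ω) = (𝒢 n).mover h) ∧
  (∀ i, ∃ A B : PPT, ∀ n, 1 ≤ n → ∀ h, (𝒢 n).Terminal h → ∀ ω ω',
    binVal (B.out h ω') ≠ 0 ∧
      (𝒢 n).u i h = (intVal (A.out h ω) : ℝ) / (binVal (B.out h ω') : ℝ))

/-- The distribution on the terminal histories of the underlying game that is obtained from the one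
induced by `M` on the `n`-th game, by means of the map `f n`. -/
def pushedWeight {c : ℕ} (𝒢 : ℕ → ExtGame c) (f : ℕ → History → History) (M : Fin c → Strategy)
    (n : ℕ) (h : History) : ℝ :=
  ((((𝒢 n).terminalLaw n M).map (f n)) h).toReal

/-- The sequence `𝒢 1, 𝒢 2, …` represents the finite game `G` by means of the maps `f n` on
histories and the map `F` from strategies in `G` to strategies in the sequence. -/
structure RepresentsVia {c : ℕ} (𝒢 : ℕ → ExtGame c) (G : ExtGame c) (f : ℕ → History → History)
    (F : ∀ i, G.MixedStrategy i → Strategy) : Prop where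
  finite : G.H.Finite
  maps : ∀ n, 1 ≤ n → ∀ h ∈ (𝒢 n).H, f n h ∈ G.H
  surj : ∀ n, 1 ≤ n → ∀ g ∈ G.H, ∃ h ∈ (𝒢 n).H, f n h = g
  length_eq : ∀ n, 1 ≤ n → ∀ h ∈ (𝒢 n).H, (f n h).length = h.length
  mover_eq : ∀ n, 1 ≤ n → ∀ h, (𝒢 n).NonTerminal h →
    G.NonTerminal (f n h) ∧ G.mover (f n h) = (𝒢 n).mover h
  prefix_map : ∀ n, 1 ≤ n → ∀ h ∈ (𝒢 n).H, ∀ h' ∈ (𝒢 n).H, h' <+: h → f n h' <+: f n h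
  info_map : ∀ n, 1 ≤ n → ∀ h h', (𝒢 n).NonTerminal h → (𝒢 n).NonTerminal h' →
    (𝒢 n).mover h = (𝒢 n).mover h' → (𝒢 n).info h = (𝒢 n).info h' →
    G.info (f n h) = G.info (f n h')
  action_map : ∀ n, 1 ≤ n → ∀ h h', (𝒢 n).NonTerminal h → (𝒢 n).NonTerminal h' →
    (𝒢 n).mover h = (𝒢 n).mover h' → (𝒢 n).info h = (𝒢 n).info h' →
    ∀ a, h ++ [a] ∈ (𝒢 n).H → (f n (h ++ [a])).getLast? = (f n (h' ++ [a])).getLast?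
  utility_eq : ∀ n, 1 ≤ n → ∀ h, (𝒢 n).Terminal h →
    G.Terminal (f n h) ∧ ∀ i, (𝒢 n).u i h = G.u i (f n h)
  /-- `F σ` is a strategy of the sequence for the same player. -/
  isStrategy : ∀ i (σ : G.MixedStrategy i), RationalWeights σ → IsStrategyFor 𝒢 i (F i σ)
  /-- `σ` corresponds to `F σ`: the induced distributions are statistically close. -/
  corresponds : ∀ σ : ∀ i, G.MixedStrategy i, (∀ i, RationalWeights (σ i)) →
    ∃ ε : ℕ → ℝ, Negligible ε ∧ ∀ n, 1 ≤ n →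
      ∑' h, |pushedWeight 𝒢 f (fun i => F i (σ i)) n h - G.mixedWeight σ h| ≤ ε n
  /-- The action of `G` that corresponds to the action played by `F σ` can be computed in polynomial
  time from the view and the random bits that `F σ` uses in this move. -/
  knows : ∀ i (σ : G.MixedStrategy i), RationalWeights σ → ∃ N : PPT, ∀ n, 1 ≤ n → ∀ h r,
    Reachable (𝒢 n) n (F i σ) i h r → (𝒢 n).NonTerminal h → (𝒢 n).mover h = i →
    ∀ (ω : (F i σ).Coins n ((𝒢 n).info h) r) (ω' : N.Coins (unary n :: r ::
        ((F i σ).act n ((𝒢 n).info h) r ω).2 :: (𝒢 n).info h)),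
      (f n (h ++ [((F i σ).act n ((𝒢 n).info h) r ω).1])).getLast? = some (N.out _ ω')
  /-- A polynomial-time deviation of one player from `F σ` is computationally indistinguishable from
  a sequence of deviations from `σ` in `G`. -/
  deviation : ∀ σ : ∀ i, G.MixedStrategy i, (∀ i, RationalWeights (σ i)) →
    ∀ i, ∀ M' : Strategy, IsStrategyFor 𝒢 i M' → ∃ σ' : ℕ → G.MixedStrategy i,
      CompIndist (pushedWeight 𝒢 f (Function.update (fun j => F j (σ j)) i M'))
        (fun n => G.mixedWeight (Function.update σ i (σ' n)))

def Represents {c : ℕ} (𝒢 : ℕ → ExtGame c) (G : ExtGame c) : Prop :=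
  ∃ f F, RepresentsVia 𝒢 G f F

/-! ## The envelope game and the commitment game -/

/-- The envelope game. Player `0` puts a bit in an envelope, then player `1`, who does not see it,
chooses a bit, and then player `0` either opens (`1`) or destroys (`0`) the envelope. Player `0`
wins iff the envelope is opened and the two bits are different. -/
def envelopeGame : ExtGame 2 where
  H := {h | h.length ≤ 3 ∧ ∀ a ∈ h, a.length = 1}
  nil_mem := by simp
  prefix_mem := by
    rintro h a ⟨h1, h2⟩
    refine ⟨?_, fun b hb => h2 b (by simp [hb])⟩
    simp at h1
    omega
  depth := 3
  length_le := fun _ h => h.1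
  mover h := if h.length = 1 then 1 else 0
  u i h :=
    let win : Prop := ∃ b x : Bool, h = [[b], [x], [true]] ∧ b ≠ x
    open Classical in if win then (if i = 0 then 1 else -1) else (if i = 0 then -1 else 1)
  info h := if h.length = 1 then [] else h
  actions_eq := by
    rintro h h' ⟨a, ha, ha'⟩ ⟨b, hb, hb'⟩ hm hi x
    by_cases h1 : h.length = 1 <;> by_cases h2 : h'.length = 1 <;> simp [h1, h2] at hm hi
    · have e1 : ∀ y ∈ h, y.length = 1 := fun y hy => ha' y (by simp [hy])
      have e2 : ∀ y ∈ h', y.length = 1 := fun y hy => hb' y (by simp [hy])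
      simp only [Set.mem_ofPred_eq, List.length_append, List.length_singleton, h1, h2,
        List.mem_append, List.mem_singleton]
      constructor
      · rintro ⟨h3, h4⟩
        refine ⟨h3, ?_⟩
        rintro y (hy | rfl)
        · exact e2 y hy
        · exact h4 _ (Or.inr rfl)
      · rintro ⟨h3, h4⟩
        refine ⟨h3, ?_⟩
        rintro y (hy | rfl)
        · exact e1 y hy
        · exact h4 _ (Or.inr rfl)
    · subst hi
      rfl

namespace CommitmentScheme

variable (S : CommitmentScheme)

/-- The first actions of the `n`-th game: the first `⌈log₂ n⌉` bits are the binary representation of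
a key length `κ < n`; they are followed by a commitment to a bit `b` with a key of length `κ`. -/
def IsFirstAction (n : ℕ) (b : Bool) (a : List Bool) : Prop :=
  ∃ κ < n, ∃ c, S.IsCommitment (κ + 1) b c ∧ a = bits (Nat.clog 2 n) κ ++ c

/-- The histories of the `n`-th game: a commitment to some bit, then a bit, and then a string that is
no longer than `n + ⌈log₂ n⌉`. -/
def IsHistory (n : ℕ) : History → Prop
  | [] => True
  | [a] => ∃ b, S.IsFirstAction n b a
  | [a, x] => (∃ b, S.IsFirstAction n b a) ∧ x.length = 1
  | [a, x, s] => (∃ b, S.IsFirstAction n b a) ∧ x.length = 1 ∧ s.length ≤ n + Nat.clog 2 n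
  | _ => False

/-- Player `0` wins iff the last action is a key that opens the commitment to a bit different from
the one chosen by player `1`. -/
def FirstWins (n : ℕ) (h : History) : Prop :=
  ∃ a s : List Bool, ∃ b x : Bool, h = [a, [x], s] ∧
    openWith S.R (a.drop (Nat.clog 2 n)) s = some b ∧ b ≠ x

/-- The commitment game in which player `0` may choose the length of the key. It is a game of perfect
information: the information sets are singletons. -/
def game (n : ℕ) : ExtGame 2 where
  H := {h | S.IsHistory n h}
  nil_mem := trivial
  prefix_mem := by
    intro h a hh
    match h, hh with
    | [], _ => trivial
    | [b], hh => exact hh.1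
    | [b, x], hh => exact ⟨hh.1, hh.2.1⟩
    | _ :: _ :: _ :: t, hh => cases t <;> exact hh.elim
  depth := 3
  length_le := by
    intro h hh
    match h, hh with
    | [], _ => simp
    | [_], _ => simp
    | [_, _], _ => simp
    | [_, _, _], _ => simp
    | _ :: _ :: _ :: _ :: _, hh => exact hh.elim
  mover h := if h.length = 1 then 1 else 0
  u i h := open Classical in
    if S.FirstWins n h then (if i = 0 then 1 else -1) else (if i = 0 then -1 else 1)
  info h := h
  actions_eq := by
    rintro h h' - - - rfl a
    rfl

end CommitmentScheme

end

/-! The commitment game replaces the envelope by a string lying on the table. Perfect binding makes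
the committed bit a function of the first action and leaves exactly one key, so a play of `S.game n`
is read as a play of `envelopeGame`: take the committed bit, keep the answer, note whether the last
string opens the commitment (`decode`). Utilities agree because opening gives either the committed
bit or nothing (`IsFirstAction.openWith_eq`).

A mixed strategy with rational weights is a uniform choice among `q` entries of a table
(`exists_sampling`), and `n` coins reduced modulo `q` imitate this choice up to statistical distance
`q / 2 ^ n` (`close_binMod`). Player 0 commits with security parameter `n`. At the last move it
reruns the sender on the coins preserved in its view, which gives the key; to destroy the envelope
it plays a string of the wrong length. This is where memory is essential.

Against such strategies a deviation amounts to a mixed strategy of the envelope game. If player 1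
deviates, hiding is applied to a distinguisher that runs the deviating machine on the commitment:
the answer has nearly the same law for both bits (`exists_close_answerLaw`), so it is a random bit
chosen blindly. If player 0 deviates, its reactions to the answers 0 and 1 can both be drawn in
advance, because player 1 answers independently of the commitment (`RepresentsSecond.exists_close`).
Both comparisons are even statistical.

For the stateful equilibrium, player 0 commits to a uniform bit and always opens, and player 1
guesses uniformly. Up to negligible errors each side thereby enforces the value `1/2` for the
probability that player 0 wins, whatever the opponent does in polynomial time.

In a stateless profile that is an equilibrium, player 0 could still deviate to the stateful uniform
committer, hence must win with probability at least `1/2` up to a negligible error. But the last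
action of a stateless player 0 has a law determined by the history alone, and player 1 can sample
from it (`exists_winProb_le`): run player 0's machine as if the answer were 0, answer 1 if this
opens the commitment to 1, and answer 0 otherwise. If the committed bit is 0, the answer matches it.
If it is 1 and `p` is the probability of opening after the answer 0, then player 0 wins only when
the sample fails to open and the independent real move opens, with probability `p (1 - p) ≤ 1/4`.
The two deviations together are incompatible with equilibrium.

All machines come from a calculus of polynomial-time functions on sequences of strings (`PolyTime`),
closed under composition, case distinction, bounded iteration and simulation of given machines, and
implemented by structured stack programs. A `ProbTM` consumes a random bit in every step and its
view contains all of them. The translated machines therefore record bits during a first phase, whose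
length depends on the input only, and compute deterministically from the record afterwards
(`exists_ppt_law`); the record is a prefix of the used bits, so a later move can recover it.

In a computable uniform sequence the utilities are computed from the history without `n`;
`weightLength` finds the beginning of the commitment from the first action alone. -/

noncomputable section

/-! ## Structured programs on stacks -/

/-- Structured programs acting on stacks numbered by `ℕ`, with stack alphabet `A`. -/
inductive StackProg (A : Type) : Type 1
  | skip : StackProg A
  | push (k : ℕ) (a : A) : StackProg A
  | pop (k : ℕ) : StackProg A
  | seq (p q : StackProg A) : StackProg A
  | case (k : ℕ) {ι : Type} (hι : Fintype ι) (c : Option A → ι) (p : ι → StackProg A) : StackProg A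
  | loop (k : ℕ) {ι : Type} (hι : Fintype ι) (c : Option A → Option ι) (p : ι → StackProg A) :
      StackProg A

namespace StackProg

variable {A : Type}

/-- `Exec p S t S'`: started on the stacks `S`, the program `p` takes `t` steps and ends with the
stacks `S'`. -/
inductive Exec : StackProg A → (ℕ → List A) → ℕ → (ℕ → List A) → Prop
  | skip (S) : Exec skip S 1 S
  | push (k a S) : Exec (push k a) S 1 (Function.update S k (a :: S k))
  | pop (k S) : Exec (pop k) S 1 (Function.update S k (S k).tail)
  | seq {p q S t S' t' S''} : Exec p S t S' → Exec q S' t' S'' → Exec (seq p q) S (t + t') S''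
  | case {k ι} {hι : Fintype ι} {c : Option A → ι} {p S t S'} (i : ι) : c (S k).head? = i →
      Exec (p i) S t S' → Exec (case k hι c p) S (1 + t) S'
  | loop_none {k ι} {hι : Fintype ι} {c : Option A → Option ι} {p S} : c (S k).head? = none →
      Exec (loop k hι c p) S 1 S
  | loop_some {k ι} {hι : Fintype ι} {c : Option A → Option ι} {p S t S' t' S''} (i : ι) :
      c (S k).head? = some i → Exec (p i) S t S' → Exec (loop k hι c p) S' t' S'' →
      Exec (loop k hι c p) S (1 + (t + t')) S''

/-- Program positions. -/
def Label : StackProg A → Type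
  | skip => Unit
  | push _ _ => Unit
  | pop _ => Unit
  | seq p q => Label p ⊕ Label q
  | case _ _ _ p => Option (Σ i, Label (p i))
  | loop _ _ _ p => Option (Σ i, Label (p i))

-- Finiteness of the set of positions is the reason why `case` and `loop` branch over finite types:
-- the positions become control labels of a machine.
@[reducible] def labelFintype : (p : StackProg A) → Fintype (Label p)
  | skip => inferInstanceAs (Fintype Unit)
  | push _ _ => inferInstanceAs (Fintype Unit)
  | pop _ => inferInstanceAs (Fintype Unit)
  | seq p q =>
    haveI := labelFintype p
    haveI := labelFintype q
    inferInstanceAs (Fintype (Label p ⊕ Label q))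
  | case _ hι _ p =>
    haveI := hι
    haveI := fun i => labelFintype (p i)
    inferInstanceAs (Fintype (Option (Σ i, Label (p i))))
  | loop _ hι _ p =>
    haveI := hι
    haveI := fun i => labelFintype (p i)
    inferInstanceAs (Fintype (Option (Σ i, Label (p i))))

instance (p : StackProg A) : Fintype (Label p) := labelFintype p

def entry : (p : StackProg A) → Label p
  | skip => ()
  | push _ _ => ()
  | pop _ => ()
  | seq p _ => Sum.inl (entry p)
  | case _ _ _ _ => none
  | loop _ _ _ _ => none

/-- The program uses only stacks with number less than `N`. -/
def Below (N : ℕ) : StackProg A → Prop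
  | skip => True
  | push k _ => k < N
  | pop k => k < N
  | seq p q => Below N p ∧ Below N q
  | case k _ _ p => k < N ∧ ∀ i, Below N (p i)
  | loop k _ _ p => k < N ∧ ∀ i, Below N (p i)

theorem Below.mono {N N' : ℕ} (h : N ≤ N') : ∀ {p : StackProg A}, Below N p → Below N' p
  | skip, _ => trivial
  | push _ _, hp => lt_of_lt_of_le hp h
  | pop _, hp => lt_of_lt_of_le hp h
  | seq _ _, hp => ⟨hp.1.mono h, hp.2.mono h⟩
  | case _ _ _ _, hp => ⟨lt_of_lt_of_le hp.1 h, fun i => (hp.2 i).mono h⟩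
  | loop _ _ _ _, hp => ⟨lt_of_lt_of_le hp.1 h, fun i => (hp.2 i).mono h⟩

theorem exists_below_of_forall {ι : Type} (hι : Fintype ι) {p : ι → StackProg A} (k : ℕ)
    (h : ∀ i, ∃ N, Below N (p i)) : ∃ N, k < N ∧ ∀ i, Below N (p i) := by
  choose N hN using h
  exact ⟨Finset.univ.sup N + k + 1, by omega, fun i => (hN i).mono
    ((Finset.le_sup (f := N) (Finset.mem_univ i)).trans (by omega))⟩

theorem exists_below : ∀ p : StackProg A, ∃ N, Below N p
  | skip => ⟨0, trivial⟩
  | push k _ => ⟨k + 1, Nat.lt_succ_self k⟩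
  | pop k => ⟨k + 1, Nat.lt_succ_self k⟩
  | seq p q => by
    obtain ⟨N, hN⟩ := exists_below p
    obtain ⟨N', hN'⟩ := exists_below q
    exact ⟨max N N', hN.mono (le_max_left _ _), hN'.mono (le_max_right _ _)⟩
  | case k hι _ p => exists_below_of_forall hι k fun i => exists_below (p i)
  | loop k hι _ p => exists_below_of_forall hι k fun i => exists_below (p i)

/-! ## Translation into Turing machines -/

/-- The stacks of the translated machine: input, output, a stack that records random bits, and
registers. -/
inductive Stk (N : ℕ)
  | inp | out | record
  | reg (i : Fin (N + 1))
  deriving DecidableEq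

def Stk.equiv (N : ℕ) : Fin 3 ⊕ Fin (N + 1) ≃ Stk N where
  toFun := Sum.elim ![Stk.inp, Stk.out, Stk.record] Stk.reg
  invFun
    | .inp => Sum.inl 0
    | .out => Sum.inl 1
    | .record => Sum.inl 2
    | .reg i => Sum.inr i
  left_inv := by
    rintro (i | i)
    · fin_cases i <;> rfl
    · rfl
  right_inv := by rintro (_ | _ | _ | i) <;> rfl

instance (N : ℕ) : Fintype (Stk N) := Fintype.ofEquiv _ (Stk.equiv N)

/-- The stack alphabets of the translated machine. -/
abbrev Sy (A : Type) (N : ℕ) : Stk N → Type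
  | .inp => Option Bool
  | .out => Bool
  | .record => Bool
  | .reg _ => A

variable {N : ℕ} {Λ : Type}

/-- The state is a pair: the random bit read in the present step, and a label in which `peek` leaves
the jump target for the following `goto`. -/
abbrev Stmt (A : Type) (N : ℕ) (Λ : Type) := Turing.TM2.Stmt (Sy A N) Λ (Bool × Λ)

/-- The reduction modulo `N + 1` only makes the function total; for programs that satisfy `Below (N
+ 1)` it changes nothing. -/
def rg (N k : ℕ) : Stk N := .reg (Fin.ofNat (N + 1) k)

/-- The statement at each position of `p`, the positions being embedded by `e` into the set `Λ`;
control is passed to `exit` at the end. -/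
def code : (p : StackProg A) → (Label p → Λ) → Λ → Label p → Stmt A N Λ
  | skip, _, exit, _ => .goto fun _ => exit
  | push k a, _, exit, _ => .push (rg N k) (fun _ => a) (.goto fun _ => exit)
  | pop k, _, exit, _ => .pop (rg N k) (fun v _ => v) (.goto fun _ => exit)
  | seq p q, e, _, Sum.inl l => code p (e ∘ Sum.inl) (e (Sum.inr (entry q))) l
  | seq _ q, e, exit, Sum.inr l => code q (e ∘ Sum.inr) exit l
  | case k _ c p, e, _, none =>
    .peek (rg N k) (fun v o => (v.1, e (some ⟨c o, entry (p (c o))⟩))) (.goto fun v => v.2)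
  | case _ _ _ p, e, exit, some ⟨i, l⟩ => code (p i) (fun l => e (some ⟨i, l⟩)) exit l
  | loop k _ c p, e, exit, none =>
    .peek (rg N k) (fun v o => (v.1, match c o with
      | none => exit
      | some i => e (some ⟨i, entry (p i)⟩))) (.goto fun v => v.2)
  | loop _ _ _ p, e, _, some ⟨i, l⟩ => code (p i) (fun l => e (some ⟨i, l⟩)) (e none) l

/-- If `b`, record the random bit of this step. -/
def recording (b : Bool) (s : Stmt A N Λ) : Stmt A N Λ :=
  if b then .push .record (fun v => v.1) s else s

def machine (A : Type) (N : ℕ) {Λ : Type} [Fintype Λ] (main : Λ) (m : Λ → Stmt A N Λ) : ProbTM where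
  tm :=
    { K := Stk N
      k₀ := .inp
      k₁ := .out
      Γ := Sy A N
      Λ := Λ
      main := main
      σ := Bool × Λ
      initialState := (false, main)
      Γk₀Fin := inferInstanceAs (Fintype (Option Bool))
      m := m }
  inputAlphabet := Equiv.refl _
  outputAlphabet := Equiv.refl _
  flip b v := (b, v.2)

end StackProg

namespace ProbTM

variable (M : ProbTM)

/-- Reading the random bits `ω`, the machine gets from `c` to `c'`. -/
def Steps (c : M.Config) (ω : List Bool) (c' : M.Config) : Prop :=
  ∀ r, M.runFrom c (ω ++ r) = ((M.runFrom c' r).1, ω ++ (M.runFrom c' r).2)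

variable {M}

theorem Steps.trans {c c' c'' : M.Config} {ω ω' : List Bool} (h : M.Steps c ω c')
    (h' : M.Steps c' ω' c'') : M.Steps c (ω ++ ω') c'' := by
  intro r
  rw [List.append_assoc, h, h', List.append_assoc]

theorem Steps.single {c c' : M.Config} {b : Bool} (h : M.step b c = some c') :
    M.Steps c [b] c' := by
  intro r
  simp [runFrom, h]

theorem Steps.cons {c c' c'' : M.Config} {b : Bool} {ω : List Bool} (h : M.step b c = some c')
    (h' : M.Steps c' ω c'') : M.Steps c (b :: ω) c'' :=
  (Steps.single h).trans h'

end ProbTM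

namespace StackProg

variable {A : Type} {N : ℕ} {Λ : Type}

/-- The stacks of the translated machine. -/
def stkOf (N : ℕ) (i : List (Option Bool)) (o r : List Bool) (S : ℕ → List A) :
    ∀ k, List (Sy A N k)
  | .inp => i
  | .out => o
  | .record => r
  | .reg k => S k

theorem stkOf_rg {k : ℕ} (hk : k < N + 1) (i o r) (S : ℕ → List A) :
    stkOf N i o r S (rg N k) = S k := by
  simp [stkOf, rg, Nat.mod_eq_of_lt hk]

theorem update_stkOf_rg {k : ℕ} (hk : k < N + 1) (i o r) (S : ℕ → List A) (w : List A) :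
    Function.update (stkOf N i o r S) (rg N k) w = stkOf N i o r (Function.update S k w) := by
  funext x
  rcases x with _ | _ | _ | j
  · rfl
  · rfl
  · rfl
  · by_cases h : j = Fin.ofNat (N + 1) k
    · subst h
      simp [rg, stkOf, Nat.mod_eq_of_lt hk]
    · have h2 : (j : ℕ) ≠ k := by
        rintro rfl
        apply h
        ext
        simp
      have h3 : (Stk.reg j : Stk N) ≠ rg N k := by
        simpa [rg] using h
      refine (Function.update_of_ne (f := stkOf N i o r S) h3 w).trans ?_
      simp [stkOf, Function.update_of_ne h2]

theorem update_stkOf_inp (i i' o r) (S : ℕ → List A) :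
    Function.update (stkOf N i o r S) .inp i' = stkOf N i' o r S := by
  funext x
  rcases x with _ | _ | _ | j <;> simp [stkOf]

theorem update_stkOf_out (i o o' r) (S : ℕ → List A) :
    Function.update (stkOf N i o r S) .out o' = stkOf N i o' r S := by
  funext x
  rcases x with _ | _ | _ | j <;> simp [stkOf]

theorem update_stkOf_record (i o r r') (S : ℕ → List A) :
    Function.update (stkOf N i o r S) .record r' = stkOf N i o r' S := by
  funext x
  rcases x with _ | _ | _ | j <;> simp [stkOf]

variable [Fintype Λ] {main : Λ} {m : Λ → Stmt A N Λ}

abbrev cfg (main : Λ) (m : Λ → Stmt A N Λ) (l : Option Λ) (v : Bool × Λ) (i : List (Option Bool))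
    (o r : List Bool) (S : ℕ → List A) : (machine A N main m).Config :=
  ⟨l, v, stkOf N i o r S⟩

/-- The bit is put into the state before the statement is executed, so the recorded bit is the one
of this very step. The additional push belongs to the same step and costs no random bit. -/
theorem step_recording {f : Bool} {l : Λ} {s : Stmt A N Λ} (h : m l = recording f s) (b v i o r)
    (S : ℕ → List A) :
    (machine A N main m).step b (cfg main m (some l) v i o r S) =
      some (Turing.TM2.stepAux s (b, v.2) (stkOf N i o (if f then b :: r else r) S)) := by
  have : (machine A N main m).step b (cfg main m (some l) v i o r S) =
      some (Turing.TM2.stepAux (m l) (b, v.2) (stkOf N i o r S)) := rfl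
  rw [this, h]
  cases f
  · rfl
  · simp only [recording, if_true, Turing.TM2.stepAux]
    congr 2
    exact update_stkOf_record i o r _ S

/-- The translated machine carries out the program. -/
theorem Exec.steps (f : Bool) {p : StackProg A} {S S' : ℕ → List A} {t : ℕ} (hE : Exec p S t S') :
    ∀ (e : Label p → Λ) (exit : Λ), (∀ l, m (e l) = recording f (code p e exit l)) →
    Below (N + 1) p → ∀ (ω : List Bool), ω.length = t → ∀ v i o r, ∃ v',
    (machine A N main m).Steps (cfg main m (some (e (entry p))) v i o r S) ω
      (cfg main m (some exit) v' i o (if f then ω.reverse ++ r else r) S') := by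
  induction hE with
  | skip S =>
    intro e exit hm hB ω hω v i o r
    obtain ⟨b, rfl⟩ := List.length_eq_one_iff.1 hω
    refine ⟨(b, v.2), ProbTM.Steps.single ?_⟩
    rw [step_recording (hm _)]
    cases f <;> rfl
  | push k a S =>
    intro e exit hm hB ω hω v i o r
    obtain ⟨b, rfl⟩ := List.length_eq_one_iff.1 hω
    refine ⟨(b, v.2), ProbTM.Steps.single ?_⟩
    rw [step_recording (hm _)]
    simp only [code, Turing.TM2.stepAux]
    rw [stkOf_rg hB]
    erw [update_stkOf_rg hB]
    cases f <;> rfl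
  | pop k S =>
    intro e exit hm hB ω hω v i o r
    obtain ⟨b, rfl⟩ := List.length_eq_one_iff.1 hω
    refine ⟨(b, v.2), ProbTM.Steps.single ?_⟩
    rw [step_recording (hm _)]
    simp only [code, Turing.TM2.stepAux]
    rw [stkOf_rg hB]
    erw [update_stkOf_rg hB]
    cases f <;> rfl
  | @seq p q S t S' t' S'' h1 h2 ih1 ih2 =>
    intro e exit hm hB ω hω v i o r
    obtain ⟨ω1, ω2, rfl, h3, h4⟩ : ∃ ω1 ω2, ω = ω1 ++ ω2 ∧ ω1.length = t ∧ ω2.length = t' :=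
      ⟨ω.take t, ω.drop t, by simp, by simp; omega, by simp; omega⟩
    obtain ⟨v1, hv1⟩ := ih1 (e ∘ Sum.inl) (e (Sum.inr (entry q))) (fun l => hm (Sum.inl l)) hB.1 ω1
      h3 v i o r
    obtain ⟨v2, hv2⟩ := ih2 (e ∘ Sum.inr) exit (fun l => hm (Sum.inr l)) hB.2 ω2 h4 v1 i o
      (if f then ω1.reverse ++ r else r)
    refine ⟨v2, ?_⟩
    have := hv1.trans hv2
    cases f
    · exact this
    · simp only [if_true, List.reverse_append, List.append_assoc] at this ⊢
      exact this
  | @case k ι hι c p S t S' j hc h1 ih1 =>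
    intro e exit hm hB ω hω v i o r
    obtain ⟨b, ω1, rfl⟩ : ∃ b ω1, ω = b :: ω1 := List.exists_cons_of_length_eq_add_one
      (n := t) (by omega)
    obtain ⟨v1, hv1⟩ := ih1 (fun l => e (some ⟨j, l⟩)) exit (fun l => hm (some ⟨j, l⟩)) (hB.2 j) ω1
      (by simpa [add_comm] using hω) (b, e (some ⟨j, entry (p j)⟩)) i o (if f then b :: r else r)
    refine ⟨v1, ProbTM.Steps.cons (c' := cfg main m (some (e (some ⟨j, entry (p j)⟩)))
      (b, e (some ⟨j, entry (p j)⟩)) i o (if f then b :: r else r) S) ?_ (by cases f <;> simpa using hv1)⟩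
    rw [step_recording (hm _)]
    simp only [entry, code, Turing.TM2.stepAux]
    rw [stkOf_rg hB.1]
    erw [hc]
    cases f <;> rfl
  | @loop_none k ι hι c p S hc =>
    intro e exit hm hB ω hω v i o r
    obtain ⟨b, rfl⟩ := List.length_eq_one_iff.1 hω
    refine ⟨(b, exit), ProbTM.Steps.single ?_⟩
    rw [step_recording (hm _)]
    simp only [entry, code, Turing.TM2.stepAux]
    rw [stkOf_rg hB.1]
    erw [hc]
    cases f <;> rfl
  | @loop_some k ι hι c p S t S' t' S'' j hc h1 h2 ih1 ih2 =>
    intro e exit hm hB ω hω v i o r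
    obtain ⟨b, ω0, rfl⟩ : ∃ b ω1, ω = b :: ω1 := List.exists_cons_of_length_eq_add_one
      (n := t + t') (by omega)
    obtain ⟨ω1, ω2, rfl, h3, h4⟩ : ∃ ω1 ω2, ω0 = ω1 ++ ω2 ∧ ω1.length = t ∧ ω2.length = t' := by
      simp at hω
      exact ⟨ω0.take t, ω0.drop t, by simp, by simp; omega, by simp; omega⟩
    obtain ⟨v1, hv1⟩ := ih1 (fun l => e (some ⟨j, l⟩)) (e none) (fun l => hm (some ⟨j, l⟩)) (hB.2 j)
      ω1 h3 (b, e (some ⟨j, entry (p j)⟩)) i o (if f then b :: r else r)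
    obtain ⟨v2, hv2⟩ := ih2 e exit hm hB ω2 h4 v1 i o
      (if f then ω1.reverse ++ b :: r else r)
    refine ⟨v2, ProbTM.Steps.cons (c' := cfg main m (some (e (some ⟨j, entry (p j)⟩)))
      (b, e (some ⟨j, entry (p j)⟩)) i o (if f then b :: r else r) S) ?_
      (ProbTM.Steps.trans (c' := cfg main m (some (e none)) v1 i o
        (if f then ω1.reverse ++ b :: r else r) S') (by cases f <;> simpa using hv1)
        (by cases f <;> simpa [entry] using hv2))⟩
    rw [step_recording (hm _)]
    simp only [entry, code, Turing.TM2.stepAux]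
    rw [stkOf_rg hB.1]
    erw [hc]
    cases f <;> rfl

end StackProg

namespace StackProg

/-! ## Machines with input and output -/

/-- Finitely many words as the contents of the stacks. -/
def st {A : Type} (l : List (List A)) : ℕ → List A := fun j => l.getD j []

/-- Word over `{0, 1, #}` as stack contents. -/
abbrev wd {B : Type} (w : List (Option Bool)) : List (Option Bool ⊕ B) := w.map Sum.inl

/-- Control labels outside the two programs. -/
inductive Phase
  | init | load (s : Option Bool)
  | move | moved (b : Bool)
  | write | wrote (b : Bool)
  | finish
  deriving Fintype

variable {B : Type} {N : ℕ}

/-- The machine reads the input, runs `p` and meanwhile records all random bits, then moves the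
recorded bits to register `1`, runs `q` and outputs the bits in register `0`. -/
def ioCode (N : ℕ) (p q : StackProg (Option Bool ⊕ B)) : Label p ⊕ Label q ⊕ Phase →
    Stmt (Option Bool ⊕ B) N (Label p ⊕ Label q ⊕ Phase)
  | .inl l => recording true (code p .inl (.inr (.inr .move)) l)
  | .inr (.inl l) => recording false (code q (fun l => .inr (.inl l)) (.inr (.inr .write)) l)
  | .inr (.inr .init) => recording true (.pop .inp (fun v o => (v.1, match o with
      | none => .inl (entry p)
      | some s => .inr (.inr (.load s)))) (.goto fun v => v.2))
  | .inr (.inr (.load s)) => recording true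
      (.push (rg N 0) (fun _ => Sum.inl s) (.goto fun _ => .inr (.inr .init)))
  | .inr (.inr .move) => recording false (.pop .record (fun v o => (v.1, match o with
      | none => .inr (.inl (entry q))
      | some s => .inr (.inr (.moved s)))) (.goto fun v => v.2))
  | .inr (.inr (.moved b)) => recording false
      (.push (rg N 1) (fun _ => Sum.inl (some b)) (.goto fun _ => .inr (.inr .move)))
  | .inr (.inr .write) => recording false (.pop (rg N 0) (fun v o => (v.1, match o with
      | some (Sum.inl (some b)) => .inr (.inr (.wrote b))
      | _ => .inr (.inr .finish))) (.goto fun v => v.2))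
  | .inr (.inr (.wrote b)) => recording false
      (.push .out (fun _ => b) (.goto fun _ => .inr (.inr .write)))
  | .inr (.inr .finish) => .halt

def ioMachine (N : ℕ) (p q : StackProg (Option Bool ⊕ B)) : ProbTM :=
  machine (Option Bool ⊕ B) N (.inr (.inr .init)) (ioCode N p q)

variable {p q : StackProg (Option Bool ⊕ B)}

abbrev ioCfg (N : ℕ) (p q : StackProg (Option Bool ⊕ B)) (l : Option (Label p ⊕ Label q ⊕ Phase))
    (v : Bool × (Label p ⊕ Label q ⊕ Phase)) (i : List (Option Bool)) (o r : List Bool)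
    (S : ℕ → List (Option Bool ⊕ B)) : (ioMachine N p q).Config :=
  ⟨l, v, stkOf N i o r S⟩

theorem io_step {f : Bool} {l : Label p ⊕ Label q ⊕ Phase}
    {s : Stmt (Option Bool ⊕ B) N (Label p ⊕ Label q ⊕ Phase)}
    (h : ioCode N p q l = recording f s) (b v i o r) (S : ℕ → List (Option Bool ⊕ B)) :
    (ioMachine N p q).step b (ioCfg N p q (some l) v i o r S) =
      some (Turing.TM2.stepAux s (b, v.2) (stkOf N i o (if f then b :: r else r) S)) :=
  step_recording h b v i o r S

/-- Each letter costs a pop and a push, since it has to be remembered in the label in between; the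
last step is the pop that finds the input empty. The input arrives reversed, and so do the random
bits on the record. -/
theorem io_read : ∀ (w : List (Option Bool)) (ω : List Bool), ω.length = 2 * w.length + 1 →
    ∀ v o r (S : ℕ → List (Option Bool ⊕ B)), ∃ v', (ioMachine N p q).Steps
      (ioCfg N p q (some (.inr (.inr .init))) v w o r S) ω
      (ioCfg N p q (some (.inl (entry p))) v' [] o (ω.reverse ++ r)
        (Function.update S 0 (wd w.reverse ++ S 0)))
  | [], ω, hω, v, o, r, S => by
    obtain ⟨b, rfl⟩ := List.length_eq_one_iff.1 hω
    refine ⟨(b, .inl (entry p)), ProbTM.Steps.single ?_⟩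
    refine (io_step (f := true) rfl _ _ _ _ _ _).trans ?_
    simp only [if_true, Turing.TM2.stepAux]
    erw [update_stkOf_inp]
    simp [stkOf]
    rfl
  | s :: w, ω, hω, v, o, r, S => by
    obtain ⟨b, b', ω', rfl⟩ : ∃ b b' ω', ω = b :: b' :: ω' := by
      match ω, hω with
      | [], h => simp at h
      | [_], h => simp at h
      | b :: b' :: ω', _ => exact ⟨b, b', ω', rfl⟩
    obtain ⟨v', hv'⟩ := io_read w ω' (by simp at hω; omega) (b', .inr (.inr (.load s))) o
      (b' :: b :: r) (Function.update S 0 (Sum.inl s :: S 0))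
    refine ⟨v', ProbTM.Steps.cons (c' := ioCfg N p q (some (.inr (.inr (.load s))))
      (b, .inr (.inr (.load s))) w o (b :: r) S) ?_ (ProbTM.Steps.cons
        (c' := ioCfg N p q (some (.inr (.inr .init))) (b', .inr (.inr (.load s))) w o
          (b' :: b :: r) (Function.update S 0 (Sum.inl s :: S 0))) ?_ (by simpa using hv'))⟩
    · refine (io_step (f := true) rfl _ _ _ _ _ _).trans ?_
      simp only [if_true, Turing.TM2.stepAux]
      erw [update_stkOf_inp]
      rfl
    · refine (io_step (f := true) rfl _ _ _ _ _ _).trans ?_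
      simp only [if_true, Turing.TM2.stepAux]
      rw [stkOf_rg (by omega)]
      erw [update_stkOf_rg (by omega)]
      rfl

/-- Emptying the record reverses it once more, so that the oldest random bit ends on top of register
`1`. -/
theorem io_move (hN : 1 ≤ N) : ∀ (r ω : List Bool), ω.length = 2 * r.length + 1 →
    ∀ v i o (S : ℕ → List (Option Bool ⊕ B)), ∃ v', (ioMachine N p q).Steps
      (ioCfg N p q (some (.inr (.inr .move))) v i o r S) ω
      (ioCfg N p q (some (.inr (.inl (entry q)))) v' i o []
        (Function.update S 1 (wd (r.reverse.map some) ++ S 1)))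
  | [], ω, hω, v, i, o, S => by
    obtain ⟨b, rfl⟩ := List.length_eq_one_iff.1 hω
    refine ⟨(b, .inr (.inl (entry q))), ProbTM.Steps.single ?_⟩
    refine (io_step (f := false) rfl _ _ _ _ _ _).trans ?_
    simp only [recording, Bool.false_eq_true, if_false, Turing.TM2.stepAux]
    erw [update_stkOf_record]
    simp [stkOf]
    rfl
  | s :: r, ω, hω, v, i, o, S => by
    obtain ⟨b, b', ω', rfl⟩ : ∃ b b' ω', ω = b :: b' :: ω' := by
      match ω, hω with
      | [], h => simp at h
      | [_], h => simp at h
      | b :: b' :: ω', _ => exact ⟨b, b', ω', rfl⟩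
    obtain ⟨v', hv'⟩ := io_move hN r ω' (by simp at hω; omega) (b', .inr (.inr (.moved s))) i o
      (Function.update S 1 (Sum.inl (some s) :: S 1))
    refine ⟨v', ProbTM.Steps.cons (c' := ioCfg N p q (some (.inr (.inr (.moved s))))
      (b, .inr (.inr (.moved s))) i o r S) ?_ (ProbTM.Steps.cons
        (c' := ioCfg N p q (some (.inr (.inr .move))) (b', .inr (.inr (.moved s))) i o
          r (Function.update S 1 (Sum.inl (some s) :: S 1))) ?_ (by simpa using hv'))⟩
    · refine (io_step (f := false) rfl _ _ _ _ _ _).trans ?_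
      simp only [recording, Bool.false_eq_true, if_false, Turing.TM2.stepAux]
      erw [update_stkOf_record]
      rfl
    · refine (io_step (f := false) rfl _ _ _ _ _ _).trans ?_
      simp only [recording, Bool.false_eq_true, if_false, Turing.TM2.stepAux]
      rw [stkOf_rg (by omega)]
      erw [update_stkOf_rg (by omega)]
      rfl

/-- Writing reverses the word, so the second program has to leave its output reversed. The two extra
steps are the pop that finds no further bit and the halting step. -/
theorem io_write : ∀ (u ω : List Bool), ω.length = 2 * u.length + 2 →
    ∀ v i o r (S : ℕ → List (Option Bool ⊕ B)), S 0 = wd (u.map some) →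
    ∃ v' S', (ioMachine N p q).Steps
      (ioCfg N p q (some (.inr (.inr .write))) v i o r S) ω
      (ioCfg N p q none v' i (u.reverse ++ o) r S')
  | [], ω, hω, v, i, o, r, S, hS => by
    obtain ⟨b, b', rfl⟩ : ∃ b b', ω = [b, b'] := List.length_eq_two.1 hω
    refine ⟨(b', .inr (.inr .finish)), Function.update S 0 [],
      ProbTM.Steps.cons (c' := ioCfg N p q (some (.inr (.inr .finish))) (b, .inr (.inr .finish)) i o r
        (Function.update S 0 [])) ?_ (ProbTM.Steps.single ?_)⟩
    · refine (io_step (f := false) rfl _ _ _ _ _ _).trans ?_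
      simp only [recording, Bool.false_eq_true, if_false, Turing.TM2.stepAux]
      rw [stkOf_rg (by omega)]
      erw [update_stkOf_rg (by omega), hS]
      rfl
    · rfl
  | s :: u, ω, hω, v, i, o, r, S, hS => by
    obtain ⟨b, b', ω', rfl⟩ : ∃ b b' ω', ω = b :: b' :: ω' := by
      match ω, hω with
      | [], h => simp at h
      | [_], h => simp at h
      | b :: b' :: ω', _ => exact ⟨b, b', ω', rfl⟩
    obtain ⟨v', S', hv'⟩ := io_write u ω' (by simp at hω; omega) (b', .inr (.inr (.wrote s))) i
      (s :: o) r (Function.update S 0 (wd (u.map some))) (by simp)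
    refine ⟨v', S', ProbTM.Steps.cons (c' := ioCfg N p q (some (.inr (.inr (.wrote s))))
      (b, .inr (.inr (.wrote s))) i o r (Function.update S 0 (wd (u.map some)))) ?_
        (ProbTM.Steps.cons
        (c' := ioCfg N p q (some (.inr (.inr .write))) (b', .inr (.inr (.wrote s))) i (s :: o)
          r (Function.update S 0 (wd (u.map some)))) ?_ (by simpa using hv'))⟩
    · refine (io_step (f := false) rfl _ _ _ _ _ _).trans ?_
      simp only [recording, Bool.false_eq_true, if_false, Turing.TM2.stepAux]
      rw [stkOf_rg (by omega)]
      erw [update_stkOf_rg (by omega), hS]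
      rfl
    · refine (io_step (f := false) rfl _ _ _ _ _ _).trans ?_
      simp only [recording, Bool.false_eq_true, if_false, Turing.TM2.stepAux]
      erw [update_stkOf_out]
      rfl

theorem ioMachine_start (w : List (Option Bool)) :
    (ioMachine N p q).start w =
      ioCfg N p q (some (.inr (.inr .init))) (false, .inr (.inr .init)) w [] [] (st []) := by
  have : ∀ x, ((ioMachine N p q).start w).stk x = stkOf N w [] [] (st []) x := by
    intro x
    rcases x with _ | _ | _ | j
    · exact List.map_id w
    · rfl
    · rfl
    · simp [stkOf, st]
      rfl
  exact congrArg (fun s => (⟨some (.inr (.inr .init)), (false, .inr (.inr .init)), s⟩ :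
    (ioMachine N p q).Config)) (funext this)

theorem _root_.List.exists_append_of_le_length {α : Type*} {l : List α} {n : ℕ} (h : n ≤ l.length) :
    ∃ a b, l = a ++ b ∧ a.length = n :=
  ⟨l.take n, l.drop n, by simp, by simpa using h⟩

/-- The behaviour of `ioMachine`. -/
theorem ioMachine_result (hN : 1 ≤ N) (hp : Below (N + 1) p) (hq : Below (N + 1) q)
    {w : List (Option Bool)} {t₁ T U : ℕ} {S₁ : ℕ → List (Option Bool ⊕ B)}
    (h₁ : Exec p (st [wd w.reverse]) t₁ S₁) (hS₁ : S₁ 1 = []) {g : List Bool → List Bool}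
    (h₂ : ∀ ω : List Bool, ω.length = 2 * w.length + 1 + t₁ → (g ω).length ≤ U ∧
      ∃ t₂ ≤ T, ∃ S₂, Exec q (Function.update S₁ 1 (wd (ω.map some))) t₂ S₂ ∧
        S₂ 0 = wd ((g ω).reverse.map some))
    {r : List Bool} (hr : 3 * (2 * w.length + 1 + t₁) + 1 + T + (2 * U + 2) ≤ r.length) :
    ((ioMachine N p q).run w r).1.l = none ∧
      ((ioMachine N p q).result w r).1 = g (r.take (2 * w.length + 1 + t₁)) ∧
      ((ioMachine N p q).result w r).2 <+: r ∧
      2 * w.length + 1 + t₁ ≤ ((ioMachine N p q).result w r).2.length := by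
  -- The tape is cut according to the five stages: reading the input, running `p`, moving the
  -- record, running `q`, writing. The remainder `r₄` is never read.
  obtain ⟨ω₀, r₀, rfl, l₀⟩ : ∃ a b, r = a ++ b ∧ a.length = 2 * w.length + 1 :=
    List.exists_append_of_le_length (by omega)
  obtain ⟨ω₁, r₁, rfl, l₁⟩ : ∃ a b, r₀ = a ++ b ∧ a.length = t₁ :=
    List.exists_append_of_le_length (by simp only [List.length_append] at hr; omega)
  obtain ⟨hU, t₂, ht₂, S₂, hE, hS₂⟩ := h₂ (ω₀ ++ ω₁) (by simp [l₀, l₁])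
  obtain ⟨ω₂, r₂, rfl, l₂⟩ : ∃ a b, r₁ = a ++ b ∧ a.length = 2 * (2 * w.length + 1 + t₁) + 1 :=
    List.exists_append_of_le_length (by simp only [List.length_append] at hr; omega)
  obtain ⟨ω₃, r₃, rfl, l₃⟩ : ∃ a b, r₂ = a ++ b ∧ a.length = t₂ :=
    List.exists_append_of_le_length (by simp only [List.length_append] at hr; omega)
  obtain ⟨ω₄, r₄, rfl, l₄⟩ : ∃ a b, r₃ = a ++ b ∧ a.length = 2 * (g (ω₀ ++ ω₁)).length + 2 :=
    List.exists_append_of_le_length (by simp only [List.length_append] at hr; omega)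
  obtain ⟨v₀, e₀⟩ := io_read (p := p) (q := q) (N := N) w ω₀ l₀ (false, .inr (.inr .init)) [] []
    (st [])
  have hst : Function.update (st []) 0 (wd w.reverse ++ st [] 0) =
      st [(wd w.reverse : List (Option Bool ⊕ B))] := by
    funext j
    rcases j with _ | j <;> simp [st]
  rw [hst] at e₀
  obtain ⟨v₁, e₁⟩ := h₁.steps (main := .inr (.inr .init)) (m := ioCode N p q) true .inl
    (.inr (.inr .move)) (fun _ => rfl) hp ω₁ l₁ v₀ [] [] (ω₀.reverse ++ [])
  obtain ⟨v₂, e₂⟩ := io_move (p := p) (q := q) hN (ω₁.reverse ++ (ω₀.reverse ++ [])) ω₂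
    (by simp [l₀, l₁, l₂]; omega) v₁ [] [] S₁
  simp only [hS₁, List.append_nil, List.reverse_append, List.reverse_reverse, if_true] at e₀ e₁ e₂
  obtain ⟨v₃, e₃⟩ := hE.steps (main := .inr (.inr .init)) (m := ioCode N p q) false
    (fun l => .inr (.inl l)) (.inr (.inr .write)) (fun _ => rfl) hq ω₃ l₃ v₂ [] [] []
  obtain ⟨v₄, S₄, e₄⟩ := io_write (p := p) (q := q) (N := N) (g (ω₀ ++ ω₁)).reverse ω₄
    (by simp [l₄]) v₃ [] [] [] S₂ hS₂
  have e := (((ProbTM.Steps.trans e₀ e₁).trans e₂).trans e₃).trans e₄ r₄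
  have hrun : (ioMachine N p q).run w (ω₀ ++ (ω₁ ++ (ω₂ ++ (ω₃ ++ (ω₄ ++ r₄))))) =
      (ioCfg N p q none v₄ [] (g (ω₀ ++ ω₁)) [] S₄, ω₀ ++ (ω₁ ++ (ω₂ ++ (ω₃ ++ ω₄)))) := by
    rw [ProbTM.run, ioMachine_start]
    simp only [List.append_assoc] at e
    rw [e]
    have hend : ∀ r v S, (ioMachine N p q).runFrom (ioCfg N p q none v [] (g (ω₀ ++ ω₁)) [] S) r =
        (ioCfg N p q none v [] (g (ω₀ ++ ω₁)) [] S, []) := by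
      intro r v S
      cases r <;> rfl
    have hrev : (g (ω₀ ++ ω₁)).reverse.reverse ++ [] = g (ω₀ ++ ω₁) := by simp
    rw [hrev, hend]
    exact Prod.ext rfl (by simp)
  refine ⟨by rw [hrun]; rfl, ?_, ?_, ?_⟩
  · rw [ProbTM.result, hrun]
    have : (ω₀ ++ (ω₁ ++ (ω₂ ++ (ω₃ ++ (ω₄ ++ r₄))))).take (2 * w.length + 1 + t₁) = ω₀ ++ ω₁ := by
      rw [← List.append_assoc]
      exact List.take_left' (by simp [l₀, l₁])
    rw [this]
    exact List.map_id _
  · rw [ProbTM.result, hrun]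
    exact ⟨r₄, by simp⟩
  · rw [ProbTM.result, hrun]
    simp [l₀, l₁]

end StackProg

namespace StackProg

variable {A B : Type}

/-! ## Running times, words in the registers -/

/-- One step adds at most one symbol. Used in both directions: running time bounds the size of
results, and a long result forces a long running time. -/
theorem Exec.length_le {p : StackProg A} {S S' : ℕ → List A} {t : ℕ} (h : Exec p S t S') (k : ℕ) :
    (S' k).length ≤ (S k).length + t := by
  induction h with
  | skip S => omega
  | push j a S => by_cases hk : k = j <;> simp [hk]
  | pop j S =>
    by_cases hk : k = j
    · subst hk
      simp
      omega
    · simp [hk]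
  | seq _ _ h1 h2 => omega
  | case _ _ _ h1 => omega
  | loop_none _ => omega
  | loop_some _ _ _ _ h1 h2 => omega

/-- Renumbering of the registers. -/
def shift (d : ℕ) : StackProg A → StackProg A
  | skip => skip
  | push k a => push (d + k) a
  | pop k => pop (d + k)
  | seq p q => seq (shift d p) (shift d q)
  | case k hι c p => case (d + k) hι c fun i => shift d (p i)
  | loop k hι c p => loop (d + k) hι c fun i => shift d (p i)

/-- The first `d` registers are a store that a program shifted by `d` cannot touch, which allows it
to be run as a subroutine. -/
def place (d : ℕ) (R S : ℕ → List A) : ℕ → List A := fun j => if j < d then R j else S (j - d)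

theorem place_add (d : ℕ) (R S : ℕ → List A) (k : ℕ) : place d R S (d + k) = S k := by
  simp [place]

theorem update_place (d : ℕ) (R S : ℕ → List A) (k : ℕ) (w : List A) :
    Function.update (place d R S) (d + k) w = place d R (Function.update S k w) := by
  funext j
  by_cases hj : j < d
  · rw [Function.update_of_ne (by omega)]
    simp [place, hj]
  · obtain ⟨i, rfl⟩ := Nat.exists_eq_add_of_le (not_lt.1 hj)
    by_cases hi : i = k
    · subst hi
      simp [place_add]
    · rw [Function.update_of_ne (by omega), place_add, place_add, Function.update_of_ne hi]

theorem Exec.shift (d : ℕ) (R : ℕ → List A) {p : StackProg A} {S S' : ℕ → List A} {t : ℕ}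
    (h : Exec p S t S') : Exec (p.shift d) (place d R S) t (place d R S') := by
  induction h with
  | skip S => exact .skip _
  | push j a S =>
    have := Exec.push (d + j) a (place d R S)
    rwa [place_add, update_place] at this
  | pop j S =>
    have := Exec.pop (d + j) (place d R S)
    rwa [place_add, update_place] at this
  | seq _ _ h1 h2 => exact .seq h1 h2
  | case i hc _ h1 => exact .case i (by rwa [place_add]) h1
  | loop_none hc => exact .loop_none (by rwa [place_add])
  | loop_some i hc _ _ h1 h2 => exact .loop_some i (by rwa [place_add]) h1 h2

/-- The program `p` leads from `S` to `S'` within `T` steps. -/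
def Runs (p : StackProg A) (S : ℕ → List A) (T : ℕ) (S' : ℕ → List A) : Prop :=
  ∃ t ≤ T, Exec p S t S'

theorem Exec.runs {p : StackProg A} {S S' : ℕ → List A} {t : ℕ} (h : Exec p S t S') :
    Runs p S t S' := ⟨t, le_rfl, h⟩

theorem Runs.mono {p : StackProg A} {S S' : ℕ → List A} {T T' : ℕ} (h : Runs p S T S')
    (hT : T ≤ T') : Runs p S T' S' :=
  let ⟨t, ht, hE⟩ := h
  ⟨t, ht.trans hT, hE⟩

theorem Runs.seq {p q : StackProg A} {S S' S'' : ℕ → List A} {T T' : ℕ} (h : Runs p S T S')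
    (h' : Runs q S' T' S'') : Runs (p.seq q) S (T + T') S'' :=
  let ⟨t, ht, hE⟩ := h
  let ⟨t', ht', hE'⟩ := h'
  ⟨t + t', add_le_add ht ht', hE.seq hE'⟩

theorem Runs.shift {p : StackProg A} {S S' : ℕ → List A} {T : ℕ} (h : Runs p S T S') (d : ℕ)
    (R : ℕ → List A) : Runs (p.shift d) (place d R S) T (place d R S') :=
  let ⟨t, ht, hE⟩ := h
  ⟨t, ht, hE.shift d R⟩

theorem Runs.case {k : ℕ} {ι : Type} {hι : Fintype ι} {c : Option A → ι} {p : ι → StackProg A}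
    {S S' : ℕ → List A} {T : ℕ} (i : ι) (hc : c (S k).head? = i) (h : Runs (p i) S T S') :
    Runs (case k hι c p) S (1 + T) S' :=
  let ⟨t, ht, hE⟩ := h
  ⟨1 + t, by omega, hE.case i hc⟩

theorem Runs.loop_some {k : ℕ} {ι : Type} {hι : Fintype ι} {c : Option A → Option ι}
    {p : ι → StackProg A} {S S' S'' : ℕ → List A} {T T' : ℕ} (i : ι) (hc : c (S k).head? = some i)
    (h : Runs (p i) S T S') (h' : Runs (loop k hι c p) S' T' S'') :
    Runs (loop k hι c p) S (1 + (T + T')) S'' :=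
  let ⟨t, ht, hE⟩ := h
  let ⟨t', ht', hE'⟩ := h'
  ⟨1 + (t + t'), by omega, .loop_some i hc hE hE'⟩

/-- `Runs` for registers holding words over `{0, 1, #}`. -/
def WRuns (p : StackProg (Option Bool ⊕ B)) (S : ℕ → List (Option Bool)) (T : ℕ)
    (S' : ℕ → List (Option Bool)) : Prop :=
  Runs p (fun j => wd (S j)) T fun j => wd (S' j)

theorem update_wd (S : ℕ → List (Option Bool)) (k : ℕ) (w : List (Option Bool)) :
    Function.update (fun j => (wd (S j) : List (Option Bool ⊕ B))) k (wd w) =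
      fun j => wd (Function.update S k w j) := by
  funext j
  by_cases h : j = k
  · subst h
    simp
  · simp [h]

theorem WRuns.push (k : ℕ) (s : Option Bool) (S : ℕ → List (Option Bool)) :
    WRuns (B := B) (push k (Sum.inl s)) S 1 (Function.update S k (s :: S k)) := by
  have := (Exec.push k (Sum.inl s) fun j => (wd (S j) : List (Option Bool ⊕ B))).runs
  rwa [show (Sum.inl s :: wd (S k) : List (Option Bool ⊕ B)) = wd (s :: S k) from rfl,
    update_wd] at this

theorem WRuns.pop (k : ℕ) (S : ℕ → List (Option Bool)) :
    WRuns (B := B) (pop k) S 1 (Function.update S k (S k).tail) := by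
  have := (Exec.pop k fun j => (wd (S j) : List (Option Bool ⊕ B))).runs
  rwa [show ((wd (S k)).tail : List (Option Bool ⊕ B)) = wd (S k).tail by simp [wd],
    update_wd] at this

theorem WRuns.loop_some {k : ℕ} {ι : Type} {hι : Fintype ι}
    {c : Option (Option Bool ⊕ B) → Option ι} {p : ι → StackProg (Option Bool ⊕ B)}
    {S S' S'' : ℕ → List (Option Bool)} {T T' : ℕ} (i : ι)
    (hc : c (wd (B := B) (S k)).head? = some i)
    (h : WRuns (p i) S T S') (h' : WRuns (loop k hι c p) S' T' S'') :
    WRuns (loop k hι c p) S (1 + (T + T')) S'' :=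
  Runs.loop_some i hc h h'

theorem WRuns.case {k : ℕ} {ι : Type} {hι : Fintype ι} {c : Option (Option Bool ⊕ B) → ι}
    {p : ι → StackProg (Option Bool ⊕ B)} {S S' : ℕ → List (Option Bool)} {T : ℕ} (i : ι)
    (hc : c (wd (B := B) (S k)).head? = i) (h : WRuns (p i) S T S') :
    WRuns (case k hι c p) S (1 + T) S' :=
  Runs.case i hc h

theorem WRuns.loop_none {k : ℕ} {ι : Type} {hι : Fintype ι}
    {c : Option (Option Bool ⊕ B) → Option ι} {p : ι → StackProg (Option Bool ⊕ B)}
    {S : ℕ → List (Option Bool)} (hc : c (wd (B := B) (S k)).head? = none) :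
    WRuns (loop k hι c p) S 1 S :=
  (Exec.loop_none hc).runs

theorem WRuns.congr {p : StackProg (Option Bool ⊕ B)} {S S' S'' : ℕ → List (Option Bool)}
    {T T' : ℕ} (h : WRuns p S T S') (hT : T ≤ T') (hS : S' = S'') : WRuns p S T' S'' :=
  hS ▸ Runs.mono h hT

theorem st_apply {α : Type} (l : List (List α)) (k : ℕ) : st l k = l.getD k [] := rfl

theorem update_st {α : Type} {l : List (List α)} {k : ℕ} (hk : k < l.length) (w : List α) :
    Function.update (st l) k w = st (l.set k w) := by
  funext j
  by_cases h : j = k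
  · subst h
    simp [st, hk]
  · simp [h, st, List.getElem?_set_ne (Ne.symm h)]

/-- Empty registers at the end can be added or dropped, so a program may borrow fresh registers
whenever it needs them. -/
theorem st_append_nil {α : Type} (l : List (List α)) : st (l ++ [[]]) = st l := by
  funext j
  rcases lt_trichotomy j l.length with h | h | h
  · simp [st, List.getElem?_append_left h]
  · subst h
    simp [st]
  · rw [st_apply, st_apply, List.getD_eq_default _ _ (by simpa using h),
      List.getD_eq_default _ _ h.le]

theorem place_st {α : Type} (R l : List (List α)) : place R.length (st R) (st l) = st (R ++ l) := by
  funext j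
  by_cases h : j < R.length
  · simp [place, h, st, List.getElem?_append_left h]
  · simp [place, h, st, List.getElem?_append_right (not_lt.1 h)]

theorem wd_st (l : List (List (Option Bool))) :
    (fun j => (wd (st l j) : List (Option Bool ⊕ B))) = st (l.map wd) := by
  funext j
  simp only [st, List.getD_eq_getElem?_getD, List.getElem?_map]
  cases l[j]? <;> simp

theorem WRuns.shift {p : StackProg (Option Bool ⊕ B)} {l l' : List (List (Option Bool))} {T : ℕ}
    (h : WRuns p (st l) T (st l')) (R : List (List (Option Bool))) :
    WRuns (p.shift R.length) (st (R ++ l)) T (st (R ++ l')) := by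
  have := Runs.shift h R.length fun j => wd (st R j)
  unfold WRuns
  rw [wd_st, wd_st, wd_st] at this
  rw [wd_st, wd_st, List.map_append, List.map_append, ← place_st, ← place_st]
  simpa using this

theorem WRuns.mono {p : StackProg (Option Bool ⊕ B)} {S S' : ℕ → List (Option Bool)} {T T' : ℕ}
    (h : WRuns p S T S') (hT : T ≤ T') : WRuns p S T' S' := Runs.mono h hT

theorem WRuns.seq {p q : StackProg (Option Bool ⊕ B)} {S S' S'' : ℕ → List (Option Bool)}
    {T T' : ℕ} (h : WRuns p S T S') (h' : WRuns q S' T' S'') :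
    WRuns (p.seq q) S (T + T') S'' := Runs.seq h h'

/-- The symbol on top of a register that holds a word. -/
def top : Option (Option Bool ⊕ B) → Option (Option Bool)
  | some (Sum.inl s) => some s
  | _ => none

theorem top_wd (w : List (Option Bool)) : top (wd (B := B) w).head? = w.head? := by
  cases w <;> rfl

/-- Move register `i` to register `j`, reversing it. -/
def pour (i j : ℕ) : StackProg (Option Bool ⊕ B) :=
  loop i inferInstance top fun s => (push j (Sum.inl s)).seq (pop i)

/-- Move the bits on top of register `i` to register `j`, reversing them. -/
def pourBits (i j : ℕ) : StackProg (Option Bool ⊕ B) :=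
  loop i inferInstance (fun o => (top o).join) fun b => (push j (Sum.inl (some b))).seq (pop i)

def clear (i : ℕ) : StackProg (Option Bool ⊕ B) :=
  loop i inferInstance top fun _ => pop i

/-- Move register `i` to the registers `j` and `k`, reversing it. -/
def pour2 (i j k : ℕ) : StackProg (Option Bool ⊕ B) :=
  loop i inferInstance top fun s =>
    (push j (Sum.inl s)).seq ((push k (Sum.inl s)).seq (pop i))

theorem pour_runs {i j : ℕ} (hij : i ≠ j) (w : List (Option Bool)) : ∀ S, S i = w →
    WRuns (B := B) (pour i j) S (3 * w.length + 1)
      (Function.update (Function.update S j (w.reverse ++ S j)) i []) := by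
  induction w with
  | nil =>
    intro S hS
    refine ⟨1, by simp, ?_⟩
    have : Function.update (Function.update S j ([].reverse ++ S j)) i [] = S := by
      rw [← hS]
      simp [hS]
    rw [this]
    exact .loop_none (by rw [top_wd, hS]; rfl)
  | cons s w ih =>
    intro S hS
    have h1 := (WRuns.push (B := B) j s S).seq (WRuns.pop i _)
    rw [Function.update_of_ne hij, hS, List.tail_cons] at h1
    have h2 := ih (Function.update (Function.update S j (s :: S j)) i w) (by simp)
    have h3 := WRuns.loop_some (k := i) (hι := inferInstance) (c := top) (p := fun s =>
      ((push j (Sum.inl s)).seq (pop i) : StackProg (Option Bool ⊕ B))) s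
        (by rw [top_wd, hS]; rfl) h1 h2
    refine h3.congr (by simp only [List.length_cons]; omega) ?_
    funext k
    by_cases hk : k = i
    · simp [hk]
    · by_cases hk' : k = j
      · subst hk'
        simp [hk]
      · simp [hk, hk']

theorem pourBits_runs {i j : ℕ} (hij : i ≠ j) (u : List Bool) {v : List (Option Bool)}
    (hv : v.head?.join = none) : ∀ S, S i = u.map some ++ v →
    WRuns (B := B) (pourBits i j) S (3 * u.length + 1)
      (Function.update (Function.update S j (u.reverse.map some ++ S j)) i v) := by
  induction u with
  | nil =>
    intro S hS
    refine ⟨1, by simp, ?_⟩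
    have hS' : S i = v := hS
    have : Function.update (Function.update S j (([] : List Bool).reverse.map some ++ S j)) i v =
        S := by
      simp [← hS']
    rw [this]
    exact .loop_none (by rw [top_wd, hS']; exact hv)
  | cons b u ih =>
    intro S hS
    have h1 := (WRuns.push (B := B) j (some b) S).seq (WRuns.pop i _)
    rw [Function.update_of_ne hij, hS, List.map_cons, List.cons_append, List.tail_cons] at h1
    have h2 := ih (Function.update (Function.update S j (some b :: S j)) i (u.map some ++ v))
      (by simp)
    have h3 := WRuns.loop_some (k := i) (hι := inferInstance) (c := fun o => (top o).join)
      (p := fun b => ((push j (Sum.inl (some b))).seq (pop i) : StackProg (Option Bool ⊕ B))) b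
        (by rw [top_wd, hS]; rfl) h1 h2
    refine h3.congr (by simp only [List.length_cons]; omega) ?_
    funext k
    by_cases hk : k = i
    · simp [hk]
    · by_cases hk' : k = j
      · subst hk'
        simp [hk]
      · simp [hk, hk']

theorem clear_runs (i : ℕ) (w : List (Option Bool)) : ∀ S, S i = w →
    WRuns (B := B) (clear i) S (2 * w.length + 1) (Function.update S i []) := by
  induction w with
  | nil =>
    intro S hS
    refine ⟨1, by simp, ?_⟩
    rw [← hS, Function.update_eq_self]
    exact .loop_none (by rw [top_wd, hS]; rfl)
  | cons s w ih =>
    intro S hS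
    have h1 := WRuns.pop (B := B) i S
    rw [hS, List.tail_cons] at h1
    have h2 := ih (Function.update S i w) (by simp)
    have h3 := WRuns.loop_some (k := i) (hι := inferInstance) (c := top) (p := fun _ =>
      (pop i : StackProg (Option Bool ⊕ B))) s (by rw [top_wd, hS]; rfl) h1 h2
    refine h3.congr (by simp only [List.length_cons]; omega) ?_
    simp

theorem pour2_runs {i j k : ℕ} (hij : i ≠ j) (hik : i ≠ k) (hjk : j ≠ k)
    (w : List (Option Bool)) : ∀ S, S i = w →
    WRuns (B := B) (pour2 i j k) S (4 * w.length + 1)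
      (Function.update (Function.update (Function.update S j (w.reverse ++ S j)) k
        (w.reverse ++ S k)) i []) := by
  induction w with
  | nil =>
    intro S hS
    refine ⟨1, by simp, ?_⟩
    have : Function.update (Function.update (Function.update S j ([].reverse ++ S j)) k
        ([].reverse ++ S k)) i [] = S := by
      rw [← hS]
      simp [hS]
    rw [this]
    exact .loop_none (by rw [top_wd, hS]; rfl)
  | cons s w ih =>
    intro S hS
    have h1 := (WRuns.push (B := B) j s S).seq ((WRuns.push k s _).seq (WRuns.pop i _))
    rw [Function.update_of_ne hik, Function.update_of_ne hij, hS, List.tail_cons,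
      Function.update_of_ne hjk.symm] at h1
    have h2 := ih (Function.update (Function.update (Function.update S j (s :: S j)) k (s :: S k))
      i w) (by simp)
    have h3 := WRuns.loop_some (k := i) (hι := inferInstance) (c := top) (p := fun s =>
      ((push j (Sum.inl s)).seq ((push k (Sum.inl s)).seq (pop i)) :
        StackProg (Option Bool ⊕ B))) s (by rw [top_wd, hS]; rfl) h1 h2
    refine h3.congr (by simp only [List.length_cons]; omega) ?_
    funext x
    by_cases hi : x = i
    · simp [hi]
    · by_cases hj : x = j
      · subst hj
        simp [hi, hjk, Function.update_apply]
      · by_cases hk : x = k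
        · subst hk
          simp [hi]
        · simp [hi, hj, hk]

end StackProg

namespace StackProg

variable {B : Type}

/-! ## Functions computed in polynomial time -/

theorem eval_mono (T : Polynomial ℕ) {m n : ℕ} (h : m ≤ n) : T.eval m ≤ T.eval n := by
  rw [Polynomial.eval_eq_sum, Polynomial.eval_eq_sum]
  exact Finset.sum_le_sum fun i _ => Nat.mul_le_mul_left _ (Nat.pow_le_pow_left h i)

theorem encode_nil : encode [] = [] := rfl

theorem encode_cons (w : List Bool) (l : List (List Bool)) :
    encode (w :: l) = w.map some ++ none :: encode l := by
  simp [encode]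

theorem encode_append (l l' : List (List Bool)) : encode (l ++ l') = encode l ++ encode l' := by
  simp [encode]

/-- The first string (the empty one if there is none). -/
def hd (x : List (List Bool)) : List Bool := x.headD []

@[simp] theorem hd_nil : hd [] = [] := rfl

@[simp] theorem hd_cons (w : List Bool) (l : List (List Bool)) : hd (w :: l) = w := rfl

theorem length_hd_add_tail (x : List (List Bool)) :
    (hd x).length + (encode x.tail).length ≤ (encode x).length := by
  rcases x with _ | ⟨w, l⟩
  · simp [encode_nil]
  · simp [encode_cons]

/-- Polynomial-time computable functions on sequences of bit strings. -/
def PolyTime (B : Type) (f : List (List Bool) → List (List Bool)) : Prop :=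
  ∃ (p : StackProg (Option Bool ⊕ B)) (T : Polynomial ℕ), ∀ x,
    WRuns p (st [encode x]) (T.eval (encode x).length) (st [encode (f x)])

theorem st_succ (l : List (List (Option Bool))) : st l = st (l ++ [[]]) := (st_append_nil l).symm

theorem pour_st {l : List (List (Option Bool))} (i j : ℕ) (hi : i < l.length) (hj : j < l.length)
    (hij : i ≠ j) : WRuns (B := B) (pour i j) (st l) (3 * (l.getD i []).length + 1)
      (st ((l.set j ((l.getD i []).reverse ++ l.getD j [])).set i [])) :=
  (pour_runs hij _ _ rfl).congr le_rfl (by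
    rw [update_st hj, update_st (by simpa using hi)]
    rfl)

theorem pourBits_st {l : List (List (Option Bool))} (i j : ℕ) (hi : i < l.length)
    (hj : j < l.length) (hij : i ≠ j) {u : List Bool} {v : List (Option Bool)}
    (hv : v.head?.join = none) (hl : l.getD i [] = u.map some ++ v) :
    WRuns (B := B) (pourBits i j) (st l) (3 * u.length + 1)
      (st ((l.set j (u.reverse.map some ++ l.getD j [])).set i v)) :=
  (pourBits_runs hij u hv _ hl).congr le_rfl (by
    rw [update_st hj, update_st (by simpa using hi)]
    rfl)

theorem pour2_st {l : List (List (Option Bool))} (i j k : ℕ) (hi : i < l.length)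
    (hj : j < l.length) (hk : k < l.length) (hij : i ≠ j) (hik : i ≠ k) (hjk : j ≠ k) :
    WRuns (B := B) (pour2 i j k) (st l) (4 * (l.getD i []).length + 1)
      (st (((l.set j ((l.getD i []).reverse ++ l.getD j [])).set k
        ((l.getD i []).reverse ++ l.getD k [])).set i [])) :=
  (pour2_runs hij hik hjk _ _ rfl).congr le_rfl (by
    rw [update_st hj, update_st (by simpa using hk), update_st (by simpa using hi)]
    rfl)

theorem clear_st {l : List (List (Option Bool))} (i : ℕ) (hi : i < l.length) :
    WRuns (B := B) (clear i) (st l) (2 * (l.getD i []).length + 1) (st (l.set i [])) :=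
  (clear_runs i _ _ rfl).congr le_rfl (update_st hi _)

theorem push_st {l : List (List (Option Bool))} (i : ℕ) (hi : i < l.length) (s : Option Bool) :
    WRuns (B := B) (push i (Sum.inl s)) (st l) 1 (st (l.set i (s :: l.getD i []))) :=
  (WRuns.push i s _).congr le_rfl (update_st hi _)

theorem pop_st {l : List (List (Option Bool))} (i : ℕ) (hi : i < l.length) :
    WRuns (B := B) (pop i) (st l) 1 (st (l.set i (l.getD i []).tail)) :=
  (WRuns.pop i _).congr le_rfl (update_st hi _)

namespace PolyTime

variable {f g h c : List (List Bool) → List (List Bool)}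

/-- The intermediate value is no longer than the input plus the time spent on it, so the second time
bound is evaluated at a polynomial. -/
theorem comp (hg : PolyTime B g) (hf : PolyTime B f) : PolyTime B fun x => g (f x) := by
  obtain ⟨p, T, hp⟩ := hf
  obtain ⟨q, U, hq⟩ := hg
  refine ⟨p.seq q, T + U.comp (Polynomial.X + T), fun x => ((hp x).seq (hq (f x))).mono ?_⟩
  rw [Polynomial.eval_add, Polynomial.eval_comp, Polynomial.eval_add, Polynomial.eval_X]
  obtain ⟨t, ht, hE⟩ := hp x
  have := hE.length_le 0
  simp only [st, wd, List.length_map, List.getD_cons_zero] at this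
  exact Nat.add_le_add_left (eval_mono U (by omega)) _

/-- The length of the value is polynomially bounded. -/
theorem length_le (hf : PolyTime B f) : ∃ T : Polynomial ℕ, ∀ x,
    (encode (f x)).length ≤ T.eval (encode x).length := by
  obtain ⟨p, T, hp⟩ := hf
  refine ⟨Polynomial.X + T, fun x => ?_⟩
  obtain ⟨t, ht, hE⟩ := hp x
  have := hE.length_le 0
  simp only [st, wd, List.length_map, List.getD_cons_zero] at this
  rw [Polynomial.eval_add, Polynomial.eval_X]
  omega

/-- Evaluate a function on a copy of the input. -/
theorem exists_copy (hf : PolyTime B f) : ∃ (p : StackProg (Option Bool ⊕ B)) (T : Polynomial ℕ),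
    ∀ x, WRuns p (st [encode x]) (T.eval (encode x).length) (st [[], (encode x).reverse,
      encode (f x)]) := by
  obtain ⟨p, T, hp⟩ := hf
  refine ⟨(pour 0 1).seq ((pour2 1 0 2).seq ((p.shift 2).seq (pour 0 1))),
    T + 10 * Polynomial.X + 4, fun x => ?_⟩
  have e1 : WRuns (B := B) (pour 0 1) (st [encode x]) (3 * (encode x).length + 1)
      (st [[], (encode x).reverse, []]) := by
    rw [st_succ, st_succ]
    simpa using pour_st (B := B) (l := [encode x, [], []]) 0 1 (by simp) (by simp) (by simp)
  have e2 : WRuns (B := B) (pour2 1 0 2) (st [[], (encode x).reverse, []])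
      (4 * (encode x).length + 1) (st [encode x, [], encode x]) := by
    simpa using pour2_st (B := B) (l := [[], (encode x).reverse, []]) 1 0 2 (by simp) (by simp)
      (by simp) (by simp) (by simp) (by simp)
  have e3 := (hp x).shift [encode x, []]
  have e4 : WRuns (B := B) (pour 0 1) (st [encode x, [], encode (f x)]) (3 * (encode x).length + 1)
      (st [[], (encode x).reverse, encode (f x)]) := by
    simpa using pour_st (B := B) (l := [encode x, [], encode (f x)]) 0 1 (by simp) (by simp)
      (by simp)
  refine (e1.seq (e2.seq (e3.seq e4))).mono ?_
  simp only [Polynomial.eval_add, Polynomial.eval_mul, Polynomial.eval_X, Polynomial.eval_ofNat]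
  omega

/-- The value of `f` waits, reversed, in register `0` while `g` runs two registers higher on the
restored input; afterwards it is poured on top of the value of `g`. -/
theorem append (hf : PolyTime B f) (hg : PolyTime B g) : PolyTime B fun x => f x ++ g x := by
  obtain ⟨V, hV⟩ := hf.length_le
  obtain ⟨W, hW⟩ := hg.length_le
  obtain ⟨p, T, hp⟩ := hf.exists_copy
  obtain ⟨q, U, hq⟩ := hg
  refine ⟨p.seq ((pour 2 0).seq ((pour 1 2).seq ((q.shift 2).seq ((pour 0 2).seq
    ((pour 2 1).seq (pour 1 0)))))), T + U + 3 * Polynomial.X + 12 * V + 6 * W + 5, fun x => ?_⟩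
  have e2 : WRuns (B := B) (pour 2 0) (st [[], (encode x).reverse, encode (f x)])
      (3 * (encode (f x)).length + 1) (st [(encode (f x)).reverse, (encode x).reverse, []]) := by
    simpa using pour_st (B := B) (l := [[], (encode x).reverse, encode (f x)]) 2 0 (by simp)
      (by simp) (by simp)
  have e3 : WRuns (B := B) (pour 1 2) (st [(encode (f x)).reverse, (encode x).reverse, []])
      (3 * (encode x).length + 1) (st [(encode (f x)).reverse, [], encode x]) := by
    simpa using pour_st (B := B) (l := [(encode (f x)).reverse, (encode x).reverse, []]) 1 2
      (by simp) (by simp) (by simp)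
  have e4 := (hq x).shift [(encode (f x)).reverse, []]
  have e5 : WRuns (B := B) (pour 0 2) (st [(encode (f x)).reverse, [], encode (g x)])
      (3 * (encode (f x)).length + 1) (st [[], [], encode (f x) ++ encode (g x)]) := by
    simpa using pour_st (B := B) (l := [(encode (f x)).reverse, [], encode (g x)]) 0 2
      (by simp) (by simp) (by simp)
  have e6 : WRuns (B := B) (pour 2 1) (st [[], [], encode (f x) ++ encode (g x)])
      (3 * (encode (f x) ++ encode (g x)).length + 1)
      (st [[], (encode (f x) ++ encode (g x)).reverse, []]) := by
    simpa using pour_st (B := B) (l := [[], [], encode (f x) ++ encode (g x)]) 2 1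
      (by simp) (by simp) (by simp)
  have e7 : WRuns (B := B) (pour 1 0) (st [[], (encode (f x) ++ encode (g x)).reverse, []])
      (3 * (encode (f x) ++ encode (g x)).length + 1) (st [encode (f x ++ g x)]) := by
    rw [st_succ [encode (f x ++ g x)], st_succ ([encode (f x ++ g x)] ++ [[]]), encode_append]
    generalize encode (f x) ++ encode (g x) = z
    simpa using pour_st (B := B) (l := [[], z.reverse, []]) 1 0 (by simp) (by simp) (by simp)
  refine ((hp x).seq (e2.seq (e3.seq (e4.seq (e5.seq (e6.seq e7)))))).mono ?_
  have := hV x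
  have := hW x
  simp only [Polynomial.eval_add, Polynomial.eval_mul, Polynomial.eval_X, Polynomial.eval_ofNat,
    List.length_append]
  omega

/-- Case distinction on the first bit of the first string of the value of `c`. -/
theorem cases (hc : PolyTime B c) (hf : PolyTime B f) (hg : PolyTime B g) (hh : PolyTime B h) :
    PolyTime B fun x => match (hd (c x)).head? with
      | none => f x
      | some true => g x
      | some false => h x := by
  obtain ⟨V, hV⟩ := hc.length_le
  obtain ⟨r, R, hr⟩ := hc.exists_copy
  obtain ⟨p, T, hp⟩ := hf
  obtain ⟨q, U, hq⟩ := hg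
  obtain ⟨s, W, hs⟩ := hh
  refine ⟨r.seq ((pour 1 0).seq (case 2 (ι := Option Bool) inferInstance (fun o => (top o).join)
    fun o => (clear 2).seq (Option.elim o p fun b => cond b q s))), R + T + U + W + 3 * Polynomial.X + 2 * V + 3, fun x => ?_⟩
  have e2 : WRuns (B := B) (pour 1 0) (st [[], (encode x).reverse, encode (c x)])
      (3 * (encode x).length + 1) (st [encode x, [], encode (c x)]) := by
    simpa using pour_st (B := B) (l := [[], (encode x).reverse, encode (c x)]) 1 0
      (by simp) (by simp) (by simp)
  have e3 : WRuns (B := B) (clear 2) (st [encode x, [], encode (c x)])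
      (2 * (encode (c x)).length + 1) (st [encode x]) := by
    rw [st_succ [encode x], st_succ ([encode x] ++ [[]])]
    simpa using clear_st (B := B) (l := [encode x, [], encode (c x)]) 2 (by simp)
  have hhead : (top (wd (B := B) (st [encode x, [], encode (c x)] 2)).head?).join =
      (hd (c x)).head? := by
    rw [top_wd]
    show (encode (c x)).head?.join = _
    rcases c x with _ | ⟨_ | ⟨b, w⟩, l⟩ <;> simp [encode_nil, encode_cons]
  have hcase : ∀ {y : List (List Bool)} {T' : ℕ} (o : Option Bool) (_ : WRuns
      (Option.elim o p fun b => cond b q s) (st [encode x]) T' (st [encode y]))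
      (_ : (hd (c x)).head? = o) (_ : T' ≤ T.eval (encode x).length +
        U.eval (encode x).length + W.eval (encode x).length), WRuns (r.seq ((pour 1 0).seq
        (case 2 (ι := Option Bool) inferInstance (fun o => (top o).join)
          fun o => (clear 2).seq (Option.elim o p fun b => cond b q s)))) (st [encode x])
        ((R + T + U + W + 3 * Polynomial.X + 2 * V + 3).eval (encode x).length)
        (st [encode y]) := by
    intro y T' o hp' ho hT
    refine ((hr x).seq (e2.seq (WRuns.case o (hhead.trans ho) (e3.seq hp')))).mono ?_
    have := hV x
    simp only [Polynomial.eval_add, Polynomial.eval_mul, Polynomial.eval_X, Polynomial.eval_ofNat]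
    omega
  rcases ho : (hd (c x)).head? with _ | _ | _
  · simpa only [ho] using hcase none (hp x) ho (by omega)
  · simpa only [ho] using hcase (some false) (hs x) ho (by omega)
  · simpa only [ho] using hcase (some true) (hq x) ho (by omega)

theorem id : PolyTime B fun x => x :=
  ⟨skip, 1, fun x => ⟨1, by simp, .skip _⟩⟩

/-- Split off the first string. -/
theorem split_runs (x : List (List Bool)) : WRuns (B := B) ((pourBits 0 1).seq (pop 0))
    (st [encode x]) (3 * (encode x).length + 2)
    (st [encode x.tail, (hd x).reverse.map some]) := by
  rcases x with _ | ⟨w, l⟩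
  · have e1 := pourBits_st (B := B) (l := [[], []]) 0 1 (by simp) (by simp) (by simp)
      (u := []) (v := []) (by simp) (by simp)
    have e2 := pop_st (B := B) (l := [[], []]) 0 (by simp)
    rw [show [encode []] = [([] : List (Option Bool))] from rfl, st_succ]
    exact (e1.seq e2).congr (by simp) (by simp [encode_nil])
  · have e1 := pourBits_st (B := B) (l := [encode (w :: l), []]) 0 1 (by simp) (by simp) (by simp)
      (u := w) (v := none :: encode l) (by simp) (by simp [encode_cons])
    have e2 := pop_st (B := B) (l := [none :: encode l, w.reverse.map some]) 0 (by simp)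
    rw [st_succ]
    refine (WRuns.seq (S' := st [none :: encode l, w.reverse.map some]) ?_ e2).congr
      (T := 3 * w.length + 1 + 1) ?_ (by simp)
    · simpa using e1
    · simp [encode_cons]

theorem tail : PolyTime B List.tail := by
  refine ⟨((pourBits 0 1).seq (pop 0)).seq (clear 1), 5 * Polynomial.X + 3, fun x => ?_⟩
  have e := clear_st (B := B) (l := [encode x.tail, (hd x).reverse.map some]) 1 (by simp)
  refine ((split_runs x).seq e).congr ?_ ?_
  · have := length_hd_add_tail x
    simp
    omega
  · exact st_append_nil [encode x.tail]

theorem head : PolyTime B fun x => [hd x] := by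
  refine ⟨((pourBits 0 1).seq (pop 0)).seq ((clear 0).seq ((push 0 (Sum.inl none)).seq (pour 1 0))),
    8 * Polynomial.X + 10, fun x => ?_⟩
  have e1 := clear_st (B := B) (l := [encode x.tail, (hd x).reverse.map some]) 0 (by simp)
  have e2 := push_st (B := B) (l := [[], (hd x).reverse.map some]) 0 (by simp) none
  have e3 := pour_st (B := B) (l := [[none], (hd x).reverse.map some]) 1 0 (by simp) (by simp)
    (by simp)
  refine ((split_runs x).seq (e1.seq (e2.seq e3))).congr ?_ ?_
  · have := length_hd_add_tail x
    simp
    omega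
  · refine Eq.trans ?_ (st_append_nil [encode [hd x]])
    simp [encode_cons, encode_nil]

theorem const (y : List (List Bool)) : PolyTime B fun _ => y := by
  have key : ∀ w : List (Option Bool), ∃ p : StackProg (Option Bool ⊕ B), ∃ T : ℕ,
      WRuns p (st [[]]) T (st [w]) := by
    intro w
    induction w with
    | nil => exact ⟨skip, 1, 1, le_rfl, .skip _⟩
    | cons s w ih =>
      obtain ⟨p, T, hp⟩ := ih
      exact ⟨p.seq (push 0 (Sum.inl s)), T + 1, hp.seq (push_st (l := [w]) 0 (by simp) s)⟩
  obtain ⟨p, T, hp⟩ := key (encode y)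
  refine ⟨(clear 0).seq p, 2 * Polynomial.X + Polynomial.C (1 + T), fun x => ?_⟩
  refine ((clear_st (l := [encode x]) 0 (by simp)).seq hp).congr ?_ rfl
  simp
  omega

end PolyTime
end StackProg

/-! ### Bounded iteration and basic string functions -/

namespace StackProg

variable {B : Type}

namespace PolyTime

variable {f g h c : List (List Bool) → List (List Bool)}

theorem congr (hf : PolyTime B f) (h : ∀ x, g x = f x) : PolyTime B g := by
  rwa [show g = f from funext h]

/-- Register `0` is a unary counter from which every round removes one bit. A common bound `M` for
the cost of the rounds is needed because the argument changes from round to round. -/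
theorem iterate_loop {p : StackProg (Option Bool ⊕ B)} {T : Polynomial ℕ} (hp : ∀ x,
    WRuns p (st [encode x]) (T.eval (encode x).length) (st [encode (f x)])) (M : ℕ) :
    ∀ (u : List Bool) (z : List (List Bool)),
      (∀ j ≤ u.length, T.eval (encode (f^[j] z)).length ≤ M) →
      WRuns (loop 0 (ι := Bool) inferInstance (fun o => (top o).join)
        fun _ => (pop 0).seq (p.shift 1)) (st [u.map some, encode z]) (u.length * (2 + M) + 1)
        (st [[], encode (f^[u.length] z)])
  | [], z, _ => (WRuns.loop_none (by rw [top_wd]; rfl)).mono (by simp)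
  | b :: u, z, hM => by
    have e1 := pop_st (B := B) (l := [(b :: u).map some, encode z]) 0 (by simp)
    have e2 := (hp z).shift [u.map some]
    have e3 := iterate_loop hp M u (f z) fun j hj => hM (j + 1) (by simpa using hj)
    refine (WRuns.loop_some b (by rw [top_wd]; rfl) (e1.seq e2) e3).congr ?_ rfl
    have := hM 0 (by simp)
    simp only [Function.iterate_zero, _root_.id] at this
    simp only [List.length_cons, Nat.succ_mul]
    omega

/-- Bounded iteration: `f` is iterated as often as the first string of `c x` is long. -/
theorem iterate (hf : PolyTime B f) (hc : PolyTime B c) (P : Polynomial ℕ)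
    (hP : ∀ x, ∀ j ≤ (hd (c x)).length,
      (encode (f^[j] (c x).tail)).length ≤ P.eval (encode x).length) :
    PolyTime B fun x => f^[(hd (c x)).length] (c x).tail := by
  obtain ⟨V, hV⟩ := hc.length_le
  obtain ⟨q, U, hq⟩ := hc
  obtain ⟨p, T, hp⟩ := hf
  refine ⟨q.seq (((pourBits 0 1).seq (pop 0)).seq ((pour 0 2).seq ((pour 1 0).seq ((pour 2 1).seq
    ((loop 0 (ι := Bool) inferInstance (fun o => (top o).join)
        fun _ => (pop 0).seq (p.shift 1)).seq ((pour 1 2).seq (pour 2 0))))))),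
    U + 12 * V + V * (2 + T.comp P) + 6 * P + 8, fun x => ?_⟩
  set y := c x with hy
  have e1 : WRuns (B := B) (pour 0 2) (st [encode y.tail, (hd y).reverse.map some])
      (3 * (encode y.tail).length + 1)
      (st [[], (hd y).reverse.map some, (encode y.tail).reverse]) := by
    rw [st_succ]
    simpa using pour_st (B := B) (l := [encode y.tail, (hd y).reverse.map some, []]) 0 2 (by simp)
      (by simp) (by simp)
  have e2 : WRuns (B := B) (pour 1 0) (st [[], (hd y).reverse.map some, (encode y.tail).reverse])
      (3 * (hd y).length + 1) (st [(hd y).map some, [], (encode y.tail).reverse]) := by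
    simpa using pour_st (B := B)
      (l := [[], (hd y).reverse.map some, (encode y.tail).reverse]) 1 0 (by simp)
      (by simp) (by simp)
  have e3 : WRuns (B := B) (pour 2 1) (st [(hd y).map some, [], (encode y.tail).reverse])
      (3 * (encode y.tail).length + 1) (st [(hd y).map some, encode y.tail]) := by
    rw [st_succ [(hd y).map some, encode y.tail]]
    simpa using pour_st (B := B)
      (l := [(hd y).map some, [], (encode y.tail).reverse]) 2 1 (by simp)
      (by simp) (by simp)
  have e4 := iterate_loop hp (T.eval (P.eval (encode x).length)) (hd y) y.tail
    fun j hj => eval_mono T (hP x j hj)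
  set z := encode (f^[(hd y).length] y.tail)
  have e5 : WRuns (B := B) (pour 1 2) (st [[], z]) (3 * z.length + 1) (st [[], [], z.reverse]) := by
    rw [st_succ [[], z]]
    simpa using pour_st (B := B) (l := [[], z, []]) 1 2 (by simp) (by simp) (by simp)
  have e6 : WRuns (B := B) (pour 2 0) (st [[], [], z.reverse]) (3 * z.length + 1) (st [z]) := by
    rw [st_succ [z], st_succ ([z] ++ [[]])]
    simpa using pour_st (B := B) (l := [[], [], z.reverse]) 2 0 (by simp) (by simp) (by simp)
  refine ((hq x).seq ((split_runs y).seq (e1.seq (e2.seq (e3.seq (e4.seq (e5.seq e6))))))).mono ?_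
  have h1 : (encode y).length ≤ V.eval (encode x).length := hV x
  have h2 : z.length ≤ P.eval (encode x).length := hP x _ le_rfl
  have h3 := length_hd_add_tail y
  have h4 : (hd y).length * (2 + T.eval (P.eval (encode x).length)) ≤
      V.eval (encode x).length * (2 + T.eval (P.eval (encode x).length)) :=
    Nat.mul_le_mul_right _ (by omega)
  simp only [Polynomial.eval_add, Polynomial.eval_mul, Polynomial.eval_ofNat, Polynomial.eval_comp]
  omega

/-! ### Basic functions -/

/-- Concatenation of the strings means deleting every `#` from the code and putting a single one at
the end. -/
theorem flatten : PolyTime B fun x => [x.flatten] := by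
  refine ⟨(loop 0 (ι := Option Bool) inferInstance top fun
      | none => pop 0
      | some b => (push 1 (Sum.inl (some b))).seq (pop 0)).seq
    ((push 0 (Sum.inl none)).seq (pour 1 0)), 6 * Polynomial.X + 3, fun x => ?_⟩
  have key : ∀ (w : List (Option Bool)) (v : List (Option Bool)), WRuns (B := B)
      (loop 0 (ι := Option Bool) inferInstance top fun
      | none => pop 0
      | some b => (push 1 (Sum.inl (some b))).seq (pop 0)) (st [w, v]) (3 * w.length + 1)
      (st [[], (w.reduceOption.map some).reverse ++ v]) := by
    intro w
    induction w with
    | nil => exact fun v => (WRuns.loop_none (by rw [top_wd]; rfl)).mono (by simp)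
    | cons s w ih =>
      intro v
      rcases s with _ | b
      · have e1 := pop_st (B := B) (l := [none :: w, v]) 0 (by simp)
        refine (WRuns.loop_some none (by rw [top_wd]; rfl) e1 (ih v)).congr ?_ ?_
        · simp only [List.length_cons]
          omega
        · simp [List.reduceOption_cons_of_none]
      · have e1 := push_st (B := B) (l := [some b :: w, v]) 1 (by simp) (some b)
        have e2 := pop_st (B := B) (l := [some b :: w, some b :: v]) 0 (by simp)
        refine (WRuns.loop_some (some b) (by rw [top_wd]; rfl) (e1.seq e2) (ih _)).congr ?_ ?_
        · simp only [List.length_cons]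
          omega
        · simp [List.reduceOption_cons_of_some]
  have hx : (encode x).reduceOption = x.flatten := by
    induction x with
    | nil => rfl
    | cons w l ih =>
      rw [encode_cons, List.reduceOption_append, List.reduceOption_cons_of_none, ih,
        List.flatten_cons, List.reduceOption, List.filterMap_map]
      simp
  have hlen : x.flatten.length ≤ (encode x).length := hx ▸ List.reduceOption_length_le _
  have e1 := key (encode x) []
  rw [hx] at e1
  show WRuns _ _ _ (st [encode [x.flatten]])
  generalize x.flatten = z at *
  have e2 := push_st (B := B) (l := [[], (z.map some).reverse ++ []]) 0 (by simp) none
  have e3 := pour_st (B := B) (l := [[none], (z.map some).reverse ++ []]) 1 0 (by simp)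
    (by simp) (by simp)
  rw [st_succ]
  refine (e1.seq (e2.seq e3)).congr ?_ ?_
  · simp only [Polynomial.eval_add, Polynomial.eval_mul, Polynomial.eval_X, Polynomial.eval_ofNat]
    simp
    omega
  · refine Eq.trans ?_ (st_append_nil [encode [z]])
    simp [encode_cons, encode_nil]

/-- The length of the input in unary. -/
theorem length : PolyTime B fun x => [unary (encode x).length] := by
  refine ⟨(loop 0 (ι := Option Bool) inferInstance top fun _ =>
      (push 1 (Sum.inl (some true))).seq (pop 0)).seq
    ((push 0 (Sum.inl none)).seq (pour 1 0)), 6 * Polynomial.X + 3, fun x => ?_⟩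
  have key : ∀ (w : List (Option Bool)) (v : List (Option Bool)), WRuns (B := B)
      (loop 0 (ι := Option Bool) inferInstance top fun _ =>
      (push 1 (Sum.inl (some true))).seq (pop 0)) (st [w, v]) (3 * w.length + 1)
      (st [[], List.replicate w.length (some true) ++ v]) := by
    intro w
    induction w with
    | nil => exact fun v => (WRuns.loop_none (by rw [top_wd]; rfl)).mono (by simp)
    | cons s w ih =>
      intro v
      have e1 := push_st (B := B) (l := [s :: w, v]) 1 (by simp) (some true)
      have e2 := pop_st (B := B) (l := [s :: w, some true :: v]) 0 (by simp)
      refine (WRuns.loop_some s (by rw [top_wd]; rfl) (e1.seq e2) (ih _)).congr ?_ ?_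
      · simp only [List.length_cons]
        omega
      · rw [List.length_cons, List.replicate_succ', List.append_assoc]
        rfl
  show WRuns _ _ _ (st [encode [unary (encode x).length]])
  generalize hn : (encode x).length = n
  have e1 := key (encode x) []
  rw [hn] at e1
  have e2 := push_st (B := B) (l := [[], List.replicate n (some true) ++ []]) 0 (by simp) none
  have e3 := pour_st (B := B) (l := [[none], List.replicate n (some true) ++ []]) 1 0 (by simp)
    (by simp) (by simp)
  rw [st_succ]
  refine (e1.seq (e2.seq e3)).congr ?_ ?_
  · simp
    omega
  · refine Eq.trans ?_ (st_append_nil [encode [unary n]])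
    simp [encode_cons, encode_nil, unary]

/-- Delete the first bit of the first string. -/
theorem tailBit : PolyTime B fun x => [(hd x).tail] := by
  obtain ⟨p, T, hp⟩ := PolyTime.head (B := B)
  refine ⟨p.seq (case 0 (ι := Bool) inferInstance (fun o => (top o).join.isSome) fun b =>
    cond b (pop 0) skip), T + 2, fun x => ?_⟩
  refine ((hp x).seq (T' := 2) ?_).mono (by simp)
  show WRuns _ (st [encode [hd x]]) 2 (st [encode [(hd x).tail]])
  rcases hd x with _ | ⟨b, w⟩
  · exact WRuns.case false (by rw [top_wd]; rfl) ⟨1, le_rfl, .skip _⟩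
  · refine WRuns.case (T := 1) (S := st [encode [b :: w]])
      (c := fun o => (top o).join.isSome) (p := fun b => cond b (pop 0) skip) true (by rw [top_wd]; rfl) ?_
    exact pop_st (B := B) (l := [encode [b :: w]]) 0 (by simp)

end PolyTime
end StackProg

section

/-- The stack symbols of a machine, and its control states. -/
abbrev ProbTM.Symbols (M : ProbTM) : Type := (Σ k, M.tm.Γ k) ⊕ (M.tm.Λ × M.tm.σ)

namespace StackProg

/-! ## Simulation of probabilistic Turing machines -/

section Simulation

variable {B : Type} (M : ProbTM) (e : M.Symbols ↪ B)

instance : Fintype M.tm.Λ := M.tm.ΛFin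
instance : Fintype M.tm.σ := M.tm.σFin
instance : Fintype M.tm.K := M.tm.kFin

/-- The register that holds the stack `k`. -/
def stackReg (k : M.tm.K) : ℕ := 3 + (Fintype.equivFin M.tm.K k : ℕ)

def symb (k : M.tm.K) (g : M.tm.Γ k) : Option Bool ⊕ B := Sum.inr (e (Sum.inl ⟨k, g⟩))

def ctrl (l : M.tm.Λ) (s : M.tm.σ) : Option Bool ⊕ B := Sum.inr (e (Sum.inr (l, s)))

open Classical in
-- All stacks of the simulated machine share one alphabet here. A symbol that does not belong to
-- stack `k` is read as `none`; it never occurs in the register of that stack.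
def readSymb (k : M.tm.K) (o : Option (Option Bool ⊕ B)) : Option (M.tm.Γ k) :=
  if h : ∃ g, o = some (symb M e k g) then some h.choose else none

open Classical in
def readCtrl (o : Option (Option Bool ⊕ B)) : Option (M.tm.Λ × M.tm.σ) :=
  if h : ∃ p : M.tm.Λ × M.tm.σ, o = some (ctrl M e p.1 p.2) then some h.choose else none

theorem readSymb_some (k : M.tm.K) (g : M.tm.Γ k) :
    readSymb M e k (some (symb M e k g)) = some g := by
  have h : ∃ g', some (symb M e k g) = some (symb M e k g') := ⟨g, rfl⟩
  rw [readSymb, dif_pos h]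
  exact congrArg some (eq_of_heq (Sigma.mk.inj (Sum.inl.inj (e.injective
    (Sum.inr.inj (Option.some.inj h.choose_spec))))).2).symm

theorem readSymb_none (k : M.tm.K) : readSymb M e k none = none := by
  simp [readSymb]

theorem readSymb_head (k : M.tm.K) (l : List (M.tm.Γ k)) :
    readSymb M e k (l.map (symb M e k)).head? = l.head? := by
  rcases l with _ | ⟨g, l⟩
  · exact readSymb_none M e k
  · exact readSymb_some M e k g

theorem readCtrl_some (l : M.tm.Λ) (s : M.tm.σ) :
    readCtrl M e (some (ctrl M e l s)) = some (l, s) := by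
  have h : ∃ p : M.tm.Λ × M.tm.σ, some (ctrl M e l s) = some (ctrl M e p.1 p.2) := ⟨(l, s), rfl⟩
  rw [readCtrl, dif_pos h]
  exact congrArg some (Sum.inr.inj (e.injective
    (Sum.inr.inj (Option.some.inj h.choose_spec)))).symm

theorem readCtrl_none : readCtrl M e none = none := by
  simp [readCtrl]

/-- The registers during the simulation. -/
def simStore (c : List (Option Bool ⊕ B)) (t : List Bool) (S : ∀ k, List (M.tm.Γ k)) :
    ℕ → List (Option Bool ⊕ B)
  | 0 => c
  | 1 => []
  | 2 => wd (t.map some)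
  | j + 3 => if h : j < Fintype.card M.tm.K then
      (S ((Fintype.equivFin M.tm.K).symm ⟨j, h⟩)).map (symb M e _) else []

theorem simStore_reg (c t S) (k : M.tm.K) :
    simStore M e c t S (stackReg M k) = (S k).map (symb M e k) := by
  rw [stackReg, add_comm]
  simp only [simStore, Fin.is_lt, dif_pos]
  rw [show (⟨(Fintype.equivFin M.tm.K k : ℕ), _⟩ : Fin _) = Fintype.equivFin M.tm.K k from rfl,
    Equiv.symm_apply_apply]

theorem update_simStore_reg (c t S) (k : M.tm.K) (l : List (M.tm.Γ k)) :
    Function.update (simStore M e c t S) (stackReg M k) (l.map (symb M e k)) =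
      simStore M e c t (Function.update S k l) := by
  funext j
  by_cases hj : j = stackReg M k
  · subst hj
    simp [simStore_reg]
  · rw [Function.update_of_ne hj]
    match j with
    | 0 => rfl
    | 1 => rfl
    | 2 => rfl
    | j + 3 =>
      by_cases h : j < Fintype.card M.tm.K
      · have : (Fintype.equivFin M.tm.K).symm ⟨j, h⟩ ≠ k := by
          rintro rfl
          apply hj
          simp [stackReg, add_comm]
        simp [simStore, h, Function.update_of_ne this]
      · simp [simStore, h]

theorem update_simStore_ctrl (c c' t S) :
    Function.update (simStore M e c t S) 0 c' = simStore M e c' t S := by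
  funext j
  match j with
  | 0 => simp [simStore]
  | 1 => rfl
  | 2 => rfl
  | j + 3 => rfl

theorem update_simStore_tape (c t t' S) :
    Function.update (simStore M e c t S) 2 (wd (t'.map some)) = simStore M e c t' S := by
  funext j
  match j with
  | 0 => rfl
  | 1 => rfl
  | 2 => simp [simStore]
  | j + 3 => rfl

/-- Execution of a statement of `M` in the state `s`. -/
def simStmt : Turing.TM2.Stmt M.tm.Γ M.tm.Λ M.tm.σ → M.tm.σ → StackProg (Option Bool ⊕ B)
  | .push k f q, s => (push (stackReg M k) (symb M e k (f s))).seq (simStmt q s)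
  | .peek k f q, s => case (stackReg M k) inferInstance (fun o => f s (readSymb M e k o))
      fun s' => simStmt q s'
  | .pop k f q, s => case (stackReg M k) inferInstance (fun o => f s (readSymb M e k o))
      fun s' => (pop (stackReg M k)).seq (simStmt q s')
  | .load f q, s => simStmt q (f s)
  | .branch f q q', s => cond (f s) (simStmt q s) (simStmt q' s)
  | .goto f, s => push 0 (ctrl M e (f s) s)
  | .halt, _ => skip

/-- Counts the steps of `simStmt`: a pop costs two because the symbol is inspected before it is
removed, and for a branch the sum serves as a bound for both alternatives. -/
def stmtSize : Turing.TM2.Stmt M.tm.Γ M.tm.Λ M.tm.σ → ℕ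
  | .push _ _ q => 1 + stmtSize q
  | .peek _ _ q => 1 + stmtSize q
  | .pop _ _ q => 2 + stmtSize q
  | .load _ q => stmtSize q
  | .branch _ q q' => stmtSize q + stmtSize q'
  | .goto _ => 1
  | .halt => 1

/-- The control symbol of a configuration. -/
def ctrlOf (c : M.Config) : List (Option Bool ⊕ B) :=
  (c.l.map fun l => ctrl M e l c.var).toList

/-- The internal state of `M` is not stored but is a parameter of the program text, passed on by
case distinctions over the finite state set. Register `0` is empty meanwhile and receives the next
control symbol only at the end, or nothing if `M` halts. -/
theorem simStmt_runs (t : List Bool) : ∀ (q : Turing.TM2.Stmt M.tm.Γ M.tm.Λ M.tm.σ) (s : M.tm.σ)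
    (S : ∀ k, List (M.tm.Γ k)), Runs (simStmt M e q s) (simStore M e [] t S) (stmtSize M q)
      (simStore M e (ctrlOf M e (Turing.TM2.stepAux q s S)) t (Turing.TM2.stepAux q s S).stk)
  | .push k f q, s, S => by
    have h1 := (Exec.push (stackReg M k) (symb M e k (f s)) (simStore M e [] t S)).runs
    rw [simStore_reg, ← List.map_cons, update_simStore_reg] at h1
    exact h1.seq (simStmt_runs t q s _)
  | .peek k f q, s, S => by
    refine Runs.case (f s (S k).head?) ?_ (simStmt_runs t q _ S)
    rw [simStore_reg, readSymb_head]
  | .pop k f q, s, S => by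
    have h1 := (Exec.pop (stackReg M k) (simStore M e [] t S)).runs
    rw [simStore_reg, ← List.map_tail, update_simStore_reg] at h1
    refine (Runs.case (f s (S k).head?) ?_ (h1.seq (simStmt_runs t q _ _))).mono ?_
    · rw [simStore_reg, readSymb_head]
    · rw [stmtSize]
      omega
  | .load f q, s, S => simStmt_runs t q (f s) S
  | .branch f q q', s, S => by
    rw [simStmt, Turing.TM2.stepAux, stmtSize]
    cases f s
    · exact (simStmt_runs t q' s S).mono (by omega)
    · exact (simStmt_runs t q s S).mono (by omega)
  | .goto f, s, S => by
    have h1 := (Exec.push 0 (ctrl M e (f s) s) (simStore M e [] t S)).runs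
    rw [update_simStore_ctrl] at h1
    exact h1
  | .halt, s, S => (Exec.skip _).runs

/-- One round of the simulation. -/
def simStep (p : M.tm.Λ × M.tm.σ) : StackProg (Option Bool ⊕ B) :=
  case 2 (ι := Option Bool) inferInstance (fun o => (top o).join) fun
    | none => pop 0
    | some b => (pop 2).seq ((pop 0).seq (simStmt M e (M.tm.m p.1) (M.flip b p.2)))

def simLoop : StackProg (Option Bool ⊕ B) :=
  loop 0 (ι := M.tm.Λ × M.tm.σ) inferInstance (readCtrl M e) (simStep M e)

/-- A bound for the time to simulate one step. -/
def stepBound : ℕ := Finset.univ.sup fun l => stmtSize M (M.tm.m l)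

/-- The loop ends when there is no control symbol. If the tape is exhausted first, the control
symbol is discarded and the stacks are left as they are, in accordance with `runFrom`. -/
theorem simLoop_runs : ∀ (t : List Bool) (c : M.Config), ∃ t',
    Runs (simLoop M e) (simStore M e (ctrlOf M e c) t c.stk) (t.length * (stepBound M + 4) + 4)
      (simStore M e [] t' (M.runFrom c t).1.stk)
  | t, ⟨none, v, S⟩ => by
    refine ⟨t, ?_⟩
    have : M.runFrom ⟨none, v, S⟩ t = (⟨none, v, S⟩, []) := by cases t <;> rfl
    rw [this]
    exact (Exec.loop_none (readCtrl_none M e)).runs.mono (by omega)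
  | [], ⟨some l, v, S⟩ => by
    refine ⟨[], ?_⟩
    have h1 := (Exec.pop 0 (simStore M e (ctrlOf M e ⟨some l, v, S⟩) [] S)).runs
    rw [update_simStore_ctrl] at h1
    refine (Runs.loop_some (l, v) (readCtrl_some M e l v) (Runs.case none rfl h1)
      (Exec.loop_none (readCtrl_none M e)).runs).mono (by simp)
  | b :: t, ⟨some l, v, S⟩ => by
    obtain ⟨t', ht'⟩ := simLoop_runs t (Turing.TM2.stepAux (M.tm.m l) (M.flip b v) S)
    refine ⟨t', ?_⟩
    have h1 := (Exec.pop 2 (simStore M e (ctrlOf M e ⟨some l, v, S⟩) (b :: t) S)).runs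
    rw [show (simStore M e (ctrlOf M e ⟨some l, v, S⟩) (b :: t) S 2).tail = wd (t.map some) from rfl,
      update_simStore_tape] at h1
    have h2 := (Exec.pop 0 (simStore M e (ctrlOf M e ⟨some l, v, S⟩) t S)).runs
    rw [update_simStore_ctrl] at h2
    have h3 := simStmt_runs M e t (M.tm.m l) (M.flip b v) S
    have h4 : stmtSize M (M.tm.m l) ≤ stepBound M :=
      Finset.le_sup (f := fun l => stmtSize M (M.tm.m l)) (Finset.mem_univ l)
    refine (Runs.loop_some (l, v) (readCtrl_some M e l v) (Runs.case (some b) rfl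
      (h1.seq (h2.seq h3))) ht').mono ?_
    simp only [List.length_cons, Nat.succ_mul]
    omega

/-- Clear the registers `k` that hold stacks. -/
def clearAny (k : ℕ) : StackProg (Option Bool ⊕ B) :=
  loop k (ι := Unit) inferInstance (fun o => o.map fun _ => ()) fun _ => pop k

theorem clearAny_runs (k : ℕ) (w : List (Option Bool ⊕ B)) : ∀ S, S k = w →
    Runs (clearAny k) S (2 * w.length + 1) (Function.update S k []) := by
  induction w with
  | nil =>
    intro S hS
    rw [← hS, Function.update_eq_self]
    exact (Exec.loop_none (by rw [hS]; rfl)).runs.mono (by simp)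
  | cons s w ih =>
    intro S hS
    have h1 := (Exec.pop k S).runs
    rw [hS, List.tail_cons] at h1
    have h2 := Runs.loop_some (k := k) (hι := inferInstance) (c := fun o => o.map fun _ => ())
      (p := fun _ => (pop k : StackProg (Option Bool ⊕ B))) () (by rw [hS]; rfl) h1
      (ih (Function.update S k w) (by simp))
    rw [Function.update_idem] at h2
    exact h2.mono (by simp only [List.length_cons]; omega)

/-- Registers `0` and `1` are spared: the former holds the result, the latter is empty after the
simulation. -/
def clearFrom : ℕ → StackProg (Option Bool ⊕ B)
  | 0 => skip
  | n + 1 => (clearFrom n).seq (clearAny (2 + n))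

theorem clearFrom_runs (L : ℕ) : ∀ (n : ℕ) (S : ℕ → List (Option Bool ⊕ B)),
    (∀ k, (S k).length ≤ L) → Runs (clearFrom n) S (n * (2 * L + 1) + 1)
      fun k => if 2 ≤ k ∧ k < 2 + n then [] else S k
  | 0, S, _ => by
    have : (fun k => if 2 ≤ k ∧ k < 2 + 0 then [] else S k) = S := by
      funext k
      rw [if_neg (by omega)]
    rw [this]
    exact (Exec.skip S).runs.mono (by omega)
  | n + 1, S, hS => by
    have h1 := clearAny_runs (2 + n) _ (fun k => if 2 ≤ k ∧ k < 2 + n then [] else S k) rfl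
    have h2 := (clearFrom_runs L n S hS).seq h1
    have : Function.update (fun k => if 2 ≤ k ∧ k < 2 + n then [] else S k) (2 + n) [] =
        fun k => if 2 ≤ k ∧ k < 2 + (n + 1) then [] else S k := by
      funext k
      by_cases hk : k = 2 + n
      · subst hk
        simp
      · rw [Function.update_of_ne hk]
        by_cases hk' : 2 ≤ k ∧ k < 2 + n
        · rw [if_pos hk', if_pos (by omega)]
        · rw [if_neg hk', if_neg (by omega)]
    rw [this] at h2
    refine h2.mono ?_
    have := hS (2 + n)
    rw [if_neg (by omega), Nat.add_one_mul n]
    omega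

/-- Fill the input stack. -/
def simInput : StackProg (Option Bool ⊕ B) :=
  loop 1 (ι := Option Bool) inferInstance top fun s =>
    (push (stackReg M M.tm.k₀) (symb M e _ (M.inputAlphabet.symm s))).seq (pop 1)

theorem simInput_runs (t : List Bool) : ∀ (w : List (Option Bool)) (S : ∀ k, List (M.tm.Γ k)),
    Runs (simInput M e) (Function.update (simStore M e [] t S) 1 (wd w)) (3 * w.length + 1)
      (simStore M e [] t (Function.update S M.tm.k₀
        ((w.map M.inputAlphabet.symm).reverse ++ S M.tm.k₀)))
  | [], S => by
    have : Function.update (simStore M e [] t S) 1 (wd []) = simStore M e [] t S := by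
      rw [Function.update_eq_iff]
      exact ⟨rfl, fun _ _ => rfl⟩
    rw [this]
    simpa [simInput] using (Exec.loop_none (k := 1) (hι := inferInstance) (c := top) (p := fun s =>
      (push (stackReg M M.tm.k₀) (symb M e _ (M.inputAlphabet.symm s))).seq (pop 1))
      (S := simStore M e [] t S) rfl).runs
  | s :: w, S => by
    have hk : stackReg M M.tm.k₀ ≠ 1 := by rw [stackReg]; omega
    have h1 := (Exec.push (stackReg M M.tm.k₀) (symb M e _ (M.inputAlphabet.symm s))
      (Function.update (simStore M e [] t S) 1 (wd (s :: w)))).runs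
    rw [Function.update_of_ne hk, simStore_reg, ← List.map_cons, Function.update_comm hk.symm,
      update_simStore_reg] at h1
    have h2 := (Exec.pop 1 (Function.update (simStore M e [] t (Function.update S M.tm.k₀
      (M.inputAlphabet.symm s :: S M.tm.k₀))) 1 (wd (s :: w)))).runs
    rw [Function.update_idem, Function.update_self] at h2
    have h3 := Runs.loop_some (k := 1) (hι := inferInstance) (c := top) (p := fun s =>
      (push (stackReg M M.tm.k₀) (symb M e _ (M.inputAlphabet.symm s))).seq (pop 1)) s
      (by simp [top]) (h1.seq h2) (simInput_runs t w _)
    rw [Function.update_idem, Function.update_self] at h3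
    simpa [simInput] using h3.mono (T' := 3 * (s :: w).length + 1) (by simp only [List.length_cons]; omega)

/-- Read the output stack. -/
def simOutput : StackProg (Option Bool ⊕ B) :=
  loop (stackReg M M.tm.k₁) (ι := Bool) inferInstance
    (fun o => (readSymb M e M.tm.k₁ o).map M.outputAlphabet) fun b =>
    (push 0 (Sum.inl (some b))).seq (pop (stackReg M M.tm.k₁))

theorem simOutput_runs (t : List Bool) : ∀ (l : List (M.tm.Γ M.tm.k₁)) (S : ∀ k, List (M.tm.Γ k))
    (w : List (Option Bool)), S M.tm.k₁ = l →
    Runs (simOutput M e) (simStore M e (wd w) t S) (3 * l.length + 1)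
      (simStore M e (wd (((l.map M.outputAlphabet).map some).reverse ++ w)) t
        (Function.update S M.tm.k₁ []))
  | [], S, w, hS => by
    rw [← hS, Function.update_eq_self, hS]
    refine (Exec.loop_none ?_).runs
    rw [simStore_reg, readSymb_head, hS]
    rfl
  | g :: l, S, w, hS => by
    have h1 := (Exec.push 0 (Sum.inl (some (M.outputAlphabet g))) (simStore M e (wd w) t S)).runs
    rw [update_simStore_ctrl] at h1
    have h2 := (Exec.pop (stackReg M M.tm.k₁)
      (simStore M e (wd (some (M.outputAlphabet g) :: w)) t S)).runs
    rw [simStore_reg, ← List.map_tail, update_simStore_reg, hS] at h2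
    have h3 := Runs.loop_some (k := stackReg M M.tm.k₁) (hι := inferInstance)
      (c := fun o => (readSymb M e M.tm.k₁ o).map M.outputAlphabet) (p := fun b =>
      (push 0 (Sum.inl (some b))).seq (pop (stackReg M M.tm.k₁))) (M.outputAlphabet g)
      (by rw [simStore_reg, readSymb_head, hS]; rfl) (h1.seq h2)
      (simOutput_runs t l _ (some (M.outputAlphabet g) :: w) (by simp))
    rw [Function.update_idem] at h3
    simpa [simOutput] using h3.mono (T' := 3 * (g :: l).length + 1) (by simp only [List.length_cons]; omega)

end Simulation

end StackProg

end

theorem ProbTM.start_eq (M : ProbTM) (w : List (Option Bool)) :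
    M.start w = ⟨some M.tm.main, M.tm.initialState,
      Function.update (fun _ => []) M.tm.k₀ (w.map M.inputAlphabet.symm)⟩ := by
  have : (M.start w).stk =
      Function.update (fun _ => []) M.tm.k₀ (w.map M.inputAlphabet.symm) := by
    funext k
    by_cases hk : k = M.tm.k₀
    · subst hk
      rw [Function.update_self]
      exact dif_pos rfl
    · rw [Function.update_of_ne hk]
      exact dif_neg hk
  rw [← this]
  rfl

namespace StackProg

variable {B : Type}

theorem Runs.length_le {A : Type} {p : StackProg A} {S S' : ℕ → List A} {T : ℕ}
    (h : Runs p S T S') (k : ℕ) : (S' k).length ≤ (S k).length + T := by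
  obtain ⟨t, ht, hE⟩ := h
  exact (hE.length_le k).trans (by omega)

theorem length_st_singleton (w : List (Option Bool)) (k : ℕ) :
    (wd (B := B) (st [w] k)).length ≤ w.length := by
  rcases k with _ | k <;> simp [st]

/-- Simulation of a probabilistic Turing machine on a given random tape. -/
theorem PolyTime.run (M : ProbTM) (e : M.Symbols ↪ B) :
    PolyTime B fun x => [(M.result (encode x.tail) (hd x)).1] := by
  set D := stepBound M + 4 with hD
  have hT : ∃ T : Polynomial ℕ, ∀ n, 3 * n + 2 + (3 * n + 1) + (3 * n + 1) + (3 * n + 1) + 1 +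
      (n * D + 4) = T.eval n :=
    ⟨3 * Polynomial.X + 2 + (3 * Polynomial.X + 1) + (3 * Polynomial.X + 1) +
      (3 * Polynomial.X + 1) + 1 + (Polynomial.X * Polynomial.C D + 4), fun n => by simp⟩
  obtain ⟨T, hT⟩ := hT
  refine ⟨((pourBits 0 1).seq (pop 0)).seq ((pour 1 2).seq ((pour 0 1).seq ((simInput M e).seq
    ((push 0 (ctrl M e M.tm.main M.tm.initialState)).seq ((simLoop M e).seq ((simOutput M e).seq
    ((clearFrom (1 + Fintype.card M.tm.K)).seq ((pour 0 1).seq ((pour 1 2).seq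
    ((push 0 (Sum.inl none)).seq (pour 2 0))))))))))),
    T + 12 * (Polynomial.X + T) + 10 + Polynomial.C (1 + Fintype.card M.tm.K) *
      (2 * (Polynomial.X + T + 3 * (Polynomial.X + T) + 1) + 1), fun x => ?_⟩
  set n := (encode x).length with hn
  set w := encode x.tail with hw
  have hlen : (hd x).length + w.length ≤ n := length_hd_add_tail x
  have e1 : WRuns (B := B) (pour 1 2) (st [w, (hd x).reverse.map some])
      (3 * (hd x).length + 1) (st [w, [], (hd x).map some]) := by
    rw [st_succ]
    simpa using pour_st (B := B) (l := [w, (hd x).reverse.map some, []]) 1 2 (by simp)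
      (by simp) (by simp)
  have e2 : WRuns (B := B) (pour 0 1) (st [w, [], (hd x).map some])
      (3 * w.length + 1) (st [[], w.reverse, (hd x).map some]) := by
    simpa using pour_st (B := B) (l := [w, [], (hd x).map some]) 0 1 (by simp)
      (by simp) (by simp)
  have e3 := simInput_runs M e (hd x) w.reverse fun _ => []
  have hst : (fun j => (wd (st [[], w.reverse, (hd x).map some] j) : List (Option Bool ⊕ B))) =
      Function.update (simStore M e [] (hd x) fun _ => []) 1 (wd w.reverse) := by
    funext j
    match j with
    | 0 => rfl
    | 1 => simp [st]
    | 2 => rfl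
    | j + 3 => simp [st, simStore]
  rw [← hst] at e3
  rw [List.append_nil, List.map_reverse, List.reverse_reverse] at e3
  have e4 := (Exec.push 0 (ctrl M e M.tm.main M.tm.initialState) (simStore M e [] (hd x)
    (Function.update (fun _ => []) M.tm.k₀ (w.map M.inputAlphabet.symm)))).runs
  rw [update_simStore_ctrl] at e4
  obtain ⟨t', e5⟩ := simLoop_runs M e (hd x) (M.start w)
  rw [M.start_eq w] at e5
  have e15 := Runs.seq (split_runs (B := B) x) (Runs.seq e1 (Runs.seq e2 (Runs.seq e3
    (Runs.seq e4 e5))))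
  set c := M.runFrom ⟨some M.tm.main, M.tm.initialState,
    Function.update (fun _ => []) M.tm.k₀ (w.map M.inputAlphabet.symm)⟩ (hd x) with hc
  have hx : (M.result w (hd x)).1 = (c.1.stk M.tm.k₁).map M.outputAlphabet := by
    rw [ProbTM.result, ProbTM.run, M.start_eq]
  -- No register exceeds the length of the input plus the time used so far. This bounds the output
  -- as well as the time for clearing the stacks.
  have hl : ∀ k, (simStore M e [] t' c.1.stk k).length ≤ n + T.eval n := by
    intro k
    have h1 := e15.length_le k
    have h2 := length_st_singleton (B := B) (encode x) k
    have h3 := hT n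
    have h4 : (hd x).length * (stepBound M + 4) ≤ n * D := Nat.mul_le_mul_right _ (by omega)
    have h5 : w.reverse.length = w.length := List.length_reverse
    omega
  have hout : (c.1.stk M.tm.k₁).length ≤ n + T.eval n := by
    have := hl (stackReg M M.tm.k₁)
    rwa [simStore_reg, List.length_map] at this
  have e6 := simOutput_runs M e t' _ c.1.stk [] rfl
  rw [← hx, List.append_nil] at e6
  set o := (M.result w (hd x)).1
  have ho : o.length ≤ n + T.eval n := by
    rw [hx, List.length_map]
    exact hout
  have e7 := clearFrom_runs (n + T.eval n + 3 * (n + T.eval n) + 1) (1 + Fintype.card M.tm.K)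
    (simStore M e (wd (o.map some).reverse) t' (Function.update c.1.stk M.tm.k₁ [])) fun k => (by
      have h1 := e6.length_le k
      have h2 : (simStore M e (wd []) t' c.1.stk k).length ≤ n + T.eval n := hl k
      omega)
  have hst' : (fun k => if 2 ≤ k ∧ k < 2 + (1 + Fintype.card M.tm.K) then [] else
      simStore M e (wd (o.map some).reverse) t' (Function.update c.1.stk M.tm.k₁ []) k) =
      fun j => wd (st [(o.map some).reverse] j) := by
    funext k
    match k with
    | 0 => rfl
    | 1 => rfl
    | 2 => exact if_pos (by omega)
    | k + 3 =>
      by_cases hk : k < Fintype.card M.tm.K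
      · rw [if_pos (by omega)]
        rfl
      · rw [if_neg (by omega)]
        exact dif_neg hk
  rw [hst'] at e7
  have e8 : WRuns (B := B) (pour 0 1) (st [(o.map some).reverse]) (3 * o.length + 1)
      (st [[], o.map some]) := by
    rw [st_succ]
    simpa using pour_st (B := B) (l := [(o.map some).reverse, []]) 0 1 (by simp) (by simp) (by simp)
  have e9 : WRuns (B := B) (pour 1 2) (st [[], o.map some]) (3 * o.length + 1)
      (st [[], [], (o.map some).reverse]) := by
    rw [st_succ]
    simpa using pour_st (B := B) (l := [[], o.map some, []]) 1 2 (by simp) (by simp) (by simp)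
  have e10 := push_st (B := B) (l := [[], [], (o.map some).reverse]) 0 (by simp) none
  have e11 : WRuns (B := B) (pour 2 0) (st [[none], [], (o.map some).reverse]) (3 * o.length + 1)
      (st [encode [o]]) := by
    have h : st [encode [o], [], []] = st [encode [o]] := by
      rw [← st_append_nil [encode [o]], ← st_append_nil ([encode [o]] ++ [[]])]
      rfl
    rw [← h]
    simpa [encode_cons, encode_nil] using
      pour_st (B := B) (l := [[none], [], (o.map some).reverse]) 2 0 (by simp) (by simp) (by simp)
  refine Runs.mono (Runs.seq (split_runs (B := B) x) (Runs.seq e1 (Runs.seq e2 (Runs.seq e3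
    (Runs.seq e4 (Runs.seq e5 (Runs.seq e6 (Runs.seq e7 (Runs.seq e8 (Runs.seq e9
    (Runs.seq e10 e11))))))))))) ?_
  have h3 := hT n
  have h4 : (hd x).length * (stepBound M + 4) ≤ n * D := Nat.mul_le_mul_right _ (by omega)
  have h5 : w.reverse.length = w.length := List.length_reverse
  simp only [Polynomial.eval_add, Polynomial.eval_mul, Polynomial.eval_X, Polynomial.eval_ofNat,
    Polynomial.eval_one, Polynomial.eval_C]
  omega

end StackProg

/-! ### Unary arithmetic, and the compilation of polynomial-time functions into machines -/

namespace StackProg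

variable {B : Type}

namespace PolyTime

variable {f g h c : List (List Bool) → List (List Bool)}
variable {u v w : List (List Bool) → List Bool}

theorem cons (hu : PolyTime B fun x => [u x]) (hf : PolyTime B f) : PolyTime B fun x => u x :: f x :=
  hu.append hf

theorem pair (hu : PolyTime B fun x => [u x]) (hv : PolyTime B fun x => [v x]) :
    PolyTime B fun x => [u x, v x] := hu.append hv

theorem triple (hu : PolyTime B fun x => [u x]) (hv : PolyTime B fun x => [v x])
    (hw : PolyTime B fun x => [w x]) : PolyTime B fun x => [u x, v x, w x] := hu.cons (hv.pair hw)

theorem hd' (hf : PolyTime B f) : PolyTime B fun x => [hd (f x)] := head.comp hf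

theorem concat (hu : PolyTime B fun x => [u x]) (hv : PolyTime B fun x => [v x]) :
    PolyTime B fun x => [u x ++ v x] :=
  (flatten.comp (hu.pair hv)).congr fun x => by simp

theorem unary_add {a b : List (List Bool) → ℕ} (ha : PolyTime B fun x => [unary (a x)])
    (hb : PolyTime B fun x => [unary (b x)]) : PolyTime B fun x => [unary (a x + b x)] :=
  (ha.concat hb).congr fun x => by simp [unary]

/-- Repeated addition: every round flattens the pair consisting of the accumulator and `unary (a x)`
into the new accumulator. -/
theorem unary_mul {a b : List (List Bool) → ℕ} (ha : PolyTime B fun x => [unary (a x)])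
    (hb : PolyTime B fun x => [unary (b x)]) : PolyTime B fun x => [unary (a x * b x)] := by
  have hf : PolyTime B fun x => [x.flatten] ++ x.tail := flatten.append tail
  have hc : PolyTime B fun x => [unary (b x), [], unary (a x)] := hb.triple (const [[]]) ha
  have key : ∀ x j, (fun x : List (List Bool) => [x.flatten] ++ x.tail)^[j] [[], unary (a x)] =
      [unary (j * a x), unary (a x)] := by
    intro x j
    induction j with
    | zero => simp [unary]
    | succ j ih =>
      rw [Function.iterate_succ_apply', ih]
      simp [unary, Nat.add_mul]
  obtain ⟨V, hV⟩ := hc.length_le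
  refine (hf.iterate hc (V * V + V + 2) fun x j hj => ?_).hd'.congr fun x => ?_
  · rw [List.tail_cons, key]
    have h1 := hV x
    have h2 : (unary (b x)).length = b x := by simp [unary]
    rw [hd_cons, h2] at hj
    simp [encode_cons, encode_nil, unary] at h1 ⊢
    have h3 : j * a x ≤ V.eval (encode x).length * V.eval (encode x).length :=
      Nat.mul_le_mul (by omega) (by omega)
    omega
  · rw [List.tail_cons, key, hd_cons, hd_cons]
    simp [unary, mul_comm]

theorem unary_eval (q : Polynomial ℕ) {a : List (List Bool) → ℕ}
    (ha : PolyTime B fun x => [unary (a x)]) : PolyTime B fun x => [unary (q.eval (a x))] := by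
  induction q using Polynomial.induction_on with
  | C k => exact (const [unary k]).congr fun x => by simp
  | add p q hp hq => exact (hp.unary_add hq).congr fun x => by simp
  | monomial n k ih =>
    exact (ih.unary_mul ha).congr fun x => by simp [pow_succ, mul_assoc]

end PolyTime

/-! ## Polynomial-time functions as machines -/

/-- A `PPT` must halt on all words over the input alphabet, not only on codes. The only way for a
word not to be a code is that its last string lacks the closing `#`, which the machine can supply.
-/
theorem encode_or (w : List (Option Bool)) :
    (∃ l, w = encode l) ∨ ∃ l b v, w ++ [none] = encode l ∧ w.reverse = some b :: v := by
  induction w using List.reverseRecOn with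
  | nil => exact Or.inl ⟨[], rfl⟩
  | append_singleton w s ih =>
    rcases s with _ | b
    · rcases ih with ⟨l, rfl⟩ | ⟨l, b, v, hl, hv⟩
      · exact Or.inl ⟨l ++ [[]], by simp [encode_append, encode_cons, encode_nil]⟩
      · exact Or.inl ⟨l, hl⟩
    · refine Or.inr ?_
      rcases ih with ⟨l, rfl⟩ | ⟨l, b', v, hl, hv⟩
      · exact ⟨l ++ [[b]], b, _, by simp [encode_append, encode_cons, encode_nil],
          by rw [List.reverse_append]; rfl⟩
      · obtain ⟨l', u, rfl⟩ : ∃ l' u, l = l' ++ [u] := by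
          rcases List.eq_nil_or_concat l with rfl | ⟨l', u, rfl⟩
          · simp [encode_nil] at hl
          · exact ⟨l', u, List.concat_eq_append⟩
        refine ⟨l' ++ [u ++ [b]], b, w.reverse, ?_, by simp⟩
        rw [encode_append, encode_cons, encode_nil, ← List.append_assoc] at hl
        have := List.append_cancel_right hl
        rw [this, encode_append, encode_cons, encode_nil]
        simp

/-- Complete the reversed input word by a missing `#`. -/
def complete : StackProg (Option Bool ⊕ B) :=
  case 0 (ι := Bool) inferInstance (fun o => (top o).join.isSome) fun b =>
    cond b (push 0 (Sum.inl none)) skip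

theorem encode_injective : ∀ {l l' : List (List Bool)}, encode l = encode l' → l = l'
  | [], [], _ => rfl
  | [], w :: l, h => by simp [encode_cons, encode_nil] at h
  | w :: l, [], h => by simp [encode_cons, encode_nil] at h
  | w :: l, w' :: l', h => by
    rw [encode_cons, encode_cons] at h
    have key : ∀ (u u' : List Bool) (v v' : List (Option Bool)),
        u.map some ++ none :: v = u'.map some ++ none :: v' → u = u' ∧ v = v' := by
      intro u
      induction u with
      | nil =>
        rintro (_ | ⟨b, u'⟩) v v' h
        · simpa using h
        · simp at h
      | cons a u ih =>
        rintro (_ | ⟨b, u'⟩) v v' h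
        · simp at h
        · simp only [List.map_cons, List.cons_append, List.cons.injEq, Option.some.injEq] at h
          obtain ⟨rfl, h⟩ := h
          exact (ih u' v v' h).imp (congrArg _) _root_.id
    obtain ⟨rfl, h2⟩ := key _ _ _ _ h
    rw [encode_injective h2]

theorem complete_runs (w : List (Option Bool)) : ∃ l, (∀ l', w = encode l' → l = l') ∧
    (encode l).length ≤ w.length + 1 ∧
    WRuns (complete (B := B)) (st [w.reverse]) 2 (st [(encode l).reverse]) := by
  rcases encode_or w with ⟨l, rfl⟩ | ⟨l, b, v, hl, hv⟩
  · refine ⟨l, fun l' h => encode_injective h, by omega, ?_⟩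
    refine WRuns.case (T := 1) (c := fun o => (top o).join.isSome)
      (p := fun b => cond b (push 0 (Sum.inl none)) skip) false ?_ ⟨1, le_rfl, .skip _⟩
    rw [top_wd]
    rcases List.eq_nil_or_concat l with rfl | ⟨l, u, rfl⟩
    · rfl
    · simp [st, encode_append, encode_cons, encode_nil]
  · refine ⟨l, fun l' h => ?_, by rw [← hl]; simp, ?_⟩
    · exfalso
      subst h
      rcases List.eq_nil_or_concat l' with rfl | ⟨l, u, rfl⟩
      · simp [encode_nil] at hv
      · simp [encode_append, encode_cons, encode_nil] at hv
    · refine WRuns.case (T := 1) (c := fun o => (top o).join.isSome)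
        (p := fun b => cond b (push 0 (Sum.inl none)) skip) true ?_ ?_
      · rw [top_wd, hv]
        rfl
      · simpa [← hl] using push_st (B := B) (l := [w.reverse]) 0 (by simp) none

/-- Wait for at least `q` steps. -/
theorem exists_wait (q : Polynomial ℕ) : ∃ (p : StackProg (Option Bool ⊕ B)) (T : Polynomial ℕ),
    ∀ x, ∃ t, q.eval (encode x).length ≤ t ∧ t ≤ T.eval (encode x).length ∧
      Exec p (st [wd (encode x).reverse]) t (st [wd (encode x)]) := by
  obtain ⟨p, T, hp⟩ := (PolyTime.length.unary_eval (B := B) q).exists_copy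
  refine ⟨((pour 0 1).seq ((pour 1 2).seq (pour 2 0))).seq (p.seq ((clear 2).seq (pour 1 0))),
    T + 12 * Polynomial.X + 2 * q + 10, fun x => ?_⟩
  set n := (encode x).length with hn
  have e1 : WRuns (B := B) (pour 0 1) (st [(encode x).reverse]) (3 * n + 1)
      (st [[], encode x]) := by
    rw [st_succ]
    simpa using pour_st (B := B) (l := [(encode x).reverse, []]) 0 1 (by simp) (by simp) (by simp)
  have e2 : WRuns (B := B) (pour 1 2) (st [[], encode x]) (3 * n + 1)
      (st [[], [], (encode x).reverse]) := by
    rw [st_succ]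
    simpa using pour_st (B := B) (l := [[], encode x, []]) 1 2 (by simp) (by simp) (by simp)
  have e3 : WRuns (B := B) (pour 2 0) (st [[], [], (encode x).reverse]) (3 * n + 1)
      (st [encode x]) := by
    rw [st_succ [encode x], st_succ ([encode x] ++ [[]])]
    simpa using pour_st (B := B) (l := [[], [], (encode x).reverse]) 2 0 (by simp) (by simp)
      (by simp)
  set z := encode [unary (q.eval n)] with hz
  have hzl : z.length = q.eval n + 1 := by simp [hz, encode_cons, encode_nil, unary]
  have e5 : WRuns (B := B) (clear 2) (st [[], (encode x).reverse, z]) (2 * z.length + 1)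
      (st [[], (encode x).reverse]) := by
    rw [st_succ [[], (encode x).reverse]]
    simpa using clear_st (B := B) (l := [[], (encode x).reverse, z]) 2 (by simp)
  have e6 : WRuns (B := B) (pour 1 0) (st [[], (encode x).reverse]) (3 * n + 1)
      (st [encode x]) := by
    rw [st_succ [encode x]]
    simpa using pour_st (B := B) (l := [[], (encode x).reverse]) 1 0 (by simp) (by simp) (by simp)
  obtain ⟨t1, ht1, h1⟩ := e1.seq (e2.seq e3)
  obtain ⟨t2, ht2, h2⟩ := hp x
  obtain ⟨t3, ht3, h3⟩ := e5.seq e6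
  have h4 := h1.seq (h2.seq h3)
  rw [wd_st, wd_st] at h4
  refine ⟨_, ?_, ?_, h4⟩
  -- Register `2` receives a unary word of length `q.eval n`, and no program writes more than one
  -- symbol in a step: this is the required delay.
  · have := h2.length_le 2
    have h5 : (wd (B := B) (st [[], (encode x).reverse, z] 2)).length = q.eval n + 1 := by
      rw [← hzl]
      simp [st]
    have h6 : (wd (B := B) (st [encode x] 2)).length = 0 := by simp [st]
    change (wd (B := B) (st [[], (encode x).reverse, z] 2)).length ≤ _ at this
    rw [h5, h6] at this
    omega
  · rw [← hn] at ht2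
    simp only [Polynomial.eval_add, Polynomial.eval_mul, Polynomial.eval_X, Polynomial.eval_ofNat]
    omega

/-- Polynomial-time functions can be applied to a sequence of strings together with polynomially
many random bits. -/
theorem exists_ppt {G : List (List Bool) → List (List Bool)} (hG : PolyTime B G)
    (q : Polynomial ℕ) : ∃ (M : PPT) (t : List (List Bool) → ℕ), ∀ l,
      q.eval (encode l).length ≤ t l ∧ ∀ ω : M.Coins l, t l ≤ (M.result l ω).2.length ∧
        (M.result l ω).2 <+: List.ofFn ω ∧
        M.out l ω = hd (G ((M.result l ω).2.take (t l) :: l)) := by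
  obtain ⟨V, hV⟩ := hG.length_le
  obtain ⟨p, T, hp⟩ := hG.hd'
  obtain ⟨p₀, T₀, hp₀⟩ := exists_wait (B := B) q
  set p₁ := complete.seq p₀
  set p₂ := (push 0 (Sum.inl none)).seq ((pour 1 2).seq ((pour 2 0).seq (p.seq
    ((pourBits 0 1).seq ((clear 0).seq ((pour 1 2).seq (pour 2 0))))))) with hp₂
  obtain ⟨N₁, hN₁⟩ := exists_below p₁
  obtain ⟨N₂, hN₂⟩ := exists_below p₂
  set N := N₁ + N₂ + 1
  -- the part that reads the input
  have h₁ : ∀ w : List (Option Bool), ∃ l t, (∀ l', w = encode l' → l = l') ∧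
      q.eval (encode l).length ≤ t ∧ (encode l).length ≤ w.length + 1 ∧
      t ≤ 2 + T₀.eval (w.length + 1) ∧
      Exec p₁ (st [wd w.reverse]) t (st [wd (encode l)]) := by
    intro w
    obtain ⟨l, hl, hl', t₁, ht₁, hE₁⟩ := complete_runs (B := B) w
    obtain ⟨t₂, ht₂, ht₂', hE₂⟩ := hp₀ l
    rw [wd_st, wd_st] at hE₁
    exact ⟨l, t₁ + t₂, hl, by omega, hl', add_le_add ht₁ (ht₂'.trans (eval_mono _ hl')),
      hE₁.seq hE₂⟩
  choose l t hl hq hlen ht hE using h₁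
  -- the part that computes the output
  have h₂ : ∀ (x : List (List Bool)) (ω : List Bool), WRuns p₂ (st [encode x, ω.map some])
      (1 + (3 * ω.length + 1 + (3 * ω.length + 1 + (T.eval (encode (ω :: x)).length +
        (3 * (hd (G (ω :: x))).length + 1 + (3 + (3 * (hd (G (ω :: x))).length + 1 +
        (3 * (hd (G (ω :: x))).length + 1))))))))
      (st [(hd (G (ω :: x))).reverse.map some]) := by
    intro x ω
    have e1 := push_st (B := B) (l := [encode x, ω.map some]) 0 (by simp) none
    have e2 : WRuns (B := B) (pour 1 2) (st [none :: encode x, ω.map some]) (3 * ω.length + 1)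
        (st [none :: encode x, [], (ω.map some).reverse]) := by
      rw [st_succ [none :: encode x, ω.map some]]
      simpa using pour_st (B := B) (l := [none :: encode x, ω.map some, []]) 1 2 (by simp) (by simp)
        (by simp)
    have e3 : WRuns (B := B) (pour 2 0) (st [none :: encode x, [], (ω.map some).reverse])
        (3 * ω.length + 1) (st [encode (ω :: x)]) := by
      rw [st_succ [encode (ω :: x)], st_succ ([encode (ω :: x)] ++ [[]]), encode_cons]
      simpa using pour_st (B := B) (l := [none :: encode x, [], (ω.map some).reverse]) 2 0 (by simp)
        (by simp) (by simp)
    have e4 := hp (ω :: x)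
    set o := hd (G (ω :: x))
    have e5 : WRuns (B := B) (pourBits 0 1) (st [encode [o]]) (3 * o.length + 1)
        (st [[none], o.reverse.map some]) := by
      rw [st_succ [encode [o]]]
      simpa using pourBits_st (B := B) (l := [encode [o], []]) 0 1 (by simp) (by simp) (by simp)
        (u := o) (v := [none]) (by simp) (by simp [encode_cons, encode_nil])
    have e6 : WRuns (B := B) (clear 0) (st [[none], o.reverse.map some]) 3
        (st [[], o.reverse.map some]) := by
      simpa using clear_st (B := B) (l := [[none], o.reverse.map some]) 0 (by simp)
    have e7 : WRuns (B := B) (pour 1 2) (st [[], o.reverse.map some]) (3 * o.length + 1)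
        (st [[], [], o.map some]) := by
      rw [st_succ [[], o.reverse.map some]]
      simpa using pour_st (B := B) (l := [[], o.reverse.map some, []]) 1 2 (by simp) (by simp)
        (by simp)
    have e8 : WRuns (B := B) (pour 2 0) (st [[], [], o.map some]) (3 * o.length + 1)
        (st [o.reverse.map some]) := by
      rw [st_succ [o.reverse.map some], st_succ ([o.reverse.map some] ++ [[]])]
      simpa using pour_st (B := B) (l := [[], [], o.map some]) 2 0 (by simp) (by simp) (by simp)
    exact e1.seq (e2.seq (e3.seq (e4.seq (e5.seq (e6.seq (e7.seq e8))))))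
  -- `L` bounds the number of recorded bits, `W` the length of the code of the record together with
  -- the input; the second phase is polynomial in the latter.
  set L : Polynomial ℕ := 2 * Polynomial.X + 1 + (2 + T₀.comp (Polynomial.X + 1)) with hL
  set W : Polynomial ℕ := L + Polynomial.X + 2
  have key : ∀ (w : List (Option Bool)) (r : List Bool), (3 * L + 1 + (20 + 6 * L + T.comp W +
      9 * V.comp W) + (2 * V.comp W + 2)).eval w.length ≤ r.length →
      ((ioMachine N p₁ p₂).run w r).1.l = none ∧
      ((ioMachine N p₁ p₂).result w r).1 = hd (G (r.take (2 * w.length + 1 + t w) :: l w)) ∧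
      ((ioMachine N p₁ p₂).result w r).2 <+: r ∧
      2 * w.length + 1 + t w ≤ ((ioMachine N p₁ p₂).result w r).2.length := by
    intro w r hr
    have htL : 2 * w.length + 1 + t w ≤ L.eval w.length := by
      simp only [hL, Polynomial.eval_add, Polynomial.eval_mul, Polynomial.eval_X,
        Polynomial.eval_ofNat, Polynomial.eval_one, Polynomial.eval_comp]
      have := ht w
      omega
    have hlenL : ∀ ω : List Bool, ω.length = 2 * w.length + 1 + t w →
        (encode (ω :: l w)).length ≤ W.eval w.length := by
      intro ω hω
      have := hlen w
      simp only [W, encode_cons, List.length_append, List.length_cons, List.length_map,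
        Polynomial.eval_add, Polynomial.eval_X, Polynomial.eval_ofNat]
      omega
    have hout : ∀ ω : List Bool, ω.length = 2 * w.length + 1 + t w →
        (hd (G (ω :: l w))).length ≤ (V.comp W).eval w.length := by
      intro ω hω
      have h1 := hV (ω :: l w)
      have h2 := length_hd_add_tail (G (ω :: l w))
      rw [Polynomial.eval_comp]
      exact le_trans (by omega) (eval_mono V (hlenL ω hω))
    refine ioMachine_result (g := fun ω => hd (G (ω :: l w))) (U := (V.comp W).eval w.length)
      (T := (20 + 6 * L + T.comp W + 9 * V.comp W).eval w.length)
      (by omega) (hN₁.mono (by omega)) (hN₂.mono (by omega)) (hE w) rfl ?_ ?_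
    · intro ω hω
      refine ⟨hout ω hω, ?_⟩
      obtain ⟨t₂, ht₂, hE₂⟩ := h₂ (l w) ω
      have e : (fun j => wd (st [encode (l w), ω.map some] j)) =
          Function.update (st [wd (encode (l w))]) 1 (wd (B := B) (ω.map some)) := by
        funext j
        match j with
        | 0 => rfl
        | 1 => rfl
        | _ + 2 => rfl
      rw [e] at hE₂
      refine ⟨t₂, ht₂.trans ?_, _, hE₂, rfl⟩
      have h1 := hout ω hω
      have h2 := eval_mono T (hlenL ω hω)
      simp only [Polynomial.eval_add, Polynomial.eval_mul, Polynomial.eval_ofNat]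
      rw [Polynomial.eval_comp (p := T)]
      omega
    · simp only [Polynomial.eval_add, Polynomial.eval_mul, Polynomial.eval_ofNat,
        Polynomial.eval_one] at hr ⊢
      omega
  -- The number of recorded bits is the duration of the first phase, including the reading of the
  -- input. It does not depend on the random bits.
  refine ⟨⟨ioMachine N p₁ p₂, _, fun w r => (key w (List.ofFn r) (by rw [List.length_ofFn])).1⟩,
    fun x => 2 * (encode x).length + 1 + t (encode x), fun x => ⟨?_, fun ω => ?_⟩⟩
  · have := hq (encode x)
    rw [hl _ x rfl] at this
    show _ ≤ 2 * (encode x).length + 1 + t (encode x)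
    omega
  · obtain ⟨-, h2, h3, h4⟩ := key (encode x) (List.ofFn ω) (by rw [List.length_ofFn])
    refine ⟨h4, h3, h2.trans ?_⟩
    rw [hl _ x rfl]
    congr 3
    obtain ⟨r, hr⟩ := h3
    conv_lhs => rw [← hr]
    exact List.take_append_of_le_length h4

end StackProg

/-! ### Loops, unary and binary numbers, finite tables and automata in polynomial time -/

theorem length_unary (n : ℕ) : (unary n).length = n := List.length_replicate

theorem unary_succ (n : ℕ) : unary (n + 1) = true :: unary n := rfl

theorem unary_append (m n : ℕ) : unary m ++ unary n = unary (m + n) := by simp [unary]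

theorem drop_unary (m n : ℕ) : (unary n).drop m = unary (n - m) := by simp [unary]

theorem tail_unary (n : ℕ) : (unary n).tail = unary (n - 1) := by simp [unary]

/-- The output when all random bits are `1`. -/
def PPT.outOnes (M : PPT) (l : List (List Bool)) : List Bool := M.out l fun _ => true

namespace StackProg

variable {B : Type}

theorem length_encode_pair (u v : List Bool) : (encode [u, v]).length = u.length + v.length + 2 := by
  simp [encode_cons, encode_nil]
  omega

theorem length_encode_triple (u v w : List Bool) :
    (encode [u, v, w]).length = u.length + v.length + w.length + 3 := by
  simp [encode_cons, encode_nil]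
  omega

namespace PolyTime

variable {f g h c : List (List Bool) → List (List Bool)}
variable {u v w : List (List Bool) → List Bool}
variable {p q : List (List Bool) → Bool} {m n : List (List Bool) → ℕ}

/-- A loop is described by its trajectory `S j x`, so the body has to behave well only on the states
that occur; their size is controlled by one polynomial-time function `b`. -/
theorem of_iterate (hf : PolyTime B f) (hn : PolyTime B fun x => [unary (n x)])
    (S : ℕ → List (List Bool) → List (List Bool)) (h0 : PolyTime B (S 0))
    (hS : ∀ x, ∀ j < n x, f (S j x) = S (j + 1) x) {b : List (List Bool) → List (List Bool)}
    (hb : PolyTime B b) (hSb : ∀ x, ∀ j ≤ n x, (encode (S j x)).length ≤ (encode (b x)).length) :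
    PolyTime B fun x => S (n x) x := by
  obtain ⟨V, hV⟩ := hb.length_le
  have key : ∀ x j, j ≤ n x → f^[j] (S 0 x) = S j x := by
    intro x j
    induction j with
    | zero => exact fun _ => rfl
    | succ j ih =>
      intro hj
      rw [Function.iterate_succ_apply', ih (by omega), hS x j (by omega)]
  refine (hf.iterate (hn.cons h0) V fun x j hj => ?_).congr fun x => ?_
  · rw [hd_cons, length_unary] at hj
    rw [List.tail_cons, key x j hj]
    exact (hSb x j hj).trans (hV x)
  · rw [hd_cons, length_unary, List.tail_cons, key x _ le_rfl]

theorem ite (hp : PolyTime B fun x => [[p x]]) (hf : PolyTime B f) (hg : PolyTime B g) :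
    PolyTime B fun x => if p x then f x else g x :=
  (hp.cases hf hf hg).congr fun x => by cases p x <;> rfl

theorem ite_str (hp : PolyTime B fun x => [[p x]]) (hu : PolyTime B fun x => [u x])
    (hv : PolyTime B fun x => [v x]) : PolyTime B fun x => [if p x then u x else v x] :=
  (hp.ite hu hv).congr fun x => by cases p x <;> rfl

theorem and (hp : PolyTime B fun x => [[p x]]) (hq : PolyTime B fun x => [[q x]]) :
    PolyTime B fun x => [[p x && q x]] :=
  (hp.ite hq (const [[false]])).congr fun x => by cases p x <;> rfl

theorem not (hp : PolyTime B fun x => [[p x]]) : PolyTime B fun x => [[!p x]] :=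
  (hp.ite (const [[false]]) (const [[true]])).congr fun x => by cases p x <;> rfl

theorem beq (hp : PolyTime B fun x => [[p x]]) (hq : PolyTime B fun x => [[q x]]) :
    PolyTime B fun x => [[p x == q x]] :=
  (hp.ite hq hq.not).congr fun x => by cases p x <;> simp

/-- The loop runs for `n x` rounds but does nothing once the condition fails, so its trajectory is
`S (min j (m x)) x`. -/
theorem while_loop (hf : PolyTime B f) (hp : PolyTime B fun x => [[p x]])
    (hn : PolyTime B fun x => [unary (n x)])
    (S : ℕ → List (List Bool) → List (List Bool)) (h0 : PolyTime B (S 0)) (hmn : ∀ x, m x ≤ n x)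
    (hS : ∀ x, ∀ j < m x, p (S j x) = true ∧ f (S j x) = S (j + 1) x)
    (hend : ∀ x, p (S (m x) x) = false) {b : List (List Bool) → List (List Bool)}
    (hb : PolyTime B b) (hSb : ∀ x, ∀ j ≤ m x, (encode (S j x)).length ≤ (encode (b x)).length) :
    PolyTime B fun x => S (m x) x := by
  refine ((hp.ite hf id).of_iterate hn (fun j x => S (min j (m x)) x)
    (h0.congr fun x => by rw [Nat.zero_min]) (fun x j _ => ?_) hb
    fun x j _ => hSb x _ (min_le_right _ _)).congr fun x => by rw [min_eq_right (hmn x)]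
  rcases lt_or_ge j (m x) with hj | hj
  · rw [min_eq_left hj.le, min_eq_left hj, if_pos (hS x j hj).1, (hS x j hj).2]
  · rw [min_eq_right hj, min_eq_right (by omega), if_neg (by simp [hend])]

theorem unary_length (hu : PolyTime B fun x => [u x]) :
    PolyTime B fun x => [unary (u x).length] :=
  (tailBit.comp (length.comp hu)).congr fun x => by
    simp [encode_cons, encode_nil, unary_succ]

theorem drop (i : ℕ) : PolyTime B fun x => x.drop i := by
  induction i with
  | zero => exact id
  | succ i ih => exact (ih.comp tail).congr fun x => by simp

theorem nth (i : ℕ) : PolyTime B fun x => [hd (x.drop i)] := (drop i).hd'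

theorem tail_str (hu : PolyTime B fun x => [u x]) : PolyTime B fun x => [(u x).tail] :=
  (tailBit.comp hu).congr fun _ => rfl

theorem head_or (hu : PolyTime B fun x => [u x]) : PolyTime B fun x => [[(u x).headD false]] :=
  (hu.cases (const [[false]]) (const [[true]]) (const [[false]])).congr fun x => by
    rw [hd_cons]
    rcases u x with _ | ⟨_ | _, _⟩ <;> rfl

theorem isEmpty (hu : PolyTime B fun x => [u x]) : PolyTime B fun x => [[(u x).isEmpty]] :=
  (hu.cases (const [[true]]) (const [[false]]) (const [[false]])).congr fun x => by
    rw [hd_cons]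
    rcases u x with _ | ⟨_ | _, _⟩ <;> rfl

theorem isEmpty_list (hf : PolyTime B f) : PolyTime B fun x => [[(f x).isEmpty]] :=
  (length.comp hf).isEmpty.congr fun x => by
    rcases f x with _ | ⟨_, _⟩
    · rfl
    · simp [encode_cons, unary]

theorem take_append_drop_list (hu : PolyTime B fun x => [u x])
    (hn : PolyTime B fun x => [unary (n x)]) :
    PolyTime B fun x => [(u x).take (n x), (u x).drop (n x)] := by
  have hf : PolyTime B fun y : List (List Bool) => if (hd (y.drop 1)).isEmpty then y else
      [hd y ++ [(hd (y.drop 1)).headD false], (hd (y.drop 1)).tail] :=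
    (nth 1).isEmpty.ite id ((head.concat (nth 1).head_or).pair (nth 1).tail_str)
  refine hf.of_iterate hn (fun j x => [(u x).take j, (u x).drop j])
    (((const [[]]).append hu).congr fun x => by simp) (fun x j _ => ?_) (hu.pair (const [[]]))
    fun x j _ => ?_
  · simp only [List.drop_succ_cons, List.drop_zero, hd_cons]
    rcases h : (u x).drop j with _ | ⟨b, r⟩
    · have : (u x).length ≤ j := by simpa using h
      simp [List.take_of_length_le this, List.take_of_length_le (this.trans (Nat.le_succ j)),
        List.drop_eq_nil_of_le (this.trans (Nat.le_succ j))]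
    · have h1 : (u x)[j]? = some b := by
        rw [← List.head?_drop, h]
        rfl
      rw [← List.drop_drop, h, List.take_add_one, h1]
      rfl
  · rw [length_encode_pair, length_encode_pair, List.length_take, List.length_drop, List.length_nil]
    omega

theorem take_str (hu : PolyTime B fun x => [u x]) (hn : PolyTime B fun x => [unary (n x)]) :
    PolyTime B fun x => [(u x).take (n x)] := (take_append_drop_list hu hn).hd'

theorem drop_str (hu : PolyTime B fun x => [u x]) (hn : PolyTime B fun x => [unary (n x)]) :
    PolyTime B fun x => [(u x).drop (n x)] :=
  (tail.comp (take_append_drop_list hu hn)).congr fun _ => rfl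

theorem le (hm : PolyTime B fun x => [unary (m x)]) (hn : PolyTime B fun x => [unary (n x)]) :
    PolyTime B fun x => [[decide (m x ≤ n x)]] :=
  (hm.drop_str hn).isEmpty.congr fun x => by
    rw [drop_unary, Bool.decide_congr (Nat.sub_eq_zero_iff_le).symm]
    cases m x - n x <;> rfl

theorem eq_nat (hm : PolyTime B fun x => [unary (m x)]) (hn : PolyTime B fun x => [unary (n x)]) :
    PolyTime B fun x => [[decide (m x = n x)]] :=
  ((hm.le hn).and (hn.le hm)).congr fun x => by
    rw [Bool.decide_congr (le_antisymm_iff (a := m x) (b := n x)), Bool.decide_and]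

/-- Both strings are stripped bit by bit while a flag remembers whether they agreed so far.
Emptiness is compared too, since the default `false` of `headD` would not distinguish an exhausted
string from a leading `0`. -/
theorem eq_str (hu : PolyTime B fun x => [u x]) (hv : PolyTime B fun x => [v x]) :
    PolyTime B fun x => [[decide (u x = v x)]] := by
  have hf : PolyTime B fun y : List (List Bool) => [(hd y).tail, (hd (y.drop 1)).tail,
      [(hd (y.drop 2)).headD false && ((hd y).isEmpty == (hd (y.drop 1)).isEmpty &&
        ((hd y).headD false == (hd (y.drop 1)).headD false))]] :=
    head.tail_str.triple (nth 1).tail_str ((nth 2).head_or.and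
      ((head.isEmpty.beq (nth 1).isEmpty).and (head.head_or.beq (nth 1).head_or)))
  have hn : PolyTime B fun x => [unary ((u x).length + (v x).length)] :=
    hu.unary_length.unary_add hv.unary_length
  refine ((nth 2).comp (hf.of_iterate hn
    (fun j x => [(u x).drop j, (v x).drop j, [decide ((u x).take j = (v x).take j)]])
    ((hu.triple hv (const [[true]])).congr fun x => by simp)
    (fun x j _ => ?_) (hu.triple hv (const [[true]])) fun x j _ => ?_)).congr fun x => ?_
  · simp only [hd_cons, List.tail_drop, List.drop_succ_cons, List.drop_zero, List.headD_cons,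
      List.cons.injEq, true_and, and_true]
    have h1 : ∀ l : List Bool, l.take (j + 1) = l.take j ++ (l.drop j).head?.toList := fun l => by
      rw [List.take_add_one, List.head?_drop]
    rw [h1, h1]
    have h2 : (u x).take j ++ ((u x).drop j).head?.toList =
        (v x).take j ++ ((v x).drop j).head?.toList ↔ (u x).take j = (v x).take j ∧
        ((u x).drop j).head? = ((v x).drop j).head? := by
      constructor
      · intro h
        have h3 := congrArg List.length h
        simp only [List.length_append, List.length_take] at h3
        have h4 := congrArg (List.take j) h
        rw [← h1, ← h1, List.take_take, List.take_take, min_eq_left (Nat.le_succ j)] at h4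
        rw [h4] at h
        have h5 := List.append_cancel_left h
        refine ⟨h4, ?_⟩
        rcases h6 : ((u x).drop j).head? <;> rcases h7 : ((v x).drop j).head? <;>
          simp [h6, h7] at h5 ⊢
        exact h5
      · rintro ⟨h3, h4⟩
        rw [h3, h4]
    rw [Bool.decide_congr h2, Bool.decide_and]
    congr 1
    rcases (u x).drop j with _ | ⟨_ | _, _⟩ <;> rcases (v x).drop j with _ | ⟨_ | _, _⟩ <;> simp
  · rw [length_encode_triple, length_encode_triple]
    simp only [List.length_drop, List.length_singleton]
    omega
  · simp only [List.drop_succ_cons, List.drop_zero, hd_cons]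
    rw [List.take_of_length_le (by omega), List.take_of_length_le (by omega)]

/-- Counting up to `n x` with a parity bit: the quotient grows whenever the parity returns to even.
-/
theorem half_odd (hn : PolyTime B fun x => [unary (n x)]) :
    PolyTime B fun x => [unary (n x / 2), [decide (n x % 2 = 1)]] := by
  have hf : PolyTime B fun y : List (List Bool) =>
      [if (hd (y.drop 1)).headD false then hd y ++ [true] else hd y,
        [!(hd (y.drop 1)).headD false]] :=
    (ite_str (nth 1).head_or (head.concat (const [[true]])) head).pair (nth 1).head_or.not
  refine hf.of_iterate hn (fun j x => [unary (j / 2), [decide (j % 2 = 1)]]) (const [[], [false]])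
    (fun x j _ => ?_) (hn.pair (const [[true]])) fun x j hj => ?_
  · simp only [List.drop_succ_cons, List.drop_zero, hd_cons, List.headD_cons, decide_eq_true_eq]
    rcases Nat.mod_two_eq_zero_or_one j with h | h
    · rw [if_neg (by omega), show (j + 1) / 2 = j / 2 by omega, show (j + 1) % 2 = 1 by omega, h]
      rfl
    · rw [if_pos h, show (j + 1) / 2 = j / 2 + 1 by omega, show (j + 1) % 2 = 0 by omega, h,
        ← unary_append]
      rfl
  · rw [length_encode_pair, length_encode_pair, length_unary, length_unary, List.length_singleton,
      List.length_singleton]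
    omega

/-- Repeated halving; each remainder is the next more significant digit and is put in front. -/
theorem bits (hm : PolyTime B fun x => [unary (m x)]) (hn : PolyTime B fun x => [unary (n x)]) :
    PolyTime B fun x => [bits (m x) (n x)] := by
  have hh : PolyTime B fun y : List (List Bool) =>
      [unary ((hd y).length / 2), [decide ((hd y).length % 2 = 1)]] := head.unary_length.half_odd
  have hf : PolyTime B fun y : List (List Bool) => [unary ((hd y).length / 2),
      [decide ((hd y).length % 2 = 1)] ++ hd (y.drop 1)] :=
    ((hh.hd').pair (((nth 1).comp hh).concat (nth 1))).congr fun _ => rfl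
  refine (nth 1).comp (hf.of_iterate hm (fun j x => [unary (n x / 2 ^ j), _root_.bits j (n x)])
    ((hn.pair (const [[]])).congr fun x => by simp [_root_.bits])
    (fun x j _ => ?_) (hn.pair hm) fun x j hj => ?_)
  · simp only [hd_cons, length_unary, List.drop_succ_cons, List.drop_zero]
    rw [Nat.div_div_eq_div_mul, ← pow_succ]
    simp [_root_.bits, List.range_succ, Nat.testBit_eq_decide_div_mod_eq]
  · rw [length_encode_pair, length_encode_pair, length_unary, length_unary, length_unary]
    have : (_root_.bits j (n x)).length = j := by simp [_root_.bits]
    have := Nat.div_le_self (n x) (2 ^ j)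
    omega

theorem clog (hn : PolyTime B fun x => [unary (n x)]) :
    PolyTime B fun x => [unary (Nat.clog 2 (n x))] := by
  have hf : PolyTime B fun y : List (List Bool) =>
      [hd y ++ hd y, hd (y.drop 1) ++ [true], hd (y.drop 2)] :=
    (head.concat head).triple ((nth 1).concat (const [[true]])) (nth 2)
  have hp : PolyTime B fun y : List (List Bool) =>
      [[!decide ((hd (y.drop 2)).length ≤ (hd y).length)]] :=
    ((nth 2).unary_length.le head.unary_length).not
  refine (nth 1).comp (hf.while_loop (m := fun x => Nat.clog 2 (n x)) hp hn
    (fun j x => [unary (2 ^ j), unary j, unary (n x)])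
    (((const [unary 1]).triple (const [[]]) hn).congr fun _ => rfl)
    (fun x => ?_) (fun x j hj => ?_) (fun x => ?_)
    ((hn.unary_add (hn.unary_add (const [unary 2]))).triple hn hn) fun x j hj => ?_)
  · exact Nat.clog_le_of_le_pow (Nat.lt_two_pow_self).le
  · have h1 : 2 ^ j < n x := (Nat.lt_clog_iff_pow_lt (by norm_num)).1 hj
    simp only [hd_cons, length_unary, List.drop_succ_cons, List.drop_zero, unary_append, pow_succ,
      mul_two]
    refine ⟨by simpa using h1, ?_⟩
    rw [← unary_append j 1]
    rfl
  · have := Nat.le_pow_clog (b := 2) (by norm_num) (n x)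
    simpa [length_unary] using this
  · simp only [length_encode_triple, length_unary]
    have h2 : j ≤ n x := hj.trans (Nat.clog_le_of_le_pow (Nat.lt_two_pow_self).le)
    -- As long as the loop runs, the previous power is less than `n x`, so doubling stays below `2 *
    -- n x`; the summand `2` covers `j = 0`.
    have h1 : 2 ^ j ≤ n x + (n x + 2) := by
      rcases j with _ | j
      · rw [pow_zero]
        omega
      · have := (Nat.lt_clog_iff_pow_lt (b := 2) (by norm_num)).1 hj
        rw [pow_succ]
        omega
    omega

/-- A finite table is a nested case distinction on a unary number: one removes a bit and shifts the
table. Arbitrary functions on a finite range, such as choices made by a strategy, are thereby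
computable. -/
theorem table (N : ℕ) : ∀ (g : ℕ → List Bool) {n : List (List Bool) → ℕ},
    (PolyTime B fun x => [unary (n x)]) →
    PolyTime B fun x => [if n x < N then g (n x) else []] := by
  induction N with
  | zero => exact fun g n hn => (const [[]]).congr fun x => by simp
  | succ N ih =>
    intro g n hn
    refine (hn.isEmpty.ite_str (const [g 0]) (ih (fun j => g (j + 1)) (n := fun x => n x - 1)
      (hn.tail_str.congr fun x => by rw [tail_unary]))).congr fun x => ?_
    rcases n x with _ | k
    · simp [unary]
    · simp [unary]

theorem lookup (N : ℕ) (g : ℕ → List Bool) (hn : PolyTime B fun x => [unary (n x)])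
    (hN : ∀ x, n x < N) : PolyTime B fun x => [g (n x)] :=
  (table N g hn).congr fun x => by rw [if_pos (hN x)]

theorem lookup_bool (N : ℕ) (g : ℕ → Bool) (hn : PolyTime B fun x => [unary (n x)])
    (hN : ∀ x, n x < N) : PolyTime B fun x => [[g (n x)]] := lookup N (fun j => [g j]) hn hN

/-- A finite automaton with `N` states, kept in unary, whose transitions are looked up in two
tables. -/
theorem foldl (N : ℕ) (hN : 0 < N) (δ : ℕ → Bool → ℕ) (hδ : ∀ j b, δ j b < N)
    (hu : PolyTime B fun x => [u x]) : PolyTime B fun x => [unary ((u x).foldl δ 0)] := by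
  have hlt : ∀ l : List Bool, l.foldl δ 0 < N := by
    intro l
    induction l using List.reverseRecOn with
    | nil => exact hN
    | append_singleton l b _ =>
      rw [List.foldl_append]
      exact hδ _ _
  have hf : PolyTime B fun y : List (List Bool) => [(hd y).tail,
      if (hd y).headD false then
        if (hd (y.drop 1)).length < N then unary (δ (hd (y.drop 1)).length true) else []
      else if (hd (y.drop 1)).length < N then unary (δ (hd (y.drop 1)).length false) else []] :=
    head.tail_str.pair (head.head_or.ite_str (table N (fun j => unary (δ j true))
      (nth 1).unary_length) (table N (fun j => unary (δ j false)) (nth 1).unary_length))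
  refine ((nth 1).comp (hf.of_iterate hu.unary_length
    (fun j x => [(u x).drop j, unary (((u x).take j).foldl δ 0)])
    ((hu.pair (const [[]])).congr fun x => by simp [unary])
    (fun x j hj => ?_) (hu.pair (const [unary N])) fun x j hj => ?_)).congr fun x => ?_
  · simp only [hd_cons, length_unary, List.drop_succ_cons, List.drop_zero, hlt, if_true,
      List.tail_drop]
    rw [List.take_add_one, List.getElem?_eq_getElem hj, List.foldl_append,
      List.drop_eq_getElem_cons hj]
    simp only [List.headD_cons, Option.toList_some, List.foldl_cons, List.foldl_nil]
    cases (u x)[j] <;> rfl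
  · rw [length_encode_pair, length_encode_pair, length_unary, length_unary]
    have := hlt ((u x).take j)
    simp only [List.length_drop]
    omega
  · simp

theorem run_of (M : ProbTM) (e : M.Symbols ↪ B) (hu : PolyTime B fun x => [u x])
    (hf : PolyTime B f) : PolyTime B fun x => [(M.result (encode (f x)) (u x)).1] :=
  (run M e).comp (hu.cons hf) |>.congr fun x => by simp

theorem unary_eval_length (q : Polynomial ℕ) (hf : PolyTime B f) :
    PolyTime B fun x => [unary (q.eval (encode (f x)).length)] :=
  (length.comp hf).unary_eval q

/-- A tape of ones is a unary word, so it can be generated within the calculus. For machines whose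
output does not depend on the coins any fixed tape would do. -/
theorem run_ppt (M : PPT) (e : M.toProbTM.Symbols ↪ B) (hf : PolyTime B f) :
    PolyTime B fun x => [M.outOnes (f x)] :=
  (run_of M.toProbTM e (unary_eval_length M.time hf) hf).congr fun x => by
    rw [PPT.outOnes, PPT.out, PPT.result, List.ofFn_const, unary]

end PolyTime

end StackProg

section

open scoped ENNReal

/-! ## Distributions -/

namespace PMF

variable {α β γ : Type*}

/-- The expected value of a function with nonnegative values. -/
def mean (p : PMF α) (g : α → ℝ≥0∞) : ℝ≥0∞ := ∑' a, p a * g a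

theorem mean_pure (a : α) (g : α → ℝ≥0∞) : (pure a).mean g = g a := by
  classical
  rw [mean, tsum_eq_single a fun b hb => by simp [pure_apply, hb]]
  simp [pure_apply]

theorem mean_bind (p : PMF α) (k : α → PMF β) (g : β → ℝ≥0∞) :
    (p.bind k).mean g = p.mean fun a => (k a).mean g := by
  simp only [mean, bind_apply, ← ENNReal.tsum_mul_right, ← ENNReal.tsum_mul_left]
  rw [ENNReal.tsum_comm]
  simp only [mul_assoc]

theorem mean_map (p : PMF α) (f : α → β) (g : β → ℝ≥0∞) : (p.map f).mean g = p.mean (g ∘ f) := by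
  rw [← bind_pure_comp, mean_bind]
  exact congrArg _ (funext fun a => mean_pure (f a) g)

theorem mean_mono (p : PMF α) {g h : α → ℝ≥0∞} (hgh : ∀ a ∈ p.support, g a ≤ h a) :
    p.mean g ≤ p.mean h :=
  ENNReal.tsum_le_tsum fun a => by
    by_cases ha : p a = 0
    · simp [ha]
    · gcongr
      exact hgh a ha

theorem mean_congr (p : PMF α) {g h : α → ℝ≥0∞} (hgh : ∀ a ∈ p.support, g a = h a) :
    p.mean g = p.mean h :=
  le_antisymm (p.mean_mono fun a ha => (hgh a ha).le) (p.mean_mono fun a ha => (hgh a ha).ge)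

theorem mean_add (p : PMF α) (g h : α → ℝ≥0∞) :
    (p.mean fun a => g a + h a) = p.mean g + p.mean h := by
  simp only [mean, mul_add, ENNReal.tsum_add]

theorem mean_const (p : PMF α) (c : ℝ≥0∞) : (p.mean fun _ => c) = c := by
  rw [mean, ENNReal.tsum_mul_right, p.tsum_coe, one_mul]

theorem mean_le_one (p : PMF α) {g : α → ℝ≥0∞} (hg : ∀ a, g a ≤ 1) : p.mean g ≤ 1 :=
  (p.mean_mono fun a _ => hg a).trans (p.mean_const 1).le

theorem mean_uniform [Fintype α] [Nonempty α] (g : α → ℝ≥0∞) :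
    (uniformOfFintype α).mean g = (Fintype.card α : ℝ≥0∞)⁻¹ * ∑ a, g a := by
  rw [mean, tsum_fintype]
  simp only [uniformOfFintype_apply]
  rw [← Finset.mul_sum]

theorem ext_mean {p q : PMF α} (h : ∀ g, p.mean g = q.mean g) : p = q := by
  classical
  ext a
  have := h fun b => if b = a then 1 else 0
  simpa [mean] using this

theorem apply_eq_mean (p : PMF α) (a : α) [DecidableEq α] :
    p a = p.mean fun b => if b = a then 1 else 0 := by
  simp [mean]

theorem bind_congr' (p : PMF α) {k k' : α → PMF β} (h : ∀ a ∈ p.support, k a = k' a) :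
    p.bind k = p.bind k' :=
  ext_mean fun g => by
    rw [mean_bind, mean_bind]
    exact p.mean_congr fun a ha => by rw [h a ha]

theorem bind_const' (p : PMF α) (q : PMF β) : (p.bind fun _ => q) = q :=
  ext_mean fun g => by rw [mean_bind, mean_const]

/-- The statistical distance of the two distributions is at most `ε`. -/
def Close (ε : ℝ≥0∞) (p q : PMF α) : Prop :=
  ∀ g : α → ℝ≥0∞, (∀ a, g a ≤ 1) → p.mean g ≤ q.mean g + ε

namespace Close

variable {p q r : PMF α} {ε δ : ℝ≥0∞}

theorem rfl' : Close 0 p p := fun g _ => by rw [add_zero]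

/-- The one-sided inequality is applied to the complementary test `1 - g`. -/
theorem symm (h : Close ε p q) : Close ε q p := by
  intro g hg
  have key : ∀ p : PMF α, p.mean g + p.mean (fun a => 1 - g a) = 1 := fun p => by
    rw [← mean_add, ← p.mean_const 1]
    congr 1
    funext a
    rw [mean_const, add_tsub_cancel_of_le (hg a)]
  have h1 := h (fun a => 1 - g a) fun a => tsub_le_self
  have h2 : q.mean (fun a => 1 - g a) ≠ ∞ :=
    ((q.mean_le_one fun a => tsub_le_self).trans_lt ENNReal.one_lt_top).ne
  rw [← ENNReal.add_le_add_iff_right h2, key q]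
  calc 1 = p.mean g + p.mean (fun a => 1 - g a) := (key p).symm
    _ ≤ p.mean g + (q.mean (fun a => 1 - g a) + ε) := by gcongr
    _ = _ := by ring

theorem trans (h : Close ε p q) (h' : Close δ q r) : Close (ε + δ) p r := fun g hg => by
  refine (h g hg).trans ?_
  rw [add_comm ε, ← add_assoc]
  gcongr
  exact h' g hg

theorem mono (h : Close ε p q) (hε : ε ≤ δ) : Close δ p q := fun g hg =>
  (h g hg).trans (by gcongr)

theorem bind_right (h : Close ε p q) (k : α → PMF β) : Close ε (p.bind k) (q.bind k) :=
  fun g hg => by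
    rw [mean_bind, mean_bind]
    exact h _ fun a => mean_le_one _ hg

theorem bind_left (p : PMF α) {k k' : α → PMF β} (h : ∀ a, Close ε (k a) (k' a)) :
    Close ε (p.bind k) (p.bind k') := fun g hg => by
  rw [mean_bind, mean_bind]
  conv_rhs => rw [← p.mean_const ε, ← mean_add]
  exact p.mean_mono fun a _ => h a g hg

theorem map (h : Close ε p q) (f : α → β) : Close ε (p.map f) (q.map f) := fun g hg => by
  rw [mean_map, mean_map]
  exact h _ fun a => hg _

end Close

theorem mean_toReal (p : PMF α) {g : α → ℝ≥0∞} (hg : ∀ a, g a ≤ 1) :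
    ∑' a, (p a).toReal * (g a).toReal = (p.mean g).toReal := by
  rw [mean, ENNReal.tsum_toReal_eq fun a =>
    ENNReal.mul_ne_top (p.apply_ne_top a) ((hg a).trans_lt ENNReal.one_lt_top).ne]
  simp only [ENNReal.toReal_mul]

theorem Close.abs_sub_le {p q : PMF α} {ε : ℝ} (hε : 0 ≤ ε) (h : Close (ENNReal.ofReal ε) p q)
    {g : α → ℝ≥0∞} (hg : ∀ a, g a ≤ 1) : |(p.mean g).toReal - (q.mean g).toReal| ≤ ε := by
  have key : ∀ {p q : PMF α}, Close (ENNReal.ofReal ε) p q →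
      (p.mean g).toReal ≤ (q.mean g).toReal + ε := by
    intro p q h
    have hq : q.mean g ≠ ∞ := ((q.mean_le_one hg).trans_lt ENNReal.one_lt_top).ne
    have := ENNReal.toReal_mono (ENNReal.add_ne_top.2 ⟨hq, ENNReal.ofReal_ne_top⟩) (h g hg)
    rwa [ENNReal.toReal_add hq ENNReal.ofReal_ne_top, ENNReal.toReal_ofReal hε] at this
  rw [_root_.abs_sub_le_iff]
  have := key h
  have := key h.symm
  constructor <;> linarith

theorem summable_toReal (p : PMF α) : Summable fun a => (p a).toReal :=
  ENNReal.summable_toReal p.tsum_coe_ne_top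

theorem tsum_toReal (p : PMF α) : ∑' a, (p a).toReal = 1 := by
  rw [← ENNReal.tsum_toReal_eq p.apply_ne_top, p.tsum_coe, ENNReal.toReal_one]

/-- The test is the indicator of the set where `q ≤ p`. Both total masses are `1`, so the absolute
difference sums to twice the excess on this set. -/
theorem Close.tsum_abs_sub_le {p q : PMF α} {ε : ℝ} (hε : 0 ≤ ε)
    (h : Close (ENNReal.ofReal ε) p q) : ∑' a, |(p a).toReal - (q a).toReal| ≤ 2 * ε := by
  classical
  set g : α → ℝ≥0∞ := fun a => if (q a).toReal ≤ (p a).toReal then 1 else 0 with hg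
  have hg1 : ∀ a, g a ≤ 1 := fun a => by
    simp only [hg]
    split_ifs <;> simp
  have hs : ∀ p : PMF α, Summable fun a => (p a).toReal * (g a).toReal := fun p =>
    p.summable_toReal.of_nonneg_of_le (fun a => by positivity) fun a =>
      mul_le_of_le_one_right ENNReal.toReal_nonneg (ENNReal.toReal_mono ENNReal.one_ne_top (hg1 a))
  have e : ∀ a, |(p a).toReal - (q a).toReal| = 2 * ((p a).toReal * (g a).toReal -
      (q a).toReal * (g a).toReal) - ((p a).toReal - (q a).toReal) := fun a => by
    by_cases ha : (q a).toReal ≤ (p a).toReal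
    · rw [abs_of_nonneg (by linarith)]
      simp only [hg, ha, if_true, ENNReal.toReal_one]
      ring
    · rw [abs_of_neg (by linarith)]
      simp only [hg, ha, if_false, ENNReal.toReal_zero]
      ring
  rw [tsum_congr e, Summable.tsum_sub (((hs p).sub (hs q)).mul_left 2)
    (p.summable_toReal.sub q.summable_toReal), tsum_mul_left, Summable.tsum_sub (hs p) (hs q),
    Summable.tsum_sub p.summable_toReal q.summable_toReal, tsum_toReal, tsum_toReal,
    mean_toReal p hg1, mean_toReal q hg1]
  have := (abs_le.1 (h.abs_sub_le hε hg1)).2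
  linarith

end PMF

/-! ## Coins -/

/-- The uniform distribution on the bit strings of length `t`. -/
def coins (t : ℕ) : PMF (List Bool) := (PMF.uniformOfFintype (Fin t → Bool)).map List.ofFn

theorem PMF.uniform_prod (α β : Type) [Fintype α] [Fintype β] [Nonempty α] [Nonempty β] :
    uniformOfFintype (α × β) =
      (uniformOfFintype α).bind fun a => (uniformOfFintype β).map fun b => (a, b) := by
  refine ext_mean fun g => ?_
  simp only [mean_bind, mean_map, mean_uniform, Function.comp_def]
  rw [Fintype.sum_prod_type, Fintype.card_prod, ← Finset.mul_sum, Nat.cast_mul,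
    ENNReal.mul_inv (Or.inr (ENNReal.natCast_ne_top _)) (Or.inl (ENNReal.natCast_ne_top _)),
    mul_assoc]

theorem PMF.uniform_map_equiv {α β : Type} [Fintype α] [Fintype β] [Nonempty α] [Nonempty β]
    (e : α ≃ β) : (uniformOfFintype α).map e = uniformOfFintype β := by
  refine ext_mean fun g => ?_
  rw [mean_map, mean_uniform, mean_uniform, Fintype.card_congr e]
  exact congrArg (_ * ·) (e.sum_comp g)

theorem coins_add (m n : ℕ) :
    coins (m + n) = (coins m).bind fun a => (coins n).map fun b => a ++ b := by
  rw [coins, ← PMF.uniform_map_equiv (Fin.appendEquiv m n), PMF.uniform_prod, PMF.map_bind,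
    PMF.map_bind, coins, PMF.bind_map]
  refine congrArg _ (funext fun a => ?_)
  simp only [PMF.map_comp, coins, Function.comp_apply]
  refine congrArg (fun f => PMF.map f _) (funext fun b => ?_)
  simp [Fin.appendEquiv, List.ofFn_fin_append]

theorem length_of_mem_coins {t : ℕ} {ω : List Bool} (h : ω ∈ (coins t).support) : ω.length = t := by
  rw [coins, PMF.support_map] at h
  obtain ⟨r, -, rfl⟩ := h
  exact List.length_ofFn

theorem coins_one : coins 1 = (PMF.uniformOfFintype Bool).map fun b => [b] := by
  rw [coins, ← PMF.uniform_map_equiv (Equiv.funUnique (Fin 1) Bool).symm, PMF.map_comp]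
  rfl

theorem map_take_coins {m t : ℕ} (h : m ≤ t) : (coins t).map (List.take m) = coins m := by
  obtain ⟨k, rfl⟩ := Nat.exists_eq_add_of_le h
  rw [coins_add, PMF.map_bind]
  conv_rhs => rw [← PMF.bind_pure (coins m)]
  refine PMF.bind_congr' _ fun a ha => ?_
  rw [PMF.map_comp, ← PMF.bind_const' (coins k) (PMF.pure a), ← PMF.bind_pure_comp]
  refine congrArg _ (funext fun b => ?_)
  simp [← length_of_mem_coins ha]

theorem coins_bind_split {α : Type} {m t : ℕ} (h : m ≤ t) (k : List Bool → List Bool → PMF α) :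
    ((coins t).bind fun ω => k (ω.take m) (ω.drop m)) =
      (coins m).bind fun a => (coins (t - m)).bind fun b => k a b := by
  obtain ⟨j, rfl⟩ := Nat.exists_eq_add_of_le h
  rw [coins_add, PMF.bind_bind, Nat.add_sub_cancel_left]
  refine PMF.bind_congr' _ fun a ha => ?_
  rw [PMF.bind_map]
  refine congrArg _ (funext fun b => ?_)
  simp [← length_of_mem_coins ha]

theorem sum_range_two_mul {M : Type*} [AddCommMonoid M] (φ : ℕ → M) (m : ℕ) :
    ∑ v ∈ Finset.range (2 * m), φ v = ∑ v ∈ Finset.range m, (φ (2 * v) + φ (2 * v + 1)) := by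
  induction m with
  | zero => rfl
  | succ m ih =>
    rw [Nat.mul_succ, Finset.sum_range_succ, Finset.sum_range_succ, ih, Finset.sum_range_succ,
      add_assoc]

/-- The last coin is the lowest binary digit, so the range of size `2 ^ (n + 1)` is paired into `2 *
v` and `2 * v + 1`. -/
theorem mean_binVal_coins (n : ℕ) (φ : ℕ → ℝ≥0∞) :
    (coins n).mean (fun ω => φ (binVal ω)) = (2 ^ n)⁻¹ * ∑ v ∈ Finset.range (2 ^ n), φ v := by
  induction n generalizing φ with
  | zero => simp [coins, PMF.mean_map, PMF.mean_uniform, binVal]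
  | succ n ih =>
    rw [coins_add, PMF.mean_bind]
    have : ∀ a : List Bool, ((coins 1).map fun b => a ++ b).mean (fun ω => φ (binVal ω)) =
        (fun v => 2⁻¹ * (φ (2 * v) + φ (2 * v + 1))) (binVal a) := fun a => by
      rw [coins_one, PMF.map_comp, PMF.mean_map, PMF.mean_uniform]
      simp [binVal, List.foldl_append, add_comm]
    simp only [this]
    rw [ih fun v => 2⁻¹ * (φ (2 * v) + φ (2 * v + 1)), pow_succ', pow_succ',
      sum_range_two_mul, ← Finset.mul_sum, ← mul_assoc,
      ENNReal.mul_inv (Or.inl two_ne_zero) (Or.inl ENNReal.ofNat_ne_top), mul_comm (2⁻¹ : ℝ≥0∞)]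

/-- Reduction modulo `q` of a binary expansion. -/
def binMod (q : ℕ) (ω : List Bool) : ℕ := ω.foldl (fun j b => (2 * j + b.toNat) % q) 0

theorem binMod_eq (q : ℕ) (ω : List Bool) : binMod q ω = binVal ω % q := by
  induction ω using List.reverseRecOn with
  | nil => exact (Nat.zero_mod q).symm
  | append_singleton ω b ih =>
    rw [binMod, binVal, List.foldl_append, List.foldl_append] at *
    simp only [List.foldl_cons, List.foldl_nil] at *
    rw [ih]
    simp [Nat.add_mod, Nat.mul_mod]

theorem binMod_lt {q : ℕ} (hq : 0 < q) (ω : List Bool) : binMod q ω < q := by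
  rw [binMod_eq]
  exact Nat.mod_lt _ hq

/-- With `m = 2 ^ n / q`, complete blocks of residues give each value weight `m / 2 ^ n ≤ 1 / q`;
the incomplete last block has at most `q` elements and accounts for the error. -/
theorem close_binMod {q : ℕ} [NeZero q] (n : ℕ) :
    PMF.Close (q / 2 ^ n) ((coins n).map (binMod q))
      ((PMF.uniformOfFintype (Fin q)).map Fin.val) := by
  intro g hg
  have hq : 0 < q := Nat.pos_of_ne_zero (NeZero.ne q)
  rw [PMF.mean_map, PMF.mean_map, PMF.mean_uniform, Fintype.card_fin]
  have e : (g ∘ binMod q) = fun ω => (fun v => g (v % q)) (binVal ω) := by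
    funext ω
    simp [binMod_eq]
  rw [e, mean_binVal_coins n fun v => g (v % q)]
  have h1 : ∀ m : ℕ, ∑ v ∈ Finset.range (q * m), g (v % q) = m * ∑ j : Fin q, g j := by
    intro m
    induction m with
    | zero => simp
    | succ m ih =>
      have h : ∑ j ∈ Finset.range q, g ((q * m + j) % q) = ∑ j : Fin q, g j := by
        rw [Finset.sum_range]
        exact Finset.sum_congr rfl fun j _ => by rw [Nat.mul_add_mod, Nat.mod_eq_of_lt j.2]
      rw [Nat.mul_succ, Finset.sum_range_add, ih, h]
      push_cast
      ring
  set m := 2 ^ n / q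
  have h2 : ∑ v ∈ Finset.range (2 ^ n), g (v % q) ≤ m * ∑ j : Fin q, g j + q := by
    have hle : 2 ^ n ≤ q * m + q := by
      have : q * m + 2 ^ n % q = 2 ^ n := Nat.div_add_mod (2 ^ n) q
      have := Nat.mod_lt (2 ^ n) hq
      omega
    refine (Finset.sum_le_sum_of_subset (Finset.range_mono hle)).trans ?_
    rw [Finset.sum_range_add, h1]
    gcongr
    refine (Finset.sum_le_sum fun v _ => hg _).trans ?_
    simp
  have h3 : ((2 ^ n : ℝ≥0∞))⁻¹ * m ≤ (q : ℝ≥0∞)⁻¹ := by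
    rw [mul_comm, ← div_eq_mul_inv]
    refine ENNReal.div_le_of_le_mul ?_
    rw [mul_comm, ← div_eq_mul_inv, ENNReal.le_div_iff_mul_le (Or.inl (by exact_mod_cast hq.ne'))
      (Or.inl (ENNReal.natCast_ne_top q))]
    exact_mod_cast Nat.div_mul_le_self (2 ^ n) q
  calc _ ≤ (2 ^ n)⁻¹ * (m * ∑ j : Fin q, g j + q) := by gcongr
    _ = (2 ^ n)⁻¹ * m * ∑ j : Fin q, g j + q / 2 ^ n := by
      rw [mul_add, mul_assoc, mul_comm _ (q : ℝ≥0∞), div_eq_mul_inv]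
    _ ≤ (q : ℝ≥0∞)⁻¹ * ∑ j : Fin q, g j + q / 2 ^ n := by gcongr

/-- Take for `q` the product of the denominators. Then `σ s = k s / q` with natural numbers `k s`
that sum to `q`, and `q` equally likely numbers are distributed among the elements, `k s` of them to
`s`. -/
theorem exists_sampling {α : Type} [Fintype α] (σ : PMF α) (hσ : RationalWeights σ) :
    ∃ (q : ℕ) (_ : NeZero q) (τ : ℕ → α),
      σ = ((PMF.uniformOfFintype (Fin q)).map Fin.val).map τ := by
  classical
  choose w hw using hσ
  have hw0 : ∀ s, 0 ≤ w s := fun s => by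
    have : (0 : ℝ) ≤ w s := hw s ▸ ENNReal.toReal_nonneg
    exact_mod_cast this
  set q := ∏ s, (w s).den with hq
  have hqpos : 0 < q := Finset.prod_pos fun s _ => (w s).den_pos
  have hk : ∀ s, ∃ k : ℕ, w s * q = k := by
    intro s
    obtain ⟨d, hd⟩ : (w s).den ∣ q := Finset.dvd_prod_of_mem _ (Finset.mem_univ s)
    refine ⟨(w s).num.toNat * d, ?_⟩
    rw [hd]
    push_cast
    rw [← mul_assoc, Rat.mul_den_eq_num]
    have : (((w s).num.toNat : ℤ) : ℚ) = (w s).num := by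
      rw [Int.toNat_of_nonneg (Rat.num_nonneg.2 (hw0 s))]
    rw [← this]
    norm_cast
  choose k hk using hk
  have hσk : ∀ s, σ s = (q : ℝ≥0∞)⁻¹ * k s := by
    intro s
    have h1 : (σ s).toReal * q = k s := by
      rw [hw]
      exact_mod_cast hk s
    have h2 : σ s * q = k s := by
      rw [← ENNReal.ofReal_toReal (σ.apply_ne_top s), ← ENNReal.ofReal_natCast q,
        ← ENNReal.ofReal_mul ENNReal.toReal_nonneg, h1, ENNReal.ofReal_natCast]
    rw [← h2, mul_comm, mul_assoc, ENNReal.mul_inv_cancel (by exact_mod_cast hqpos.ne')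
      (ENNReal.natCast_ne_top q), mul_one]
  have hsum : ∑ s, k s = q := by
    have h1 := σ.tsum_coe
    rw [tsum_fintype, Finset.sum_congr rfl fun s _ => hσk s, ← Finset.mul_sum, mul_comm,
      ← div_eq_mul_inv, ENNReal.div_eq_one_iff (by exact_mod_cast hqpos.ne')
      (ENNReal.natCast_ne_top q)] at h1
    exact_mod_cast h1
  have hcard : Fintype.card (Σ s, Fin (k s)) = q := by simp [hsum]
  set e := Fintype.equivFinOfCardEq hcard
  have : NeZero q := ⟨hqpos.ne'⟩
  refine ⟨q, inferInstance, fun j => if h : j < q then (e.symm ⟨j, h⟩).1 else (e.symm 0).1, ?_⟩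
  refine PMF.ext_mean fun g => ?_
  rw [PMF.mean_map, PMF.mean_map, PMF.mean_uniform, Fintype.card_fin]
  simp only [Function.comp_apply, Fin.is_lt, dif_pos, Fin.eta]
  rw [e.symm.sum_comp fun x => g x.1, Fintype.sum_sigma, PMF.mean, tsum_fintype, Finset.mul_sum]
  refine Finset.sum_congr rfl fun s _ => ?_
  rw [hσk s]
  simp [mul_assoc]

end

section

open scoped ENNReal

/-! ## Negligible functions -/

namespace Negligible

variable {ε δ : ℕ → ℝ}

/-- One more power of `n` eventually absorbs the constant. -/
theorem const_mul (h : Negligible ε) (C : ℝ) : Negligible fun n => C * ε n := by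
  intro c
  filter_upwards [h (c + 1), eventually_gt_atTop ⌈|C|⌉₊] with n hn hC
  have h1 : |C| < n := (Nat.le_ceil _).trans_lt (by exact_mod_cast hC)
  have h0 : (0 : ℝ) < n := (abs_nonneg C).trans_lt h1
  rw [abs_mul]
  calc |C| * |ε n| ≤ n * |ε n| := by gcongr
    _ < n * ((n : ℝ) ^ (c + 1))⁻¹ := by gcongr
    _ = ((n : ℝ) ^ c)⁻¹ := by
      rw [pow_succ]
      field_simp

theorem add (h : Negligible ε) (h' : Negligible δ) : Negligible fun n => ε n + δ n := by
  intro c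
  filter_upwards [h.const_mul 2 c, h'.const_mul 2 c] with n h1 h2
  rw [abs_mul, abs_two] at h1 h2
  linarith [abs_add_le (ε n) (δ n)]

theorem two_pow : Negligible fun n => ((2 : ℝ) ^ n)⁻¹ := by
  intro c
  have h := tendsto_pow_const_mul_const_pow_of_abs_lt_one c (r := (1 / 2 : ℝ)) (by norm_num [abs_lt])
  filter_upwards [h.eventually (gt_mem_nhds one_pos), eventually_gt_atTop 0] with n hn h0
  have h0 : (0 : ℝ) < n := by exact_mod_cast h0
  rw [abs_of_pos (by positivity), lt_inv_comm₀ (by positivity) (by positivity), inv_inv]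
  rw [one_div, inv_pow, ← div_eq_mul_inv, div_lt_one (by positivity)] at hn
  exact hn

end Negligible

/-- A constant that is bounded by a negligible function is not positive. -/
theorem Negligible.not_le {ε : ℕ → ℝ} (h : Negligible ε) {C : ℝ} (hC : 0 < C) :
    ∃ n, 1 ≤ n ∧ ε n < C := by
  obtain ⟨n, h1, h2⟩ := ((h 1).and (eventually_ge_atTop (⌈C⁻¹⌉₊ + 1))).exists
  refine ⟨n, by omega, (le_abs_self _).trans_lt (h1.trans_le ?_)⟩
  have : C⁻¹ ≤ n := (Nat.le_ceil _).trans (by exact_mod_cast (by omega : ⌈C⁻¹⌉₊ ≤ n))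
  rw [pow_one]
  exact inv_le_of_inv_le₀ hC this

/-! ## Laws of machines -/

namespace ProbTM

variable (M : ProbTM)

theorem runFrom_append (c : M.Config) (r r' : List Bool) (h : (M.runFrom c r).1.l = none) :
    M.runFrom c (r ++ r') = M.runFrom c r := by
  induction r generalizing c with
  | nil =>
    obtain ⟨l, v, s⟩ := c
    change l = none at h
    subst h
    rcases r' with _ | ⟨b, r'⟩ <;> rfl
  | cons b r ih =>
    rw [List.cons_append]
    simp only [runFrom] at h ⊢
    rcases hs : M.step b c with _ | c'
    · rfl
    · rw [hs] at h
      simp only at h ⊢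
      rw [ih c' h]

theorem result_append (w : List (Option Bool)) (r r' : List Bool) (h : (M.run w r).1.l = none) :
    M.result w (r ++ r') = M.result w r := by
  rw [result, result, run, run, M.runFrom_append _ _ _ h]

end ProbTM

namespace PPT

variable (M : PPT)

theorem law_eq (l : List (List Bool)) : M.law l =
    (coins (M.time.eval (encode l).length)).map (M.toProbTM.result (encode l)) := by
  rw [law, ProbTM.law, coins, PMF.map_comp]
  rfl

theorem result_take (l : List (List Bool)) (ω : List Bool)
    (h : M.time.eval (encode l).length ≤ ω.length) :
    M.toProbTM.result (encode l) (ω.take (M.time.eval (encode l).length)) =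
      M.toProbTM.result (encode l) ω := by
  conv_rhs => rw [← List.take_append_drop (M.time.eval (encode l).length) ω]
  rw [ProbTM.result_append]
  have hr : List.ofFn (fun i : Fin (M.time.eval (encode l).length) => ω[i]'(i.2.trans_le h)) =
      ω.take (M.time.eval (encode l).length) := by
    refine List.ext_getElem (by simpa using h) fun i h1 h2 => ?_
    simp
  rw [← hr]
  exact M.halts _ _

/-- A halted machine ignores the rest of the tape. Hence a machine can be run on a supply of coins
that is larger than its own time bound, as in simulations. -/
theorem law_eq_of_le (l : List (List Bool)) {t : ℕ} (h : M.time.eval (encode l).length ≤ t) :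
    M.law l = (coins t).map (M.toProbTM.result (encode l)) := by
  rw [law_eq, ← map_take_coins h, PMF.map_comp]
  refine PMF.ext_mean fun g => ?_
  rw [PMF.mean_map, PMF.mean_map]
  refine PMF.mean_congr _ fun ω hω => ?_
  rw [Function.comp_apply, Function.comp_apply, Function.comp_apply, M.result_take]
  rwa [length_of_mem_coins hω]

theorem mem_support_law {l : List (List Bool)} {p : List Bool × List Bool}
    (h : p ∈ (M.law l).support) : ∃ r : M.Coins l, p = M.result l r := by
  rw [law, ProbTM.law, PMF.support_map] at h
  obtain ⟨r, -, rfl⟩ := h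
  exact ⟨r, rfl⟩

theorem result_mem_support_law (l : List (List Bool)) (r : M.Coins l) :
    M.result l r ∈ (M.law l).support := by
  rw [law, ProbTM.law, PMF.support_map]
  exact ⟨r, by simp, rfl⟩

theorem acceptProb_eq (l : List (List Bool)) : M.acceptProb l =
    ((M.law l).mean fun p => if p.1 = [true] then 1 else 0).toReal := by
  rw [acceptProb, ProbTM.acceptProb, PMF.apply_eq_mean, PMF.mean_map]
  rfl

end PPT

namespace StackProg

/-- Polynomial-time functions of polynomially many random bits are computed by machines from which
these bits can be recovered. -/
theorem exists_ppt_law {B : Type} {G : List (List Bool) → List (List Bool)} (hG : PolyTime B G)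
    (q : Polynomial ℕ) : ∃ (M : PPT) (t : List (List Bool) → ℕ), ∀ l,
      q.eval (encode l).length ≤ t l ∧
      (∀ p ∈ (M.law l).support, t l ≤ p.2.length ∧ p.1 = hd (G (p.2.take (t l) :: l))) ∧
      (M.law l).map (fun p => (p.1, p.2.take (t l))) =
        (coins (t l)).map fun ω => (hd (G (ω :: l)), ω) := by
  obtain ⟨M, t, hM⟩ := exists_ppt hG q
  refine ⟨M, t, fun l => ⟨(hM l).1, fun p hp => ?_, ?_⟩⟩
  · obtain ⟨r, rfl⟩ := M.mem_support_law hp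
    exact ⟨((hM l).2 r).1, ((hM l).2 r).2.2⟩
  · have hle : t l ≤ M.time.eval (encode l).length := by
      obtain ⟨h1, h2, -⟩ := (hM l).2 fun _ => false
      simpa using h1.trans h2.length_le
    rw [← map_take_coins hle, PMF.map_comp, M.law_eq, PMF.map_comp]
    refine PMF.ext_mean fun g => ?_
    rw [PMF.mean_map, PMF.mean_map]
    refine PMF.mean_congr _ fun ω hω => ?_
    obtain ⟨r, rfl⟩ : ∃ r : M.Coins l, ω = List.ofFn r := by
      rw [coins, PMF.support_map] at hω
      obtain ⟨r, -, rfl⟩ := hω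
      exact ⟨r, rfl⟩
    obtain ⟨h1, ⟨s, h2⟩, h3⟩ := (hM l).2 r
    have h4 : (List.ofFn r).take (t l) = (M.result l r).2.take (t l) := by
      rw [← h2, List.take_append_of_le_length h1]
    simp only [Function.comp_apply]
    rw [h4, ← h3]
    rfl

end StackProg

/-! ## The commitment game -/

theorem length_bits (w v : ℕ) : (bits w v).length = w := by simp [bits]

namespace CommitmentScheme

variable (S : CommitmentScheme)

theorem IsCommitment.length_eq {S : CommitmentScheme} {k : ℕ} {b : Bool} {c : List Bool}
    (h : S.IsCommitment k b c) (hk : 1 ≤ k) : c.length = k := by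
  obtain ⟨r, rfl⟩ := h
  simp [S.length_out k hk b r]

/-- Every commitment has exactly one key. -/
theorem IsCommitment.exists_key {S : CommitmentScheme} {k : ℕ} {b : Bool} {c : List Bool}
    (h : S.IsCommitment k b c) (hk : 1 ≤ k) : ∃ s : List Bool, s.length = k - 1 ∧
      openWith S.R c s = some b ∧ ∀ s', s' ≠ s → openWith S.R c s' = none := by
  obtain ⟨r, rfl⟩ := h
  exact ⟨_, by simp [S.length_out k hk b r], S.opens k hk b r, fun s' => S.binding k hk b r s'⟩

/-- If the two keys coincide, the receiver's output decides; if they differ, binding for one key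
contradicts the opening with the other. -/
theorem IsCommitment.unique {S : CommitmentScheme} {k : ℕ} {b b' : Bool} {c : List Bool}
    (h : S.IsCommitment k b c) (h' : S.IsCommitment k b' c) (hk : 1 ≤ k) : b = b' := by
  obtain ⟨s, -, h1, -⟩ := h.exists_key hk
  obtain ⟨s', -, h2, h3⟩ := h'.exists_key hk
  by_cases hs : s = s'
  · subst hs
    exact Option.some.inj (h1.symm.trans h2)
  · rw [h3 s hs] at h1
    cases h1

/-- A commitment is as long as its security parameter, so the key length announced at the beginning
can be read off from the length of the rest. -/
theorem IsFirstAction.commitment {S : CommitmentScheme} {n : ℕ} {b : Bool} {a : List Bool}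
    (h : S.IsFirstAction n b a) : S.IsCommitment (a.drop (Nat.clog 2 n)).length b
      (a.drop (Nat.clog 2 n)) ∧ 1 ≤ (a.drop (Nat.clog 2 n)).length ∧
      (a.drop (Nat.clog 2 n)).length ≤ n ∧
      a = bits (Nat.clog 2 n) ((a.drop (Nat.clog 2 n)).length - 1) ++ a.drop (Nat.clog 2 n) := by
  obtain ⟨κ, hκ, c, hc, rfl⟩ := h
  have h1 : (bits (Nat.clog 2 n) κ ++ c).drop (Nat.clog 2 n) = c :=
    List.drop_left' (length_bits _ _)
  have h2 := hc.length_eq (by omega)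
  rw [h1, h2]
  exact ⟨hc, by omega, by omega, rfl⟩

theorem IsFirstAction.unique {S : CommitmentScheme} {n : ℕ} {b b' : Bool} {a : List Bool}
    (h : S.IsFirstAction n b a) (h' : S.IsFirstAction n b' a) : b = b' :=
  h.commitment.1.unique h'.commitment.1 h.commitment.2.1

open Classical in
/-- The bit to which the first action of player `0` is a commitment. -/
def committedBit (n : ℕ) (a : List Bool) : Bool := decide (S.IsFirstAction n true a)

theorem IsFirstAction.committedBit_eq {S : CommitmentScheme} {n : ℕ} {b : Bool} {a : List Bool}
    (h : S.IsFirstAction n b a) : S.committedBit n a = b := by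
  rcases b with _ | _
  · simpa [committedBit] using fun h' => by simpa using h.unique h'
  · simpa [committedBit] using h

/-- Whether the last action of player `0` opens the commitment. -/
def opensWith (n : ℕ) (a s : List Bool) : Bool :=
  (openWith S.R (a.drop (Nat.clog 2 n)) s).isSome

/-- By binding the last action can only reveal the committed bit or fail. So the two bits kept by
`decode` contain all that matters for the utilities. -/
theorem IsFirstAction.openWith_eq {S : CommitmentScheme} {n : ℕ} {b : Bool} {a : List Bool}
    (h : S.IsFirstAction n b a) (s : List Bool) :
    openWith S.R (a.drop (Nat.clog 2 n)) s = if S.opensWith n a s then some b else none := by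
  obtain ⟨k, -, h1, h2⟩ := h.commitment.1.exists_key h.commitment.2.1
  by_cases hs : s = k
  · subst hs
    simp [opensWith, h1]
  · simp [opensWith, h2 s hs]

/-- The history of the envelope game that corresponds to a history of the commitment game. -/
def decode (n : ℕ) : History → History
  | [] => []
  | [a] => [[S.committedBit n a]]
  | [a, x] => [[S.committedBit n a], x]
  | [a, x, s] => [[S.committedBit n a], x, [S.opensWith n a s]]
  | _ => []

theorem exists_isFirstAction {n : ℕ} (hn : 1 ≤ n) (b : Bool) : ∃ a, S.IsFirstAction n b a :=
  ⟨_, n - 1, by omega, _, ⟨fun _ => false, rfl⟩, rfl⟩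

section Histories

variable {S} {n : ℕ} {a x s : List Bool} {h : History}

theorem mem_one : [a] ∈ (S.game n).H ↔ ∃ b, S.IsFirstAction n b a := Iff.rfl

theorem mem_two : [a, x] ∈ (S.game n).H ↔ [a] ∈ (S.game n).H ∧ x.length = 1 := Iff.rfl

theorem mem_three : [a, x, s] ∈ (S.game n).H ↔
    [a, x] ∈ (S.game n).H ∧ s.length ≤ n + Nat.clog 2 n := and_assoc.symm

theorem length_le_three (hh : h ∈ (S.game n).H) : h.length ≤ 3 := (S.game n).length_le h hh

theorem nonTerminal_iff (hn : 1 ≤ n) :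
    (S.game n).NonTerminal h ↔ h ∈ (S.game n).H ∧ h.length < 3 := by
  constructor
  · rintro ⟨a, ha⟩
    refine ⟨(S.game n).prefix_mem h a ha, ?_⟩
    have := length_le_three ha
    rw [List.length_append, List.length_singleton] at this
    omega
  · rintro ⟨hh, hl⟩
    match h, hh, hl with
    | [], _, _ => exact (S.exists_isFirstAction hn true).imp fun a ha => ⟨true, ha⟩
    | [a], hh, _ => exact ⟨[true], hh, rfl⟩
    | [a, x], hh, _ => exact ⟨[], mem_three.2 ⟨hh, by simp⟩⟩

theorem terminal_iff (hn : 1 ≤ n) :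
    (S.game n).Terminal h ↔ ∃ a x s, h = [a, x, s] ∧ [a, x, s] ∈ (S.game n).H := by
  rw [ExtGame.Terminal, nonTerminal_iff hn]
  constructor
  · rintro ⟨hh, hl⟩
    have := length_le_three hh
    match h, hh, hl, this with
    | [], hh, hl, _ => exact absurd ⟨hh, by simp⟩ hl
    | [_], hh, hl, _ => exact absurd ⟨hh, by simp⟩ hl
    | [_, _], hh, hl, _ => exact absurd ⟨hh, by simp⟩ hl
    | [a, x, s], hh, _, _ => exact ⟨a, x, s, rfl, hh⟩
  · rintro ⟨a, x, s, rfl, hh⟩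
    exact ⟨hh, by simp⟩

theorem cases_of_mem (hh : h ∈ (S.game n).H) :
    h = [] ∨ (∃ a, h = [a]) ∨ (∃ a x, h = [a, x]) ∨ ∃ a x s, h = [a, x, s] := by
  have := length_le_three hh
  match h, this with
  | [], _ => exact Or.inl rfl
  | [a], _ => exact Or.inr (Or.inl ⟨a, rfl⟩)
  | [a, x], _ => exact Or.inr (Or.inr (Or.inl ⟨a, x, rfl⟩))
  | [a, x, s], _ => exact Or.inr (Or.inr (Or.inr ⟨a, x, s, rfl⟩))

end Histories

section Play

variable {S} {n : ℕ} {M : Strategy} {p p' : List Bool × List Bool} {a x : List Bool}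

theorem mem_of_first (hM : IsStrategyFor S.game 0 M) (hn : 1 ≤ n)
    (hp : p ∈ (M.move n [] []).support) : [p.1] ∈ (S.game n).H := by
  obtain ⟨r, rfl⟩ := M.machine.mem_support_law hp
  exact hM n hn [] [] .nil ((nonTerminal_iff hn).2 ⟨(S.game n).nil_mem, by simp⟩) rfl r

theorem mem_of_second (hM : IsStrategyFor S.game 1 M) (hn : 1 ≤ n) (ha : [a] ∈ (S.game n).H)
    (hp : p ∈ (M.move n [a] []).support) : [a, p.1] ∈ (S.game n).H := by
  obtain ⟨r, rfl⟩ := M.machine.mem_support_law hp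
  exact hM n hn [a] [] (.other [] [] a .nil (by simp [game]) ha)
    ((nonTerminal_iff hn).2 ⟨ha, by simp⟩) rfl r

theorem reachable_two (hn : 1 ≤ n) (hp : p ∈ (M.move n [] []).support)
    (hx : [p.1, x] ∈ (S.game n).H) : Reachable (S.game n) n M 0 [p.1, x] p.2 := by
  obtain ⟨r, rfl⟩ := M.machine.mem_support_law hp
  have h : Reachable (S.game n) n M 0 [(M.machine.result (M.input n [] []) r).1]
      (M.machine.result (M.input n [] []) r).2 :=
    .own [] [] r .nil rfl ((nonTerminal_iff hn).2 ⟨(S.game n).nil_mem, by simp⟩)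
  exact .other _ _ x h (by simp [game]) hx

theorem mem_of_third (hM : IsStrategyFor S.game 0 M) (hn : 1 ≤ n)
    (hp : p ∈ (M.move n [] []).support) (hx : [p.1, x] ∈ (S.game n).H)
    (hp' : p' ∈ (M.move n [p.1, x] p.2).support) : [p.1, x, p'.1] ∈ (S.game n).H := by
  obtain ⟨r, rfl⟩ := M.machine.mem_support_law hp'
  exact hM n hn _ _ (reachable_two hn hp hx) ((nonTerminal_iff hn).2 ⟨hx, by simp⟩) rfl r

theorem playStep_eq {c : ℕ} {G : ExtGame c} {M : Fin c → Strategy} {h : History}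
    {r : Fin c → List Bool} (hh : G.NonTerminal h) (i : Fin c) (hi : G.mover h = i) :
    G.playStep n M (h, r) = ((M i).move n (G.info h) (r i)).map fun p =>
      (h ++ [p.1], Function.update r i (r i ++ p.2)) := by
  subst hi
  rw [ExtGame.playStep, if_pos hh]

/-- Player 0 moves twice, and the view at the second move contains the coins `p.2` of the first one.
Player 1 moves once, with nothing remembered. -/
theorem terminalLaw_eq {M : Fin 2 → Strategy} (hM : ∀ i, IsStrategyFor S.game i (M i))
    (hn : 1 ≤ n) : (S.game n).terminalLaw n M = ((M 0).move n [] []).bind fun p =>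
      ((M 1).move n [p.1] []).bind fun p' => ((M 0).move n [p.1, p'.1] p.2).map fun p'' =>
        [p.1, p'.1, p''.1] := by
  have hd : (S.game n).depth = 3 := rfl
  have hN := ((nonTerminal_iff (S := S) hn).2 ⟨(S.game n).nil_mem, by simp⟩)
  rw [ExtGame.terminalLaw, hd]
  simp only [ExtGame.play]
  rw [PMF.pure_bind, playStep_eq hN _ rfl, PMF.bind_map, PMF.bind_bind, PMF.map_bind]
  refine PMF.bind_congr' _ fun p hp => ?_
  have h1 := mem_of_first (hM 0) hn hp
  change ((((S.game n).playStep n M ([p.1], Function.update (fun _ => []) 0 p.2)).bind _).map _) = _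
  rw [playStep_eq ((nonTerminal_iff hn).2 ⟨h1, by simp⟩) _ rfl, PMF.bind_map, PMF.map_bind]
  refine PMF.bind_congr' _ fun p' hp' => ?_
  have h2 := mem_of_second (hM 1) hn h1 hp'
  change ((S.game n).playStep n M ([p.1, p'.1], Function.update (Function.update (fun _ => []) 0 p.2)
    1 p'.2)).map _ = _
  rw [playStep_eq ((nonTerminal_iff hn).2 ⟨h2, by simp⟩) _ rfl, PMF.map_comp]
  rfl

theorem law_decode_eq {M : Fin 2 → Strategy} (hM : ∀ i, IsStrategyFor S.game i (M i))
    (hn : 1 ≤ n) : ((S.game n).terminalLaw n M).map (S.decode n) =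
      ((M 0).move n [] []).bind fun p => ((M 1).move n [p.1] []).bind fun p' =>
        ((M 0).move n [p.1, p'.1] p.2).map fun p'' =>
          [[S.committedBit n p.1], p'.1, [S.opensWith n p.1 p''.1]] := by
  rw [terminalLaw_eq hM hn, PMF.map_bind]
  refine congrArg _ (funext fun p => ?_)
  rw [PMF.map_bind]
  refine congrArg _ (funext fun p' => ?_)
  rw [PMF.map_comp]
  rfl

end Play

end CommitmentScheme

end

section

open scoped ENNReal

/-! ## The machines of the commitment game -/

namespace StackProg

variable {B : Type}

/-- Machines from `exists_ppt` see the recorded coins as an additional first string; dropping it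
leaves a function of the input. -/
theorem exists_det {u : List (List Bool) → List Bool} (hu : PolyTime B fun x => [u x]) :
    ∃ M : PPT, ∀ l ω, M.out l ω = u l := by
  obtain ⟨M, t, hM⟩ := exists_ppt (hu.comp PolyTime.tail) 0
  exact ⟨M, fun l ω => ((hM l).2 ω).2.2⟩

namespace PolyTime

variable {u v : List (List Bool) → List Bool} {n : List (List Bool) → ℕ}

theorem binMod (q : ℕ) (hq : 0 < q) (hu : PolyTime B fun x => [u x]) :
    PolyTime B fun x => [unary (binMod q (u x))] :=
  hu.foldl q hq _ fun _ _ => Nat.mod_lt _ hq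

end PolyTime

end StackProg

open StackProg

/-- The value modulo `q` of the first `n` bits. -/
def index (q n : ℕ) (ω : List Bool) : ℕ := binMod q (ω.take n)

theorem index_lt {q : ℕ} (hq : 0 < q) (n : ℕ) (ω : List Bool) : index q n ω < q := binMod_lt hq _

theorem index_take {q n t : ℕ} (h : n ≤ t) (ω : List Bool) :
    index q n (ω.take t) = index q n ω := by
  rw [index, List.take_take, min_eq_left h, index]

theorem StackProg.PolyTime.index {B : Type} {u : List (List Bool) → List Bool}
    {n : List (List Bool) → ℕ} (q : ℕ) (hq : 0 < q) (hn : PolyTime B fun x => [unary (n x)])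
    (hu : PolyTime B fun x => [u x]) : PolyTime B fun x => [unary (_root_.index q (n x) (u x))] :=
  (hu.take_str hn).binMod q hq

/-- A machine that chooses a number less than `q`, almost uniformly, and plays accordingly. -/
theorem exists_chooser (q : ℕ) (hq : 0 < q) (ξ : ℕ → Bool) : ∃ M : PPT, ∀ n l,
    (∀ p ∈ (M.law (unary n :: l)).support, n ≤ p.2.length ∧ p.1 = [ξ (index q n p.2)]) ∧
    (M.law (unary n :: l)).map Prod.fst = ((coins n).map (binMod q)).map fun j => [ξ j] := by
  have hG : PolyTime Empty fun x => [[ξ (index q (hd (x.drop 1)).length (hd x))]] :=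
    PolyTime.lookup_bool q ξ (PolyTime.index q hq (PolyTime.nth 1).unary_length PolyTime.head)
      fun x => index_lt hq _ _
  -- The input contains `1^n`, so as many coins as the length of the input are at least `n`.
  obtain ⟨M, t, hM⟩ := exists_ppt_law hG Polynomial.X
  refine ⟨M, fun n l => ?_⟩
  obtain ⟨h1, h2, h3⟩ := hM (unary n :: l)
  have ht : n ≤ t (unary n :: l) := by
    rw [Polynomial.eval_X, encode_cons] at h1
    simp [length_unary] at h1
    omega
  simp only [List.drop_succ_cons, List.drop_zero, hd_cons, length_unary] at h2 h3
  refine ⟨fun p hp => ⟨ht.trans (h2 p hp).1, ?_⟩, ?_⟩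
  · rw [(h2 p hp).2, index_take ht]
  · have := congrArg (PMF.map Prod.fst) h3
    rw [PMF.map_comp, PMF.map_comp] at this
    rw [← map_take_coins ht, PMF.map_comp, PMF.map_comp]
    exact this

namespace CommitmentScheme

variable (S : CommitmentScheme)

/-- The output of the sender of the commitment scheme. -/
def sender (n : ℕ) (b : Bool) (ω : List Bool) : List Bool :=
  (S.C.toProbTM.result (encode [unary n, [b]]) ω).1

/-- The number of coins of the sender. -/
def senderTime (n : ℕ) : ℕ := S.C.time.eval (n + 3)

theorem length_encode_sender (n : ℕ) (b : Bool) : (encode [unary n, [b]]).length = n + 3 := by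
  rw [length_encode_pair, length_unary, List.length_singleton]

variable {S}

theorem exists_sender_eq {n : ℕ} (b : Bool) {ω : List Bool} (h : S.senderTime n ≤ ω.length) :
    ∃ r, S.sender n b ω = S.C.out [unary n, [b]] r := by
  have h' : S.C.time.eval (encode [unary n, [b]]).length ≤ ω.length := by
    rwa [length_encode_sender]
  refine ⟨fun i => ω[i]'(i.2.trans_le h'), ?_⟩
  rw [sender, ← S.C.result_take _ _ h', PPT.out, PPT.result]
  congr 2
  refine List.ext_getElem (by simpa using h') fun i h1 h2 => ?_
  simp

theorem isCommitment_sender {n : ℕ} (b : Bool) {ω : List Bool} (h : S.senderTime n ≤ ω.length) :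
    S.IsCommitment n b ((S.sender n b ω).take n) := by
  obtain ⟨r, hr⟩ := exists_sender_eq b h
  exact ⟨r, by rw [hr]⟩

theorem sender_take {n t : ℕ} (b : Bool) {ω : List Bool} (h : S.senderTime n ≤ t)
    (ht : t ≤ ω.length) : S.sender n b (ω.take t) = S.sender n b ω := by
  have h' : S.C.time.eval (encode [unary n, [b]]).length ≤ t := by
    rwa [length_encode_sender]
  rw [sender, sender, ← S.C.result_take _ (ω.take t) (by rw [List.length_take]; omega),
    ← S.C.result_take _ ω (by omega), List.take_take, min_eq_left h']

theorem map_sender_coins {n t : ℕ} (b : Bool) (h : S.senderTime n ≤ t) :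
    (coins t).map (S.sender n b) = (S.C.law [unary n, [b]]).map Prod.fst := by
  rw [S.C.law_eq_of_le (t := t) _ (by rwa [length_encode_sender]), PMF.map_comp]
  rfl

variable (S)

/-- The first action of player `0` when the random bits are `ω` and the `j`-th alternative is to
commit to the bit `β j`. -/
def firstMove (q : ℕ) (β : ℕ → Bool) (n : ℕ) (ω : List Bool) : List Bool :=
  bits (Nat.clog 2 n) (n - 1) ++ (S.sender n (β (index q n ω)) (ω.drop n)).take n

/-- The last action of player `0` when the random bits of the first action were `ω`. -/
def lastMove (q : ℕ) (β : ℕ → Bool) (o : ℕ → Bool → Bool) (n : ℕ) (ω : List Bool) (x : Bool) :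
    List Bool :=
  if o (index q n ω) x then (S.sender n (β (index q n ω)) (ω.drop n)).drop n else unary n

variable {S} {q : ℕ} {β : ℕ → Bool} {o : ℕ → Bool → Bool} {n t : ℕ} {ω : List Bool}

theorem isFirstAction_firstMove (hn : 1 ≤ n) (h : n + S.senderTime n ≤ ω.length) :
    S.IsFirstAction n (β (index q n ω)) (S.firstMove q β n ω) := by
  refine ⟨n - 1, by omega, _, ?_, rfl⟩
  rw [Nat.sub_add_cancel hn]
  exact isCommitment_sender _ (by rw [List.length_drop]; omega)

theorem opensWith_lastMove (hn : 1 ≤ n) (h : n + S.senderTime n ≤ ω.length) (x : Bool) :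
    S.opensWith n (S.firstMove q β n ω) (S.lastMove q β o n ω x) = o (index q n ω) x := by
  obtain ⟨r, hr⟩ := exists_sender_eq (S := S) (n := n) (β (index q n ω)) (ω := ω.drop n)
    (by rw [List.length_drop]; omega)
  rw [opensWith, firstMove, List.drop_left' (length_bits _ _), lastMove, hr]
  cases o (index q n ω) x
  -- The string `unary n` is one bit longer than a key for parameter `n`, so by binding it opens
  -- nothing.
  · rw [if_neg (by simp), S.binding n hn]
    · rfl
    · intro h
      have := congrArg List.length h
      rw [List.length_drop, S.length_out n hn, length_unary] at this
      omega
  · rw [if_pos rfl, S.opens n hn]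
    rfl

theorem length_lastMove (hn : 1 ≤ n) (h : n + S.senderTime n ≤ ω.length) (x : Bool) :
    (S.lastMove q β o n ω x).length ≤ n := by
  obtain ⟨r, hr⟩ := exists_sender_eq (S := S) (n := n) (β (index q n ω)) (ω := ω.drop n)
    (by rw [List.length_drop]; omega)
  rw [lastMove, hr]
  split_ifs
  · rw [List.length_drop, S.length_out n hn]
    omega
  · rw [length_unary]

theorem firstMove_take (h : n + S.senderTime n ≤ t) (ht : t ≤ ω.length) :
    S.firstMove q β n (ω.take t) = S.firstMove q β n ω := by
  rw [firstMove, firstMove, index_take (by omega), List.drop_take,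
    sender_take _ (by omega) (by rw [List.length_drop]; omega)]

variable (S) in
theorem polyTime_sender {B : Type} (e : S.C.toProbTM.Symbols ↪ B) {n : List (List Bool) → ℕ}
    {b : List (List Bool) → Bool} {u : List (List Bool) → List Bool}
    (hn : PolyTime B fun x => [unary (n x)]) (hb : PolyTime B fun x => [[b x]])
    (hu : PolyTime B fun x => [u x]) : PolyTime B fun x => [S.sender (n x) (b x) (u x)] :=
  PolyTime.run_of S.C.toProbTM e hu (hn.pair hb)

variable (S) in
/-- The machine of player `0` that commits to `β j` and opens the commitment iff `o j x` holds,
where `j` is chosen almost uniformly. -/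
theorem exists_committer (q : ℕ) (hq : 0 < q) (β : ℕ → Bool) (o : ℕ → Bool → Bool) :
    ∃ (M : PPT) (t : ℕ → ℕ), ∀ n, n + S.senderTime n ≤ t n ∧
      (∀ p ∈ (M.law [unary n, []]).support, t n ≤ p.2.length ∧ p.1 = S.firstMove q β n p.2) ∧
      (M.law [unary n, []]).map (fun p => p.2.take (t n)) = coins (t n) ∧
      ∀ r a x, ∀ p ∈ (M.law [unary n, r, a, x]).support,
        p.1 = S.lastMove q β o n r (x.headD false) := by
  set B := S.C.toProbTM.Symbols
  have hn : PolyTime B fun x => [unary (hd (x.drop 1)).length] := (PolyTime.nth 1).unary_length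
  have hfirst : PolyTime B fun x => [S.firstMove q β (hd (x.drop 1)).length (hd x)] := by
    have hj := PolyTime.index q hq hn PolyTime.head
    exact (PolyTime.bits hn.clog (hn.tail_str.congr fun x => by rw [tail_unary])).concat
      ((S.polyTime_sender (.refl _) hn (PolyTime.lookup_bool q β hj fun x => index_lt hq _ _)
        (PolyTime.head.drop_str hn)).take_str hn)
  have hlast : PolyTime B fun x => [S.lastMove q β o (hd (x.drop 1)).length (hd (x.drop 2))
      ((hd (x.drop 4)).headD false)] := by
    have hj := PolyTime.index q hq hn (PolyTime.nth 2)
    have hb := PolyTime.lookup_bool q β hj fun x => index_lt hq _ _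
    have ho : PolyTime B fun x => [[o (index q (hd (x.drop 1)).length (hd (x.drop 2)))
        ((hd (x.drop 4)).headD false)]] :=
      ((PolyTime.nth 4).head_or.ite
        (PolyTime.lookup_bool q (fun j => o j true) hj fun x => index_lt hq _ _)
        (PolyTime.lookup_bool q (fun j => o j false) hj fun x => index_lt hq _ _)).congr fun x => by
          cases (hd (x.drop 4)).headD false <;> rfl
    exact ho.ite_str ((S.polyTime_sender (.refl _) hn hb ((PolyTime.nth 2).drop_str hn)).drop_str hn)
      hn
  -- One machine makes both moves and recognizes them by the number of strings: the coins, `1^n` and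
  -- an empty memory at the first move; two more strings at the last one. For the first move, whose
  -- input has length `n + 2`, the polynomial allows `n` coins to choose the index and the running
  -- time of the sender on its input of length `n + 3`.
  obtain ⟨M, t, hM⟩ := exists_ppt_law ((PolyTime.drop 3).isEmpty_list.ite hfirst hlast)
    (Polynomial.X + S.C.time.comp (Polynomial.X + 1))
  refine ⟨M, fun n => t [unary n, []], fun n => ?_⟩
  obtain ⟨h1, h2, h3⟩ := hM [unary n, []]
  simp only [List.drop_succ_cons, List.drop_zero, List.drop_nil, List.isEmpty_nil, if_true, hd_cons,
    length_unary] at h2 h3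
  have ht : n + S.senderTime n ≤ t [unary n, []] := by
    rw [length_encode_pair, length_unary] at h1
    simp only [Polynomial.eval_add, Polynomial.eval_comp, Polynomial.eval_X, Polynomial.eval_one,
      List.length_nil, add_zero, add_assoc] at h1
    rw [senderTime]
    norm_num at h1
    omega
  refine ⟨ht, fun p hp => ⟨(h2 p hp).1, ?_⟩, ?_, fun r a x p hp => ?_⟩
  · rw [(h2 p hp).2, firstMove_take ht (h2 p hp).1]
  · have := congrArg (PMF.map Prod.snd) h3
    rw [PMF.map_comp, PMF.map_comp] at this
    exact this.trans (PMF.map_id _)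
  · have := ((hM [unary n, r, a, x]).2.1 p hp).2
    simpa [length_unary] using this

/-- The bit played by the machine of `exists_chooser` can be recovered. -/
theorem exists_chooser_bit (q : ℕ) (hq : 0 < q) (ξ : ℕ → Bool) :
    ∃ N : PPT, ∀ n r u l ω, N.out (unary n :: r :: u :: l) ω = [ξ (index q n u)] := by
  have hG : PolyTime Empty fun x => [[ξ (index q (hd x).length (hd (x.drop 2)))]] :=
    PolyTime.lookup_bool q ξ (PolyTime.index q hq PolyTime.head.unary_length (PolyTime.nth 2))
      fun x => index_lt hq _ _
  obtain ⟨N, hN⟩ := exists_det hG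
  exact ⟨N, fun n r u l ω => by simp [hN, length_unary]⟩

/-- The action that corresponds to the one of the machine of `exists_committer` can be recovered. -/
theorem exists_committer_bit (q : ℕ) (hq : 0 < q) (β : ℕ → Bool) (o : ℕ → Bool → Bool) :
    ∃ N : PPT, ∀ n r u ω, N.out [unary n, r, u] ω = [β (index q n u)] ∧ ∀ a x ω,
      N.out [unary n, r, u, a, x] ω = [o (index q n r) (x.headD false)] := by
  have hn : PolyTime Empty fun x => [unary (hd x).length] := PolyTime.head.unary_length
  have hb : PolyTime Empty fun x => [[β (index q (hd x).length (hd (x.drop 2)))]] :=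
    PolyTime.lookup_bool q β (PolyTime.index q hq hn (PolyTime.nth 2)) fun x => index_lt hq _ _
  have hj := PolyTime.index q hq hn (PolyTime.nth 1)
  have ho : PolyTime Empty fun x => [[o (index q (hd x).length (hd (x.drop 1)))
      ((hd (x.drop 4)).headD false)]] :=
    ((PolyTime.nth 4).head_or.ite
      (PolyTime.lookup_bool q (fun j => o j true) hj fun x => index_lt hq _ _)
      (PolyTime.lookup_bool q (fun j => o j false) hj fun x => index_lt hq _ _)).congr fun x => by
        cases (hd (x.drop 4)).headD false <;> rfl
  obtain ⟨N, hN⟩ := exists_det ((PolyTime.drop 3).isEmpty_list.ite_str hb ho)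
  exact ⟨N, fun n r u ω => ⟨by simp [hN, length_unary], fun a x ω => by simp [hN, length_unary]⟩⟩

/-! ### Running the machine of another player -/

/-- A machine that applies the machine `M` to transformed inputs and transforms its outputs. -/
theorem exists_transform {B : Type} (M : PPT) (e : M.toProbTM.Symbols ↪ B)
    {f : List (List Bool) → List (List Bool)} (hf : PolyTime B f)
    {g : List (List Bool) → List Bool → List Bool}
    (hg : PolyTime B fun x => [g x.tail (hd x)]) : ∃ T : PPT, ∀ l,
      (T.law l).map Prod.fst = (M.law (f l)).map fun p => g l p.1 := by
  obtain ⟨V, hV⟩ := hf.length_le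
  have hrun : PolyTime B fun x =>
      (M.toProbTM.result (encode (f x.tail)) (hd x)).1 :: x.tail :=
    (PolyTime.run_of M.toProbTM e PolyTime.head (hf.comp PolyTime.tail)).append PolyTime.tail
  obtain ⟨T, t, hT⟩ := exists_ppt_law (hg.comp hrun) (M.time.comp V)
  refine ⟨T, fun l => ?_⟩
  obtain ⟨h1, -, h3⟩ := hT l
  have ht : M.time.eval (encode (f l)).length ≤ t l :=
    (eval_mono _ (hV l)).trans (by rwa [← Polynomial.eval_comp])
  have := congrArg (PMF.map Prod.fst) h3
  rw [PMF.map_comp, PMF.map_comp] at this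
  rw [M.law_eq_of_le _ ht, PMF.map_comp]
  exact this

/-- `openWith` uses a tape of zeros, simulation a tape of ones; they agree as the receiver is
deterministic. -/
theorem openWith_eq_some {c s : List Bool} {b : Bool} :
    openWith S.R c s = some b ↔ S.R.outOnes [c, s] = [b] := by
  rw [openWith, PPT.outOnes, S.R_deterministic c s (fun _ => true) fun _ => false]
  split
  · rename_i b' h
    rw [h]
    simp
  · rename_i h
    simp only [reduceCtorEq, false_iff]
    exact h b

/-- A machine that runs `M` on the last information set of player `0`, to find out whether the
commitment would be opened to the bit `1`. -/
theorem exists_predictor (S : CommitmentScheme) (M : PPT) : ∃ T : PPT, ∀ n a,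
    (T.law [unary n, a]).map Prod.fst = (M.law [unary n, a, [false]]).map fun p =>
      [decide (openWith S.R (a.drop (Nat.clog 2 n)) p.1 = some true)] := by
  set B := M.toProbTM.Symbols ⊕ S.R.toProbTM.Symbols
  have hf : PolyTime B fun x => x ++ [[false]] := PolyTime.id.append (PolyTime.const _)
  have hg : PolyTime B fun x => [[decide (openWith S.R
      ((hd (x.tail.drop 1)).drop (Nat.clog 2 (hd x.tail).length)) (hd x) = some true)]] := by
    have hc : PolyTime B fun x => [(hd (x.tail.drop 1)).drop (Nat.clog 2 (hd x.tail).length)] :=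
      ((PolyTime.nth 1).comp PolyTime.tail).drop_str
        (PolyTime.head.comp PolyTime.tail).unary_length.clog
    exact ((PolyTime.run_ppt S.R .inr (hc.pair PolyTime.head)).eq_str
      (PolyTime.const [[true]])).congr fun x => by rw [Bool.decide_congr openWith_eq_some]
  obtain ⟨T, hT⟩ := exists_transform M .inl hf (g := fun l s => [decide (openWith S.R
    ((hd (l.drop 1)).drop (Nat.clog 2 (hd l).length)) s = some true)]) hg
  refine ⟨T, fun n a => ?_⟩
  rw [hT]
  simp [length_unary]

/-- A machine that runs the strategy `M` of player `1` on a commitment with a key of length `n`. -/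
theorem exists_distinguisher (M : Strategy) : ∃ T : PPT, ∀ n c,
    (T.law [unary n, c]).map Prod.fst =
      (M.move n [bits (Nat.clog 2 n) (n - 1) ++ c] []).map Prod.fst := by
  set B := M.machine.toProbTM.Symbols
  have hn : PolyTime B fun x => [unary (hd x).length] := PolyTime.head.unary_length
  have ha : PolyTime B fun x => [bits (Nat.clog 2 (hd x).length) ((hd x).length - 1) ++
      hd (x.drop 1)] :=
    (PolyTime.bits hn.clog (hn.tail_str.congr fun x => by rw [tail_unary])).concat (PolyTime.nth 1)
  have hf : PolyTime B fun x => M.input (hd x).length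
      [bits (Nat.clog 2 (hd x).length) ((hd x).length - 1) ++ hd (x.drop 1)] [] := by
    rcases h : M.stateful
    · exact (hn.append ha).congr fun x => by simp [Strategy.input, h]
    · exact (hn.append ((PolyTime.const [[]]).append ha)).congr fun x => by
        simp [Strategy.input, h]
  obtain ⟨T, hT⟩ := exists_transform M.machine (.refl _) hf (g := fun _ s => s) PolyTime.head
  refine ⟨T, fun n c => ?_⟩
  rw [hT]
  simp [length_unary, Strategy.move]

end CommitmentScheme

end

section

open StackProg

/-! ## The commitment games form a computable uniform sequence -/

/-! ### Binary expansions; locating the commitment inside a first action -/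

theorem binVal_append_singleton (l : List Bool) (b : Bool) :
    binVal (l ++ [b]) = 2 * binVal l + b.toNat := by
  simp [binVal, List.foldl_append]

theorem binVal_le_append (l l' : List Bool) : binVal l ≤ binVal (l ++ l') := by
  induction l' using List.reverseRecOn with
  | nil => simp
  | append_singleton l' b ih =>
    rw [← List.append_assoc, binVal_append_singleton]
    omega

theorem bits_succ (w v : ℕ) : bits (w + 1) v = bits w (v / 2) ++ [decide (v % 2 = 1)] := by
  induction w with
  | zero => simp [bits, Nat.testBit_eq_decide_div_mod_eq]
  | succ w ih =>
    have h : ∀ w v, bits (w + 1) v = v.testBit w :: bits w v := fun w v => by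
      simp [bits, List.range_succ]
    rw [h, ih, h w (v / 2), Nat.testBit_succ, List.cons_append]

theorem binVal_bits (w v : ℕ) (h : v < 2 ^ w) : binVal (bits w v) = v := by
  induction w generalizing v with
  | zero =>
    rw [pow_zero] at h
    have : v = 0 := by omega
    subst this
    rfl
  | succ w ih =>
    rw [pow_succ] at h
    rw [bits_succ, binVal_append_singleton, ih _ (by omega)]
    rcases Nat.mod_two_eq_zero_or_one v with h1 | h1 <;> simp [h1] <;> omega

theorem exists_keyPart (a : List Bool) : ∃ j, (a.drop j).length ≤ binVal (a.take j) + 1 :=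
  ⟨a.length, by simp⟩

theorem StackProg.PolyTime.or {B : Type} {p q : List (List Bool) → Bool}
    (hp : PolyTime B fun x => [[p x]]) (hq : PolyTime B fun x => [[q x]]) :
    PolyTime B fun x => [[p x || q x]] :=
  (hp.ite (PolyTime.const [[true]]) hq).congr fun x => by cases p x <;> rfl

/-- The length of the representation of the key length at the beginning of a first action. -/
def weightLength (a : List Bool) : ℕ := Nat.find (exists_keyPart a)

/-- The value of the digits read so far is kept in unary. Before each round it is less than the
length of `u x`, and a round at most doubles it and adds one, so it stays of linear size. -/
theorem StackProg.PolyTime.drop_weightLength {B : Type} {u : List (List Bool) → List Bool}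
    (hu : PolyTime B fun x => [u x]) : PolyTime B fun x => [(u x).drop (weightLength (u x))] := by
  have hf : PolyTime B fun y : List (List Bool) => [(hd y).tail,
      hd (y.drop 1) ++ (hd (y.drop 1) ++ unary ((hd y).headD false).toNat)] :=
    PolyTime.head.tail_str.pair ((PolyTime.nth 1).concat ((PolyTime.nth 1).concat
      ((PolyTime.head.head_or.ite_str (PolyTime.const [unary 1]) (PolyTime.const [[]])).congr
        fun x => by cases (hd x).headD false <;> rfl)))
  have hp : PolyTime B fun y : List (List Bool) =>
      [[!decide ((hd y).length ≤ (hd (y.drop 1)).length + 1)]] :=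
    (PolyTime.head.unary_length.le ((PolyTime.nth 1).unary_length.unary_add
      (PolyTime.const [unary 1]))).not
  have hle : ∀ x, weightLength (u x) ≤ (u x).length := fun x => Nat.find_min' _ (by simp)
  have hmin : ∀ x, ∀ j < weightLength (u x),
      binVal ((u x).take j) + 1 < ((u x).drop j).length := fun x j hj =>
    not_le.1 (Nat.find_min (exists_keyPart (u x)) hj)
  have hval : ∀ x, ∀ j < weightLength (u x), binVal ((u x).take (j + 1)) =
      binVal ((u x).take j) + (binVal ((u x).take j) +
        (((u x).drop j).headD false).toNat) := fun x j hj => by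
    have hj' : j < (u x).length := hj.trans_le (hle x)
    rw [List.take_add_one, List.getElem?_eq_getElem hj', Option.toList_some,
      binVal_append_singleton, List.drop_eq_getElem_cons hj', List.headD_cons]
    omega
  refine (PolyTime.while_loop hf hp hu.unary_length (m := fun x => weightLength (u x))
    (fun j x => [(u x).drop j, unary (binVal ((u x).take j))])
    ((hu.pair (PolyTime.const [[]])).congr fun x => rfl) hle
    (fun x j hj => ?_) (fun x => ?_)
    (hu.pair ((hu.concat hu).concat (PolyTime.const [[true]]))) fun x j hj => ?_).hd'
  · have h1 := hmin x j hj
    simp only [hd_cons, List.drop_succ_cons, List.drop_zero, length_unary, List.tail_drop, hval x j hj]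
    refine ⟨by rw [List.length_drop] at h1; simp; omega, ?_⟩
    rw [← unary_append, ← unary_append]
  · have := Nat.find_spec (exists_keyPart (u x))
    simpa [length_unary, weightLength] using this
  · rw [length_encode_pair, length_encode_pair, length_unary]
    simp only [List.length_append, List.length_singleton, List.length_drop]
    have h1 : binVal ((u x).take j) ≤ (u x).length + (u x).length + 1 := by
      rcases j with _ | j
      · simp [binVal]
      · rw [hval x j hj]
        have := hmin x j hj
        rw [List.length_drop] at this
        have := Bool.toNat_le (((u x).drop j).headD false)
        omega
    omega

namespace CommitmentScheme

variable {S : CommitmentScheme} {n : ℕ} {b : Bool} {a x s : List Bool}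

/-- If the announced key length is `κ`, exactly `κ + 1` bits follow the announcement. After fewer
digits the rest is longer than `κ + 1`, while the value read so far is at most `κ`; hence the first
balance occurs at the right place. -/
theorem IsFirstAction.drop_weightLength (h : S.IsFirstAction n b a) :
    a.drop (weightLength a) = a.drop (Nat.clog 2 n) := by
  congr 1
  obtain ⟨κ, hκ, c, hc, rfl⟩ := h
  have hc := hc.length_eq (by omega)
  have hb : binVal (bits (Nat.clog 2 n) κ) = κ :=
    binVal_bits _ _ (hκ.trans_le (Nat.le_pow_clog (by norm_num) n))
  refine (Nat.find_eq_iff _).2 ⟨?_, fun j hj => ?_⟩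
  · rw [List.drop_left' (length_bits _ _), List.take_left' (length_bits _ _), hb, hc]
  · rw [not_le, List.length_drop, List.length_append, length_bits, hc,
      List.take_append_of_le_length (by rw [length_bits]; exact hj.le)]
    have := binVal_le_append ((bits (Nat.clog 2 n) κ).take j) ((bits (Nat.clog 2 n) κ).drop j)
    rw [List.take_append_drop, hb] at this
    omega

/-- For bits, to be different from `x` is to be its negation, so a single run of the receiver
determines the winner. -/
theorem firstWins_iff (hh : [a, x, s] ∈ (S.game n).H) : S.FirstWins n [a, x, s] ↔
    S.R.outOnes [a.drop (weightLength a), s] = [!x.headD false] := by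
  obtain ⟨⟨b, hb⟩, hx, -⟩ := hh
  obtain ⟨y, rfl⟩ := List.length_eq_one_iff.1 hx
  rw [hb.drop_weightLength, ← openWith_eq_some]
  constructor
  · rintro ⟨a', s', b', x', he, ho, hne⟩
    simp only [List.cons.injEq, and_true] at he
    obtain ⟨rfl, rfl, rfl⟩ := he
    rw [ho]
    cases b' <;> cases y <;> simp_all
  · intro h
    exact ⟨a, s, _, y, rfl, h, by cases y <;> simp⟩

theorem length_action_le {h : History} (hh : h ++ [a] ∈ (S.game n).H) : a.length ≤ 2 * n + 1 := by
  have hw : Nat.clog 2 n ≤ n := Nat.clog_le_of_le_pow Nat.lt_two_pow_self.le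
  have h1 : ∀ {a}, (∃ b, S.IsFirstAction n b a) → a.length ≤ 2 * n + 1 := by
    rintro a ⟨b, hb⟩
    have := hb.commitment.2.2.1
    rw [List.length_drop] at this
    omega
  match h, hh with
  | [], hh => exact h1 hh
  | [_], hh => exact hh.2.le.trans (by omega)
  | [_, _], hh => exact hh.2.2.trans (by omega)
  | _ :: _ :: _ :: t, hh => cases t <;> exact hh.elim

/-- The length of the part after the first `Nat.clog 2 n` bits dictates the only possible key length
and security parameter, so no search is needed. -/
theorem exists_isFirstAction_iff {V : PPT} (hV : ∀ k, 1 ≤ k → ∀ c r,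
    V.out [unary k, c] r = [true] ↔ ∃ b, S.IsCommitment k b c) : (∃ b, S.IsFirstAction n b a) ↔
      (!(a.drop (Nat.clog 2 n)).isEmpty && (decide ((a.drop (Nat.clog 2 n)).length ≤ n) &&
        (decide (bits (Nat.clog 2 n) ((a.drop (Nat.clog 2 n)).length - 1) =
          a.take (Nat.clog 2 n)) &&
        decide (V.outOnes [unary (a.drop (Nat.clog 2 n)).length, a.drop (Nat.clog 2 n)] =
          [true])))) = true := by
  simp only [Bool.and_eq_true, decide_eq_true_eq]
  constructor
  · rintro ⟨b, hb⟩
    obtain ⟨h1, h2, h3, h4⟩ := hb.commitment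
    refine ⟨?_, h3, ?_, (hV _ h2 _ _).2 ⟨b, h1⟩⟩
    · rcases h : a.drop (Nat.clog 2 n)
      · rw [h] at h2
        simp at h2
      · rfl
    · have := congrArg (List.take (Nat.clog 2 n)) h4
      rw [List.take_left' (length_bits _ _)] at this
      exact this.symm
  · rintro ⟨h1, h2, h3, h4⟩
    have h5 : 1 ≤ (a.drop (Nat.clog 2 n)).length := by
      rw [Nat.one_le_iff_ne_zero, Ne, List.length_eq_zero_iff]
      intro h
      simp [h] at h1
    obtain ⟨b, hb⟩ := (hV _ h5 _ _).1 h4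
    refine ⟨b, (a.drop (Nat.clog 2 n)).length - 1, by omega, a.drop (Nat.clog 2 n), ?_, ?_⟩
    · rwa [Nat.sub_add_cancel h5]
    · rw [h3, List.take_append_drop]

theorem isComputableUniform (hS : S.Recognizable) : IsComputableUniform S.game := by
  obtain ⟨V, hV⟩ := hS
  refine ⟨⟨2 * Polynomial.X + 1, fun n _ h a hh => ?_⟩, ?_, ?_, fun i => ?_⟩
  · simpa using length_action_le hh
  · set B := V.toProbTM.Symbols
    have hn : PolyTime B fun x => [unary (hd x).length] := PolyTime.head.unary_length
    have ha : PolyTime B fun x => [hd (x.drop 1)] := PolyTime.nth 1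
    have hc := ha.drop_str hn.clog
    have hfirst := hc.isEmpty.not.and ((hc.unary_length.le hn).and
      (((PolyTime.bits hn.clog (hc.unary_length.tail_str.congr fun x => by
        rw [tail_unary])).eq_str (ha.take_str hn.clog)).and
      ((PolyTime.run_ppt V (.refl _) (hc.unary_length.pair hc)).eq_str (PolyTime.const [[true]]))))
    have h3 := ((PolyTime.nth 3).unary_length.le (hn.unary_add hn.clog)).and
      (PolyTime.drop 4).isEmpty_list
    have h2 := ((PolyTime.nth 2).unary_length.eq_nat (PolyTime.const [unary 1])).and
      ((PolyTime.drop 3).isEmpty_list.or h3)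
    obtain ⟨N, hN⟩ := exists_det ((PolyTime.drop 1).isEmpty_list.or
      (hfirst.and ((PolyTime.drop 2).isEmpty_list.or h2)))
    refine ⟨N, fun n hn h ω => ?_⟩
    rw [hN]
    match h with
    | [] => simpa using (S.game n).nil_mem
    | [a] =>
      rw [mem_one, exists_isFirstAction_iff hV]
      simp only [List.cons.injEq, and_true, List.drop_succ_cons, List.drop_zero, List.drop_nil, hd_cons,
        List.isEmpty_nil, List.isEmpty_cons, Bool.false_or, Bool.true_or, Bool.and_true, length_unary]
    | [a, x] =>
      rw [mem_two, mem_one, exists_isFirstAction_iff hV]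
      simp only [List.cons.injEq, and_true, List.drop_succ_cons, List.drop_zero, List.drop_nil, hd_cons,
        List.isEmpty_nil, List.isEmpty_cons, Bool.false_or, Bool.true_or, Bool.and_true, length_unary,
        Bool.and_eq_true, decide_eq_true_eq, and_assoc]
    | [a, x, s] =>
      rw [mem_three, mem_two, mem_one, exists_isFirstAction_iff hV]
      simp only [List.cons.injEq, and_true, List.drop_succ_cons, List.drop_zero, List.drop_nil, hd_cons,
        List.isEmpty_nil, List.isEmpty_cons, Bool.false_or, Bool.and_true, length_unary,
        Bool.and_eq_true, decide_eq_true_eq, and_assoc]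
    | _ :: _ :: _ :: _ :: t =>
      refine iff_of_false (fun h => ?_) fun h => h.elim
      simp at h
  · obtain ⟨P, hP⟩ := exists_det (B := Empty)
      (PolyTime.id.isEmpty_list.not.and PolyTime.tail.isEmpty_list)
    refine ⟨P, fun n hn h hh ω => ?_⟩
    rw [hP]
    rcases cases_of_mem ((nonTerminal_iff hn).1 hh).1 with
      rfl | ⟨a, rfl⟩ | ⟨a, x, rfl⟩ | ⟨a, x, s, rfl⟩ <;> simp [binVal, game]
  · have hw : PolyTime S.R.toProbTM.Symbols fun x =>
        [[decide (S.R.outOnes [(hd x).drop (weightLength (hd x)), hd (x.drop 2)] =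
          [!(hd (x.drop 1)).headD false])]] :=
      (PolyTime.run_ppt S.R (.refl _)
        (PolyTime.head.drop_weightLength.pair (PolyTime.nth 2))).eq_str (PolyTime.nth 1).head_or.not
    -- The numerator is a sign bit followed by the digit `1`. The sign is minus if the victory of
    -- player 0 and the assertion `i = 1` are both true or both false.
    obtain ⟨A, hA⟩ := exists_det ((hw.beq (PolyTime.const [[decide (i = 1)]])).concat
      (PolyTime.const [[true]]))
    obtain ⟨D, hD⟩ := exists_det (B := Empty) (PolyTime.const [[true]])
    refine ⟨A, D, fun n hn h hh ω ω' => ?_⟩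
    obtain ⟨a, x, s, rfl, hm⟩ := (terminal_iff hn).1 hh
    rw [hA, hD]
    refine ⟨by simp [binVal], ?_⟩
    have h1 := firstWins_iff hm
    simp only [hd_cons, List.drop_succ_cons, List.drop_zero] at h1 ⊢
    by_cases h : S.FirstWins n [a, x, s]
    · rw [h1] at h
      fin_cases i <;> simp [game, h1, -List.headD_eq_head?_getD, h, intVal, binVal]
    · rw [h1] at h
      fin_cases i <;> simp [game, h1, -List.headD_eq_head?_getD, h, intVal, binVal]

end CommitmentScheme

end

section

open scoped ENNReal

/-! ## The envelope game -/

theorem eq_singleton_headD {l : List Bool} (h : l.length = 1) : l = [l.headD false] := by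
  obtain ⟨b, rfl⟩ := List.length_eq_one_iff.1 h
  rfl

namespace Envelope

variable {h : History}

theorem nonTerminal_iff : envelopeGame.NonTerminal h ↔ h ∈ envelopeGame.H ∧ h.length < 3 := by
  constructor
  · rintro ⟨a, ha⟩
    refine ⟨envelopeGame.prefix_mem h a ha, ?_⟩
    have := ha.1
    rw [List.length_append, List.length_singleton] at this
    omega
  · rintro ⟨hh, hl⟩
    refine ⟨[true], by simpa using hl, fun a ha => ?_⟩
    rcases List.mem_append.1 ha with ha | ha
    · exact hh.2 a ha
    · rw [List.mem_singleton.1 ha]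
      rfl

theorem append_mem {a : List Bool} (hh : envelopeGame.NonTerminal h) (ha : a.length = 1) :
    h ++ [a] ∈ envelopeGame.H := by
  obtain ⟨hh, hl⟩ := nonTerminal_iff.1 hh
  refine ⟨by simpa using hl, fun b hb => ?_⟩
  rcases List.mem_append.1 hb with hb | hb
  · exact hh.2 b hb
  · rwa [List.mem_singleton.1 hb]

theorem nil_nonTerminal : envelopeGame.NonTerminal [] :=
  nonTerminal_iff.2 ⟨envelopeGame.nil_mem, by simp⟩

theorem one_nonTerminal (b : Bool) : envelopeGame.NonTerminal [[b]] :=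
  nonTerminal_iff.2 ⟨⟨by simp, by simp⟩, by simp⟩

theorem two_nonTerminal (b x : Bool) : envelopeGame.NonTerminal [[b], [x]] :=
  nonTerminal_iff.2 ⟨⟨by simp, by simp⟩, by simp⟩

/-- The bit that player `0` puts in the envelope. -/
def committed (s : envelopeGame.DetStrategy 0) : Bool :=
  (s ⟨[], [], nil_nonTerminal, rfl, rfl⟩).1.headD false

/-- Whether player `0` opens the envelope. -/
def opened (s : envelopeGame.DetStrategy 0) (b x : Bool) : Bool :=
  (s ⟨[[b], [x]], [[b], [x]], two_nonTerminal b x, rfl, rfl⟩).1.headD false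

/-- The bit that player `1` chooses. -/
def chosen (s : envelopeGame.DetStrategy 1) : Bool :=
  (s ⟨[], [[false]], one_nonTerminal false, rfl, rfl⟩).1.headD false

/-- The strategy of player `0` that puts `b` in the envelope and opens it according to `o`. -/
def committer (b : Bool) (o : Bool → Bool → Bool) : envelopeGame.DetStrategy 0 := fun v =>
  ⟨match v.1 with
    | [b, x] => [o (b.headD false) (x.headD false)]
    | _ => [b], fun h hh _ _ => append_mem hh (by split <;> rfl)⟩

/-- The strategy of player `1` that chooses `x`. -/
def chooser (x : Bool) : envelopeGame.DetStrategy 1 := fun _ =>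
  ⟨[x], fun _ hh _ _ => append_mem hh rfl⟩

@[simp] theorem committed_committer (b : Bool) (o : Bool → Bool → Bool) :
    committed (committer b o) = b := rfl

@[simp] theorem opened_committer (b : Bool) (o : Bool → Bool → Bool) :
    opened (committer b o) = o := rfl

@[simp] theorem chosen_chooser (x : Bool) : chosen (chooser x) = x := rfl

theorem action_length {i : Fin 2} (s : envelopeGame.DetStrategy i) (v : envelopeGame.InfoSet i) :
    (s v).1.length = 1 := by
  obtain ⟨h, h1, h2, h3⟩ := v.2
  exact ((s v).2 h h1 h2 h3).2 _ (by simp)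

/-- A pure strategy of player 0 is determined by five bits: one at the root and one at each of the
four last information sets. The resulting finiteness is what sampling from a mixed strategy
requires. -/
theorem committed_opened_injective :
    Function.Injective fun s : envelopeGame.DetStrategy 0 => (committed s, opened s) := by
  intro s s' h
  obtain ⟨h1, h2⟩ := Prod.ext_iff.1 h
  funext v
  apply Subtype.ext
  rw [eq_singleton_headD (action_length s v), eq_singleton_headD (action_length s' v)]
  congr 1
  obtain ⟨v, h, hh, hm, hv⟩ := v
  obtain ⟨hh, hl⟩ := nonTerminal_iff.1 hh
  match h, hl, hm, hh, hv with
  | [], _, _, _, hv =>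
    obtain rfl : v = [] := hv.symm
    exact h1
  | [_], _, hm, _, _ => exact absurd hm (by simp [envelopeGame])
  | [b, x], _, _, hh, hv =>
    obtain rfl : v = [b, x] := hv.symm
    have hb := eq_singleton_headD (hh.2 b (by simp))
    have hx := eq_singleton_headD (hh.2 x (by simp))
    generalize b.headD false = b' at hb
    generalize x.headD false = x' at hx
    subst hb hx
    exact congrFun (congrFun h2 b') x'

theorem chosen_injective : Function.Injective chosen := by
  intro s s' h1
  funext v
  apply Subtype.ext
  rw [eq_singleton_headD (action_length s v), eq_singleton_headD (action_length s' v)]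
  congr 1
  obtain ⟨v, h, hh, hm, hv⟩ := v
  obtain ⟨hh, hl⟩ := nonTerminal_iff.1 hh
  match h, hl, hm, hh, hv with
  | [], _, hm, _, _ => exact absurd hm (by simp [envelopeGame])
  | [_], _, _, _, hv =>
    obtain rfl : v = [] := hv.symm
    exact h1
  | [_, _], _, hm, _, _ => exact absurd hm (by simp [envelopeGame])

instance : Finite (envelopeGame.DetStrategy 0) := Finite.of_injective _ committed_opened_injective

instance : Finite (envelopeGame.DetStrategy 1) := Finite.of_injective _ chosen_injective

theorem playDet_succ {c : ℕ} {G : ExtGame c} {s : ∀ i, G.DetStrategy i} {k : ℕ} {h : History}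
    (hk : G.playDet s k = h) (hh : G.NonTerminal h) :
    G.playDet s (k + 1) = h ++ [(s (G.mover h) ⟨G.info h, h, hh, rfl, rfl⟩).1] := by
  subst hk
  exact dif_pos hh

theorem playDet_eq (s : ∀ i, envelopeGame.DetStrategy i) : envelopeGame.playDet s 3 =
    [[committed (s 0)], [chosen (s 1)], [opened (s 0) (committed (s 0)) (chosen (s 1))]] := by
  have h1 : envelopeGame.playDet s 1 = [[committed (s 0)]] :=
    (playDet_succ rfl nil_nonTerminal).trans
      (congrArg (fun a => [a]) (eq_singleton_headD (action_length _ _)))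
  have h2 : envelopeGame.playDet s 2 = [[committed (s 0)], [chosen (s 1)]] :=
    (playDet_succ h1 (one_nonTerminal _)).trans
      (congrArg (fun a => [_, a]) (eq_singleton_headD (action_length _ _)))
  exact (playDet_succ h2 (two_nonTerminal _ _)).trans
    (congrArg (fun a => [_, _, a]) (eq_singleton_headD (action_length _ _)))

/-- The terminal history of the envelope game. -/
def outcome (s : envelopeGame.DetStrategy 0) (x : Bool) : History :=
  [[committed s], [x], [opened s (committed s) x]]

/-- The distribution on terminal histories. -/
def law (σ : envelopeGame.MixedStrategy 0) (σ' : envelopeGame.MixedStrategy 1) : PMF History :=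
  σ.bind fun s => σ'.map fun s' => outcome s (chosen s')

theorem mixedWeight_eq (σ : ∀ i, envelopeGame.MixedStrategy i) (h : History) :
    envelopeGame.mixedWeight σ h = (law (σ 0) (σ 1) h).toReal := by
  classical
  have e : law (σ 0) (σ 1) h = ∑' p : envelopeGame.DetStrategy 0 × envelopeGame.DetStrategy 1,
      σ 0 p.1 * (σ 1 p.2 * if outcome p.1 (chosen p.2) = h then 1 else 0) := by
    rw [PMF.apply_eq_mean, law, PMF.mean_bind, ENNReal.tsum_prod']
    simp only [PMF.mean_map]
    simp only [PMF.mean, ← ENNReal.tsum_mul_left, Function.comp_apply]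
  rw [e, ENNReal.tsum_toReal_eq fun p => ENNReal.mul_ne_top ((σ 0).apply_ne_top _)
    (ENNReal.mul_ne_top ((σ 1).apply_ne_top _) (by split_ifs <;> simp)), ExtGame.mixedWeight,
    ← (piFinTwoEquiv _).tsum_eq]
  refine tsum_congr fun s => ?_
  have hd : envelopeGame.depth = 3 := rfl
  rw [hd, playDet_eq, Fin.prod_univ_two, ENNReal.toReal_mul, ENNReal.toReal_mul, mul_assoc]
  simp only [piFinTwoEquiv_apply, outcome]
  congr 2
  split_ifs <;> rfl

open Classical in
/-- The indicator function of the event that player `0` wins. -/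
def win (h : History) : ℝ≥0∞ := if ∃ b x : Bool, h = [[b], [x], [true]] ∧ b ≠ x then 1 else 0

theorem win_le_one (h : History) : win h ≤ 1 := by
  rw [win]
  split_ifs <;> simp

theorem win_apply (b x o : Bool) : win [[b], [x], [o]] = if o = true ∧ b ≠ x then 1 else 0 := by
  rw [win]
  congr 1
  simp only [List.cons.injEq, and_true, eq_iff_iff]
  constructor
  · rintro ⟨b', x', ⟨rfl, rfl, rfl⟩, hne⟩
    exact ⟨rfl, hne⟩
  · rintro ⟨rfl, hne⟩
    exact ⟨b, x, ⟨rfl, rfl, rfl⟩, hne⟩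

theorem utility_zero (h : History) : envelopeGame.u 0 h = 2 * (win h).toReal - 1 := by
  simp only [envelopeGame, win]
  split_ifs <;> norm_num

theorem utility_one (h : History) : envelopeGame.u 1 h = 1 - 2 * (win h).toReal := by
  simp only [envelopeGame, win, one_ne_zero, if_false]
  split_ifs <;> norm_num

/-- The strategy of player `0` that puts a random bit in the envelope and opens it. -/
def uniformCommitter : envelopeGame.MixedStrategy 0 :=
  (PMF.uniformOfFintype Bool).map fun b => committer b fun _ _ => true

/-- The strategy of player `1` that chooses a random bit. -/
def uniformChooser : envelopeGame.MixedStrategy 1 := (PMF.uniformOfFintype Bool).map chooser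

theorem rationalWeights_map_uniform {α : Type} (f : Bool → α) (hf : Function.Injective f) :
    RationalWeights ((PMF.uniformOfFintype Bool).map f) := by
  classical
  intro s
  rw [PMF.apply_eq_mean, PMF.mean_map, PMF.mean_uniform]
  by_cases h : ∃ b, f b = s
  · obtain ⟨b, rfl⟩ := h
    refine ⟨2⁻¹, ?_⟩
    simp [hf.eq_iff]
  · push Not at h
    exact ⟨0, by simp [h]⟩

theorem rationalWeights_uniformCommitter : RationalWeights uniformCommitter :=
  rationalWeights_map_uniform _ fun b b' h => by
    simpa using congrArg committed h

theorem rationalWeights_uniformChooser : RationalWeights uniformChooser :=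
  rationalWeights_map_uniform _ fun b b' h => by
    simpa using congrArg chosen h

/-- The bit is independent of the opponent's choice and the envelope is always opened, so exactly
one of the two values wins. -/
theorem win_uniformCommitter (σ : envelopeGame.MixedStrategy 1) :
    (law uniformCommitter σ).mean win = 2⁻¹ := by
  simp only [law, ← PMF.bind_pure_comp]
  rw [PMF.bind_comm, PMF.mean_bind, ← PMF.mean_const σ 2⁻¹]
  refine PMF.mean_congr _ fun s _ => ?_
  rw [uniformCommitter, PMF.bind_map, PMF.mean_bind, PMF.mean_uniform]
  simp only [Function.comp_apply, PMF.mean_pure, outcome, win_apply, committed_committer,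
    opened_committer, Fintype.card_bool, Fintype.sum_bool]
  cases chosen s <;> simp

/-- For a fixed pure strategy of player 0 at most one of the two answers loses for player 1; it is
an inequality since player 0 may destroy the envelope. -/
theorem win_uniformChooser (σ : envelopeGame.MixedStrategy 0) :
    (law σ uniformChooser).mean win ≤ 2⁻¹ := by
  rw [law, PMF.mean_bind, ← PMF.mean_const σ 2⁻¹]
  refine PMF.mean_mono _ fun s _ => ?_
  rw [uniformChooser, PMF.map_comp, PMF.mean_map, PMF.mean_uniform]
  simp only [Function.comp_apply, outcome, win_apply, chosen_chooser, Fintype.card_bool,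
    Fintype.sum_bool]
  cases committed s <;> cases opened s _ true <;> cases opened s _ false <;> simp

end Envelope

end

section

open scoped ENNReal

/-! ## The strategies that represent mixed strategies of the envelope game -/

namespace CommitmentScheme

variable {S : CommitmentScheme}

section Reachable

variable {n : ℕ} {M : Strategy} {h : History} {r : List Bool}

/-- What player `0` has done at a history at which the random bits `r` have been used. -/
def FirstUsed (n : ℕ) (M : Strategy) : History → List Bool → Prop
  | [], r => r = []
  | [a], r => (a, r) ∈ (M.move n [] []).support
  | [a, _], r => (a, r) ∈ (M.move n [] []).support
  | _, _ => True

/-- The invariant ties the remembered coins to the first action. Thus what is known about the law of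
the first move applies to every view that can be reached at the last move. -/
theorem reachable_zero (hR : Reachable (S.game n) n M 0 h r) : FirstUsed n M h r := by
  induction hR with
  | nil => rfl
  | other h r a hR hm ha ih =>
    have hl : h.length = 1 := by
      by_contra hl
      exact hm (if_neg hl)
    obtain ⟨b, rfl⟩ := List.length_eq_one_iff.1 hl
    exact ih
  | own h r ω hR hm hN ih =>
    match h, ih with
    | [], ih =>
      obtain rfl : r = [] := ih
      exact M.machine.result_mem_support_law (M.input n [] []) ω
    | [a], _ => exact absurd hm (by simp [game])
    | _ :: _ :: t, _ => cases t <;> trivial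

theorem reachable_one (hR : Reachable (S.game n) n M 1 h r) : h.length ≤ 1 → r = [] := by
  induction hR with
  | nil => exact fun _ => rfl
  | other h r a hR hm ha ih =>
    intro hl
    rw [List.length_append, List.length_singleton] at hl
    exact ih (by omega)
  | own h r ω hR hm hN ih =>
    intro hl
    rw [List.length_append, List.length_singleton] at hl
    have h0 : h = [] := List.length_eq_zero_iff.1 (by omega)
    subst h0
    exact absurd hm (by simp [game])

end Reachable

variable (S) in
/-- `M` is a strategy of player `0` that commits to `β j` and opens the commitment iff `o j x`,
where `j` is the value modulo `q` of its first random bits. -/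
structure IsCommitter (q : ℕ) (β : ℕ → Bool) (o : ℕ → Bool → Bool) (M : Strategy) : Prop where
  stateful : M.stateful = true
  spec : ∃ t : ℕ → ℕ, ∀ n, n + S.senderTime n ≤ t n ∧
    (∀ p ∈ (M.move n [] []).support, t n ≤ p.2.length ∧ p.1 = S.firstMove q β n p.2) ∧
    (M.move n [] []).map (fun p => p.2.take (t n)) = coins (t n) ∧
    ∀ r a x, ∀ p ∈ (M.move n [a, x] r).support, p.1 = S.lastMove q β o n r (x.headD false)

/-- `M` is a strategy of player `1` that plays `ξ j`, where `j` is the value modulo `q` of its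
random bits. -/
structure IsChooser (q : ℕ) (ξ : ℕ → Bool) (M : Strategy) : Prop where
  stateful : M.stateful = true
  index_of_mem : ∀ n a, ∀ p ∈ (M.move n [a] []).support, p.1 = [ξ (index q n p.2)]
  map_fst : ∀ n a, (M.move n [a] []).map Prod.fst = ((coins n).map (binMod q)).map fun j => [ξ j]

variable (S) in
theorem exists_isCommitter {q : ℕ} (hq : 0 < q) (β : ℕ → Bool) (o : ℕ → Bool → Bool) :
    ∃ M, S.IsCommitter q β o M := by
  obtain ⟨M, t, hM⟩ := S.exists_committer q hq β o
  exact ⟨⟨M, true⟩, rfl, t, hM⟩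

theorem exists_isChooser {q : ℕ} (hq : 0 < q) (ξ : ℕ → Bool) : ∃ M, IsChooser q ξ M := by
  obtain ⟨M, hM⟩ := exists_chooser q hq ξ
  exact ⟨⟨M, true⟩, rfl, fun n a p hp => ((hM n [[], a]).1 p hp).2, fun n a => (hM n [[], a]).2⟩

variable {q : ℕ} {β ξ : ℕ → Bool} {o : ℕ → Bool → Bool} {M M' : Strategy} {n : ℕ}

theorem IsCommitter.length_le (hM : S.IsCommitter q β o M) {p : List Bool × List Bool}
    (hp : p ∈ (M.move n [] []).support) : n + S.senderTime n ≤ p.2.length := by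
  obtain ⟨t, ht⟩ := hM.spec
  exact (ht n).1.trans ((ht n).2.1 p hp).1

theorem IsCommitter.eq_firstMove (hM : S.IsCommitter q β o M) {p : List Bool × List Bool}
    (hp : p ∈ (M.move n [] []).support) : p.1 = S.firstMove q β n p.2 := by
  obtain ⟨t, ht⟩ := hM.spec
  exact ((ht n).2.1 p hp).2

theorem IsCommitter.isFirstAction (hM : S.IsCommitter q β o M) (hn : 1 ≤ n)
    {p : List Bool × List Bool} (hp : p ∈ (M.move n [] []).support) :
    S.IsFirstAction n (β (index q n p.2)) p.1 := by
  rw [hM.eq_firstMove hp]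
  exact isFirstAction_firstMove hn (hM.length_le hp)

theorem IsCommitter.opensWith_eq (hM : S.IsCommitter q β o M) (hn : 1 ≤ n)
    {p p' : List Bool × List Bool} {x : List Bool} (hp : p ∈ (M.move n [] []).support)
    (hp' : p' ∈ (M.move n [p.1, x] p.2).support) :
    S.opensWith n p.1 p'.1 = o (index q n p.2) (x.headD false) := by
  obtain ⟨t, ht⟩ := hM.spec
  rw [hM.eq_firstMove hp, (ht n).2.2.2 _ _ _ p' hp']
  exact opensWith_lastMove hn (hM.length_le hp) _

theorem IsCommitter.isStrategyFor (hM : S.IsCommitter q β o M) : IsStrategyFor S.game 0 M := by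
  intro n hn h r hR hN hm ω
  have hin := ((nonTerminal_iff hn).1 hN).1
  have hr := reachable_zero hR
  have hω : M.act n ((S.game n).info h) r ω ∈ (M.move n h r).support :=
    M.machine.result_mem_support_law (M.input n h r) ω
  obtain ⟨p', hp'⟩ : ∃ p', M.act n ((S.game n).info h) r ω = p' := ⟨_, rfl⟩
  rw [hp'] at hω ⊢
  rcases cases_of_mem hin with rfl | ⟨a, rfl⟩ | ⟨a, x, rfl⟩ | ⟨a, x, s, rfl⟩
  · obtain rfl : r = [] := hr
    exact ⟨_, hM.isFirstAction hn hω⟩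
  · exact absurd hm (by simp [game])
  · have hp : (a, r) ∈ (M.move n [] []).support := hr
    refine mem_three.2 ⟨hin, ?_⟩
    obtain ⟨t, ht⟩ := hM.spec
    rw [(ht n).2.2.2 _ _ _ p' hω]
    exact (length_lastMove hn (hM.length_le hp) _).trans (Nat.le_add_right _ _)
  · exact absurd ((nonTerminal_iff hn).1 hN).2 (by simp)

theorem IsChooser.isStrategyFor (hM : IsChooser q ξ M) : IsStrategyFor S.game 1 M := by
  intro n hn h r hR hN hm ω
  have hin := ((nonTerminal_iff hn).1 hN).1
  have hr := reachable_one hR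
  have hω : M.act n ((S.game n).info h) r ω ∈ (M.move n h r).support :=
    M.machine.result_mem_support_law (M.input n h r) ω
  obtain ⟨p', hp'⟩ : ∃ p', M.act n ((S.game n).info h) r ω = p' := ⟨_, rfl⟩
  rw [hp'] at hω ⊢
  rcases cases_of_mem hin with rfl | ⟨a, rfl⟩ | ⟨a, x, rfl⟩ | ⟨a, x, s, rfl⟩
  · exact absurd hm (by simp [game])
  · obtain rfl : r = [] := hr le_rfl
    refine ⟨hin, ?_⟩
    rw [hM.index_of_mem n a p' hω]
    rfl
  · exact absurd hm (by simp [game])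
  · exact absurd hm (by simp [game])

/-! ### The distributions on terminal histories -/

variable (S) in
/-- The distribution of the commitments to the bit `b`. -/
def commitLaw (n : ℕ) (b : Bool) : PMF (List Bool) :=
  (S.C.law [unary n, [b]]).map fun p => p.1.take n

variable (S) in
/-- The distribution of the bit that the strategy `M` of player `1` chooses, when player `0`
commits to `b` with a key of length `n - 1`. -/
def answerLaw (M : Strategy) (n : ℕ) (b : Bool) : PMF (List Bool) :=
  (S.commitLaw n b).bind fun c =>
    (M.move n [bits (Nat.clog 2 n) (n - 1) ++ c] []).map Prod.fst

variable (S) in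
/-- The distribution on terminal histories of the envelope game that is induced by the profile
`(M, M')` on the `n`-th game. -/
def decodedLaw (M M' : Strategy) (n : ℕ) : PMF History :=
  (M.move n [] []).bind fun p => (M'.move n [p.1] []).bind fun p' =>
    (M.move n [p.1, p'.1] p.2).map fun p'' =>
      [[S.committedBit n p.1], p'.1, [S.opensWith n p.1 p''.1]]

/-- The first `n` coins determine `j`; the remaining ones are independent and drive the sender, so
given `j` the commitment is a fresh sample from `commitLaw`. The decoded last move is a function of
`j` and the answer, so its own coins integrate out. -/
theorem IsCommitter.decodedLaw_eq (hM : S.IsCommitter q β o M) (hn : 1 ≤ n) :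
    S.decodedLaw M M' n = ((coins n).map (binMod q)).bind fun j =>
      (S.answerLaw M' n (β j)).map fun x => [[β j], x, [o j (x.headD false)]] := by
  obtain ⟨t, ht⟩ := hM.spec
  obtain ⟨h1, h2, h3, h4⟩ := ht n
  have e : S.decodedLaw M M' n = ((M.move n [] []).map fun p => p.2.take (t n)).bind fun ω =>
      (M'.move n [S.firstMove q β n ω] []).map fun p' =>
        [[β (index q n ω)], p'.1, [o (index q n ω) (p'.1.headD false)]] := by
    rw [PMF.bind_map]
    refine PMF.bind_congr' _ fun p hp => ?_
    rw [Function.comp_apply, firstMove_take h1 (h2 p hp).1, index_take (by omega), ← (h2 p hp).2,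
      ← PMF.bind_pure_comp]
    refine congrArg _ (funext fun p' => ?_)
    rw [Function.comp_apply, ← PMF.bind_const' (M.move n [p.1, p'.1] p.2) (PMF.pure _),
      ← PMF.bind_pure_comp]
    refine PMF.bind_congr' _ fun p'' hp'' => ?_
    rw [Function.comp_apply, (hM.isFirstAction hn hp).committedBit_eq, hM.opensWith_eq hn hp hp'']
  rw [e, h3]
  have hsplit := coins_bind_split (show n ≤ t n by omega) fun ω₁ ω₂ =>
    (M'.move n [bits (Nat.clog 2 n) (n - 1) ++ (S.sender n (β (binMod q ω₁)) ω₂).take n] []).map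
      fun p' => [[β (binMod q ω₁)], p'.1, [o (binMod q ω₁) (p'.1.headD false)]]
  refine hsplit.trans ?_
  rw [PMF.bind_map]
  refine congrArg _ (funext fun ω₁ => ?_)
  rw [Function.comp_apply, answerLaw, PMF.map_bind]
  have hc : (coins (t n - n)).map (fun ω => (S.sender n (β (binMod q ω₁)) ω).take n) =
      S.commitLaw n (β (binMod q ω₁)) := by
    have := congrArg (PMF.map (List.take n))
      (map_sender_coins (S := S) (n := n) (t := t n - n) (β (binMod q ω₁)) (by omega))
    rwa [PMF.map_comp, PMF.map_comp] at this
  rw [← hc, PMF.bind_map]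
  refine congrArg _ (funext fun ω₂ => ?_)
  rw [Function.comp_apply, PMF.map_comp]
  rfl

theorem IsChooser.answerLaw_eq (hM : IsChooser q ξ M) (n : ℕ) (b : Bool) :
    S.answerLaw M n b = ((coins n).map (binMod q)).map fun j => [ξ j] := by
  rw [answerLaw]
  simp only [hM.map_fst, PMF.bind_const']

theorem IsChooser.decodedLaw_eq (hM' : IsChooser q ξ M') :
    S.decodedLaw M M' n = (M.move n [] []).bind fun p => ((coins n).map (binMod q)).bind fun j =>
      (M.move n [p.1, [ξ j]] p.2).map fun p'' =>
        [[S.committedBit n p.1], [ξ j], [S.opensWith n p.1 p''.1]] := by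
  rw [decodedLaw]
  refine congrArg _ (funext fun p => ?_)
  have := congrArg (fun P : PMF (List Bool) => P.bind fun x => (M.move n [p.1, x] p.2).map fun p'' =>
    [[S.committedBit n p.1], x, [S.opensWith n p.1 p''.1]]) (hM'.map_fst n p.1)
  simp only [PMF.bind_map] at this ⊢
  exact this

/-! ### Hiding -/

theorem length_of_mem_answerLaw (hM : IsStrategyFor S.game 1 M) (hn : 1 ≤ n) {b : Bool}
    {x : List Bool} (hx : x ∈ (S.answerLaw M n b).support) : x.length = 1 := by
  rw [answerLaw, PMF.mem_support_bind_iff] at hx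
  obtain ⟨c, hc, hx⟩ := hx
  rw [PMF.support_map] at hx
  obtain ⟨p, hp, rfl⟩ := hx
  have hc' : S.IsCommitment n b c := by
    rw [commitLaw, PMF.support_map] at hc
    obtain ⟨p, hp, hpc⟩ := hc
    obtain ⟨r, hr⟩ := S.C.mem_support_law (l := [unary n, [b]]) hp
    refine ⟨r, ?_⟩
    rw [← hpc, hr, PPT.out]
  have ha : S.IsFirstAction n b (bits (Nat.clog 2 n) (n - 1) ++ c) :=
    ⟨n - 1, by omega, c, by rwa [Nat.sub_add_cancel hn], rfl⟩
  exact (mem_two.1 (mem_of_second hM hn (mem_one.2 ⟨b, ha⟩) hp)).2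

/-- A distribution on the two one-bit strings has one parameter, the probability of `[true]`. The
gap `ε` counts once for each of the two strings. -/
theorem close_of_singletons {P Q : PMF (List Bool)} (hP : ∀ x ∈ P.support, x.length = 1)
    (hQ : ∀ x ∈ Q.support, x.length = 1) {ε : ℝ} (hε : 0 ≤ ε)
    (h : |(P.mean fun x => if x = [true] then 1 else 0).toReal -
      (Q.mean fun x => if x = [true] then 1 else 0).toReal| ≤ ε) :
    PMF.Close (ENNReal.ofReal (2 * ε)) P Q := by
  set c₁ : List Bool → ℝ≥0∞ := fun x => if x = [true] then 1 else 0 with hc₁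
  set c₀ : List Bool → ℝ≥0∞ := fun x => if x = [true] then 0 else 1 with hc₀
  have hadd : ∀ P : PMF (List Bool), P.mean c₁ + P.mean c₀ = 1 := fun P => by
    rw [← PMF.mean_add, ← P.mean_const 1]
    congr 1
    funext x
    simp only [hc₁, hc₀]
    split_ifs <;> simp
  have hne₁ : ∀ P : PMF (List Bool), P.mean c₁ ≠ ∞ := fun P =>
    ne_top_of_le_ne_top ENNReal.one_ne_top ((hadd P).le.trans' le_self_add)
  have hne₀ : ∀ P : PMF (List Bool), P.mean c₀ ≠ ∞ := fun P =>
    ne_top_of_le_ne_top ENNReal.one_ne_top ((hadd P).le.trans' le_add_self)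
  have hadd' : ∀ P : PMF (List Bool), (P.mean c₁).toReal + (P.mean c₀).toReal = 1 := fun P => by
    rw [← ENNReal.toReal_add (hne₁ P) (hne₀ P), hadd, ENNReal.toReal_one]
  have hmean : ∀ (P : PMF (List Bool)), (∀ x ∈ P.support, x.length = 1) → ∀ g : List Bool → ℝ≥0∞,
      P.mean g = g [true] * P.mean c₁ + g [false] * P.mean c₀ := by
    intro P hP g
    have : ∀ (c : ℝ≥0∞) (f : List Bool → ℝ≥0∞), c * P.mean f = P.mean fun x => c * f x :=
      fun c f => by simp only [PMF.mean, ← ENNReal.tsum_mul_left, mul_left_comm]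
    rw [this, this, ← PMF.mean_add]
    refine P.mean_congr fun x hx => ?_
    obtain ⟨y, rfl⟩ := List.length_eq_one_iff.1 (hP x hx)
    cases y <;> simp [hc₁, hc₀]
  have hle : ∀ {a b : ℝ≥0∞}, a ≠ ∞ → b ≠ ∞ → a.toReal ≤ b.toReal + ε →
      a ≤ b + ENNReal.ofReal ε := by
    intro a b ha hb hab
    rw [← ENNReal.ofReal_toReal ha, ← ENNReal.ofReal_toReal hb,
      ← ENNReal.ofReal_add ENNReal.toReal_nonneg hε]
    exact ENNReal.ofReal_le_ofReal hab
  obtain ⟨h1, h2⟩ := abs_le.1 h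
  have hPa := hadd' P
  have hQa := hadd' Q
  intro g hg
  rw [hmean P hP, hmean Q hQ, two_mul, ENNReal.ofReal_add hε hε]
  calc _ ≤ g [true] * (Q.mean c₁ + ENNReal.ofReal ε) + g [false] * (Q.mean c₀ + ENNReal.ofReal ε) :=
        add_le_add (mul_le_mul_right (hle (hne₁ P) (hne₁ Q) (by linarith)) _)
          (mul_le_mul_right (hle (hne₀ P) (hne₀ Q) (by linarith)) _)
    _ = g [true] * Q.mean c₁ + g [false] * Q.mean c₀ +
        (g [true] * ENNReal.ofReal ε + g [false] * ENNReal.ofReal ε) := by ring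
    _ ≤ _ := by
      gcongr
      · exact mul_le_of_le_one_left zero_le (hg _)
      · exact mul_le_of_le_one_left zero_le (hg _)

/-- Hiding is used here: the distinguisher runs `M` on the given commitment, announced with key
length `n - 1`, and outputs the answer. Honest commitments are legal first actions, so the answer is
a single bit and the distinguishing advantage controls its whole distribution. -/
theorem exists_close_answerLaw (hM : IsStrategyFor S.game 1 M) : ∃ ε : ℕ → ℝ, Negligible ε ∧
    (∀ n, 0 ≤ ε n) ∧ ∀ n, 1 ≤ n → ∀ b,
      PMF.Close (ENNReal.ofReal (ε n)) (S.answerLaw M n b) (S.answerLaw M n false) := by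
  obtain ⟨T, hT⟩ := exists_distinguisher M
  obtain ⟨ε, hε, h⟩ := S.hides T
  have hε0 : ∀ n, 0 ≤ ε n := fun n => (abs_nonneg _).trans (h n)
  refine ⟨fun n => 2 * ε n, hε.const_mul 2, fun n => by linarith [hε0 n], fun n hn b => ?_⟩
  have key : ∀ b, ∑' x, commitWeight S.C b n x * T.acceptProb (unary n :: x) =
      ((S.answerLaw M n b).mean fun x => if x = [true] then 1 else 0).toReal := by
    intro b
    simp only [T.acceptProb_eq, commitWeight]
    rw [PMF.mean_toReal _ fun x => PMF.mean_le_one _ fun p => by split_ifs <;> simp, PMF.mean_map,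
      answerLaw, PMF.mean_bind, commitLaw, PMF.mean_map]
    congr 2
    funext p
    have := congrArg (fun P : PMF (List Bool) => P.mean fun x => if x = [true] then 1 else 0)
      (hT n (p.1.take n))
    simp only [PMF.mean_map] at this ⊢
    exact this
  have h1 := h n
  rw [key, key] at h1
  rcases b with _ | _
  · exact PMF.Close.rfl'.mono zero_le
  · refine close_of_singletons (fun x => length_of_mem_answerLaw hM hn)
      (fun x => length_of_mem_answerLaw hM hn) (hε0 n) ?_
    rwa [abs_sub_comm]

end CommitmentScheme

end

section

open scoped ENNReal
open Envelope

/-! ## The commitment games represent the envelope game -/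

theorem compIndist_of_close {P Q : ℕ → PMF (List (List Bool))} {X Y : ℕ → List (List Bool) → ℝ}
    (hX : ∀ n, 1 ≤ n → ∀ h, X n h = (P n h).toReal) (hY : ∀ n, 1 ≤ n → ∀ h, Y n h = (Q n h).toReal)
    {ε : ℕ → ℝ} (hε : Negligible ε) (hε0 : ∀ n, 0 ≤ ε n)
    (h : ∀ n, 1 ≤ n → PMF.Close (ENNReal.ofReal (ε n)) (P n) (Q n)) : CompIndist X Y := by
  intro D
  -- The games start at `n = 1` but indistinguishability also speaks of `n = 0`; there the bound is
  -- taken to be the difference itself, which does not affect negligibility.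
  refine ⟨fun n => if n = 0 then |∑' x, X n x * D.acceptProb (unary n :: x) -
    ∑' x, Y n x * D.acceptProb (unary n :: x)| else ε n, fun c => ?_, fun n => ?_⟩
  · filter_upwards [hε c, eventually_ge_atTop 1] with n h1 h2
    rwa [if_neg (by omega)]
  · beta_reduce
    split_ifs with hn
    · exact le_rfl
    · have hn : 1 ≤ n := by omega
      simp only [hX n hn, hY n hn, D.acceptProb_eq]
      have hle : ∀ x, ((D.law (unary n :: x)).mean fun p => if p.1 = [true] then 1 else 0) ≤ 1 :=
        fun x => PMF.mean_le_one _ fun p => by split_ifs <;> simp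
      rw [PMF.mean_toReal _ hle, PMF.mean_toReal _ hle]
      exact (h n hn).abs_sub_le (hε0 n) hle

namespace CommitmentScheme

variable {S : CommitmentScheme} {n : ℕ} {M M' : Strategy}

variable (S) in
/-- The strategy `M` of player `0` represents the mixed strategy `σ` of the envelope game. -/
def RepresentsFirst (σ : envelopeGame.MixedStrategy 0) (M : Strategy) : Prop :=
  ∃ (q : ℕ) (_ : NeZero q) (τ : ℕ → envelopeGame.DetStrategy 0),
    σ = ((PMF.uniformOfFintype (Fin q)).map Fin.val).map τ ∧
    S.IsCommitter q (fun j => committed (τ j)) (fun j x => opened (τ j) (committed (τ j)) x) M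

/-- The strategy `M` of player `1` represents the mixed strategy `σ` of the envelope game. -/
def RepresentsSecond (σ : envelopeGame.MixedStrategy 1) (M : Strategy) : Prop :=
  ∃ (q : ℕ) (_ : NeZero q) (τ : ℕ → envelopeGame.DetStrategy 1),
    σ = ((PMF.uniformOfFintype (Fin q)).map Fin.val).map τ ∧ IsChooser q (fun j => chosen (τ j)) M

theorem exists_representsFirst {σ : envelopeGame.MixedStrategy 0} (hσ : RationalWeights σ) :
    ∃ M, S.RepresentsFirst σ M := by
  have := Fintype.ofFinite (envelopeGame.DetStrategy 0)
  obtain ⟨q, hq, τ, h⟩ := exists_sampling σ hσ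
  obtain ⟨M, hM⟩ := S.exists_isCommitter (Nat.pos_of_ne_zero hq.out) (fun j => committed (τ j))
    fun j x => opened (τ j) (committed (τ j)) x
  exact ⟨M, q, hq, τ, h, hM⟩

theorem exists_representsSecond {σ : envelopeGame.MixedStrategy 1} (hσ : RationalWeights σ) :
    ∃ M, RepresentsSecond σ M := by
  have := Fintype.ofFinite (envelopeGame.DetStrategy 1)
  obtain ⟨q, hq, τ, h⟩ := exists_sampling σ hσ
  obtain ⟨M, hM⟩ := exists_isChooser (Nat.pos_of_ne_zero hq.out) fun j => chosen (τ j)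
  exact ⟨M, q, hq, τ, h, hM⟩

theorem RepresentsFirst.isStrategyFor {σ : envelopeGame.MixedStrategy 0}
    (hM : S.RepresentsFirst σ M) : IsStrategyFor S.game 0 M := by
  obtain ⟨q, hq, τ, -, hM⟩ := hM
  exact hM.isStrategyFor

theorem RepresentsSecond.isStrategyFor {σ : envelopeGame.MixedStrategy 1}
    (hM : RepresentsSecond σ M) : IsStrategyFor S.game 1 M := by
  obtain ⟨q, hq, τ, -, hM⟩ := hM
  exact hM.isStrategyFor

theorem ofReal_mul_inv_two_pow (q n : ℕ) :
    ENNReal.ofReal (q * ((2 : ℝ) ^ n)⁻¹) = q / 2 ^ n := by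
  rw [ENNReal.ofReal_mul (Nat.cast_nonneg q), ENNReal.ofReal_natCast,
    ENNReal.ofReal_inv_of_pos (by positivity), ENNReal.ofReal_pow (by norm_num),
    ENNReal.ofReal_ofNat, div_eq_mul_inv]

theorem negligible_mul_inv_two_pow (q : ℕ) : Negligible fun n => q * ((2 : ℝ) ^ n)⁻¹ :=
  Negligible.two_pow.const_mul q

/-- Any strategy of player `1` has the same effect, against a representation of `σ`, as some mixed
strategy against `σ`. -/
theorem RepresentsFirst.exists_close {σ : envelopeGame.MixedStrategy 0}
    (hM : S.RepresentsFirst σ M) (hM' : IsStrategyFor S.game 1 M') :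
    ∃ (ε : ℕ → ℝ) (σ' : ℕ → envelopeGame.MixedStrategy 1), Negligible ε ∧ (∀ n, 0 ≤ ε n) ∧
      ∀ n, 1 ≤ n → PMF.Close (ENNReal.ofReal (ε n)) (S.decodedLaw M M' n) (law σ (σ' n)) := by
  obtain ⟨q, hq, τ, rfl, hM⟩ := hM
  obtain ⟨ε, hε, hε0, hc⟩ := exists_close_answerLaw hM'
  -- The equivalent mixed strategy gives the answer of `M'` to a commitment to `0`, whatever is in
  -- the envelope. The errors come from sampling modulo `q` and from hiding.
  refine ⟨fun n => q * ((2 : ℝ) ^ n)⁻¹ + ε n, fun n => (S.answerLaw M' n false).map fun x =>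
    chooser (x.headD false), (negligible_mul_inv_two_pow q).add hε,
    fun n => add_nonneg (by positivity) (hε0 n), fun n hn => ?_⟩
  rw [hM.decodedLaw_eq hn, ENNReal.ofReal_add (by positivity) (hε0 n), ofReal_mul_inv_two_pow]
  refine ((close_binMod n).bind_right _).trans ?_
  rw [law, PMF.bind_map (_ : PMF ℕ)]
  refine PMF.Close.bind_left _ fun j => ?_
  rw [Function.comp_apply, PMF.map_comp]
  have e : ((S.answerLaw M' n false).map fun x => [[committed (τ j)], x,
      [opened (τ j) (committed (τ j)) (x.headD false)]]) =
      (S.answerLaw M' n false).map ((fun s' => outcome (τ j) (chosen s')) ∘ fun x =>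
        chooser (x.headD false)) := by
    rw [← PMF.bind_pure_comp, ← PMF.bind_pure_comp]
    refine PMF.bind_congr' _ fun x hx => ?_
    obtain ⟨y, rfl⟩ := List.length_eq_one_iff.1 (length_of_mem_answerLaw hM' hn hx)
    rfl
  rw [← e]
  exact (hc n hn _).map _

/-- Drawing a sample for each of two eventualities and using only the relevant one has the same
effect as drawing only that one. This turns behaviour after an answer into a plan made beforehand.
-/
theorem bind_ite_eq {α β ι : Type} (U : PMF ι) (D₀ D₁ : PMF α) (ξ : ι → Bool) (φ : ι → α → β) :
    (U.bind fun j => (if ξ j then D₁ else D₀).map (φ j)) =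
      D₀.bind fun a₀ => D₁.bind fun a₁ => U.map fun j => φ j (if ξ j then a₁ else a₀) := by
  simp only [← PMF.bind_pure_comp]
  have h : ∀ a₀, (D₁.bind fun a₁ => U.bind (PMF.pure ∘ fun j => φ j (if ξ j then a₁ else a₀))) =
      U.bind fun j => D₁.bind fun a₁ => PMF.pure (φ j (if ξ j then a₁ else a₀)) :=
    fun a₀ => PMF.bind_comm _ _ _
  simp only [h]
  rw [PMF.bind_comm]
  refine congrArg _ (funext fun j => ?_)
  cases ξ j
  · simp only [Bool.false_eq_true, if_false, PMF.bind_const']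
    rfl
  · simp only [if_true, PMF.bind_const']
    rfl

/-- Any strategy of player `0` has the same effect, against a representation of `σ`, as some mixed
strategy against `σ`. -/
theorem RepresentsSecond.exists_close {σ : envelopeGame.MixedStrategy 1}
    (hM' : RepresentsSecond σ M') (S : CommitmentScheme) (M : Strategy) :
    ∃ (ε : ℕ → ℝ) (σ' : ℕ → envelopeGame.MixedStrategy 0), Negligible ε ∧ (∀ n, 0 ≤ ε n) ∧
      ∀ n, PMF.Close (ENNReal.ofReal (ε n)) (S.decodedLaw M M' n) (law (σ' n) σ) := by
  obtain ⟨q, hq, τ, rfl, hM'⟩ := hM'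
  -- The plan consists of a first move and one last move for each possible answer; both last moves
  -- use the same remembered coins `p.2`. The only error comes from player 1's sampling.
  refine ⟨fun n => q * ((2 : ℝ) ^ n)⁻¹, fun n => (M.move n [] []).bind fun p =>
    (M.move n [p.1, [false]] p.2).bind fun p₀ => (M.move n [p.1, [true]] p.2).map fun p₁ =>
      committer (S.committedBit n p.1) fun _ x =>
        if x then S.opensWith n p.1 p₁.1 else S.opensWith n p.1 p₀.1,
    negligible_mul_inv_two_pow q, fun n => by positivity, fun n => ?_⟩
  rw [hM'.decodedLaw_eq, ofReal_mul_inv_two_pow, law, PMF.bind_bind]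
  refine PMF.Close.bind_left _ fun p => ?_
  have e := bind_ite_eq ((PMF.uniformOfFintype (Fin q)).map Fin.val) (M.move n [p.1, [false]] p.2)
    (M.move n [p.1, [true]] p.2) (fun j => chosen (τ j))
    fun j p'' => [[S.committedBit n p.1], [chosen (τ j)], [S.opensWith n p.1 p''.1]]
  have e₁ : ∀ j, (if chosen (τ j) then M.move n [p.1, [true]] p.2
      else M.move n [p.1, [false]] p.2) = M.move n [p.1, [chosen (τ j)]] p.2 := fun j => by
    cases chosen (τ j) <;> rfl
  simp only [e₁] at e
  have e₂ : ((M.move n [p.1, [false]] p.2).bind fun p₀ => (M.move n [p.1, [true]] p.2).map fun p₁ =>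
      committer (S.committedBit n p.1) fun _ x =>
        if x then S.opensWith n p.1 p₁.1 else S.opensWith n p.1 p₀.1).bind (fun s =>
        (((PMF.uniformOfFintype (Fin q)).map Fin.val).map τ).map fun s' => outcome s (chosen s')) =
      ((PMF.uniformOfFintype (Fin q)).map Fin.val).bind fun j =>
        (M.move n [p.1, [chosen (τ j)]] p.2).map fun p'' =>
          [[S.committedBit n p.1], [chosen (τ j)], [S.opensWith n p.1 p''.1]] := by
    rw [e, PMF.bind_bind]
    refine congrArg _ (funext fun p₀ => ?_)
    rw [PMF.bind_map]
    refine congrArg _ (funext fun p₁ => ?_)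
    rw [Function.comp_apply, PMF.map_comp]
    refine congrArg (fun f => PMF.map f _) (funext fun j => ?_)
    simp only [Function.comp_apply, outcome, committed_committer, opened_committer]
    cases chosen (τ j) <;> rfl
  rw [e₂]
  exact (close_binMod n).bind_right _

/-- The mixed strategies provided by the `exists_close` lemmas vary with `n`, so the comparison with
`σ'` itself is made directly; the two sampling errors add up. -/
theorem RepresentsFirst.close_of_second {σ : envelopeGame.MixedStrategy 0}
    {σ' : envelopeGame.MixedStrategy 1} (hM : S.RepresentsFirst σ M)
    (hM' : RepresentsSecond σ' M') : ∃ ε : ℕ → ℝ, Negligible ε ∧ (∀ n, 0 ≤ ε n) ∧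
      ∀ n, 1 ≤ n → PMF.Close (ENNReal.ofReal (ε n)) (S.decodedLaw M M' n) (law σ σ') := by
  obtain ⟨q, hq, τ, rfl, hM⟩ := hM
  obtain ⟨q', hq', τ', rfl, hM'⟩ := hM'
  refine ⟨fun n => q * ((2 : ℝ) ^ n)⁻¹ + q' * ((2 : ℝ) ^ n)⁻¹,
    (negligible_mul_inv_two_pow q).add (negligible_mul_inv_two_pow q'), fun n => by positivity,
    fun n hn => ?_⟩
  rw [hM.decodedLaw_eq hn, ENNReal.ofReal_add (by positivity) (by positivity),
    ofReal_mul_inv_two_pow, ofReal_mul_inv_two_pow]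
  refine ((close_binMod n).bind_right _).trans ?_
  rw [law, PMF.bind_map (_ : PMF ℕ)]
  refine PMF.Close.bind_left _ fun j => ?_
  have h := (close_binMod (q := q') n).map fun i => outcome (τ j) (chosen (τ' i))
  rw [hM'.answerLaw_eq, Function.comp_apply]
  simp only [PMF.map_comp] at h ⊢
  exact h

/-! ### The map on histories -/

theorem decode_mem {h : History} (hh : h ∈ (S.game n).H) : S.decode n h ∈ envelopeGame.H := by
  rcases cases_of_mem hh with rfl | ⟨a, rfl⟩ | ⟨a, x, rfl⟩ | ⟨a, x, s, rfl⟩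
  · exact envelopeGame.nil_mem
  · exact ⟨by simp [decode], by simp [decode]⟩
  · exact ⟨by simp [decode], by simpa [decode] using (mem_two.1 hh).2⟩
  · exact ⟨by simp [decode], by simpa [decode] using (mem_two.1 (mem_three.1 hh).1).2⟩

theorem length_decode {h : History} (hh : h ∈ (S.game n).H) :
    (S.decode n h).length = h.length := by
  rcases cases_of_mem hh with rfl | ⟨a, rfl⟩ | ⟨a, x, rfl⟩ | ⟨a, x, s, rfl⟩ <;> rfl

theorem decode_take {h : History} (hh : h ∈ (S.game n).H) (k : ℕ) :
    S.decode n (h.take k) = (S.decode n h).take k := by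
  rcases cases_of_mem hh with rfl | ⟨a, rfl⟩ | ⟨a, x, rfl⟩ | ⟨a, x, s, rfl⟩ <;>
    rcases k with _ | _ | _ | k <;> simp [decode]

theorem firstWins_iff_decode {h : History} (hn : 1 ≤ n) (hh : (S.game n).Terminal h) :
    S.FirstWins n h ↔ ∃ b x : Bool, S.decode n h = [[b], [x], [true]] ∧ b ≠ x := by
  obtain ⟨a, x, s, rfl, hm⟩ := (terminal_iff hn).1 hh
  obtain ⟨b, hb⟩ := mem_one.1 (mem_two.1 (mem_three.1 hm).1).1
  have hdec : S.decode n [a, x, s] = [[b], x, [S.opensWith n a s]] := by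
    rw [decode, hb.committedBit_eq]
  have ho := hb.openWith_eq s
  rw [hdec]
  constructor
  · rintro ⟨a', s', b', x', he, ho', hne⟩
    simp only [List.cons.injEq, and_true] at he
    obtain ⟨rfl, rfl, rfl⟩ := he
    rw [ho] at ho'
    split_ifs at ho' with h
    obtain rfl := Option.some.inj ho'
    exact ⟨b, x', by rw [h], hne⟩
  · rintro ⟨b', x', he, hne⟩
    simp only [List.cons.injEq, and_true] at he
    obtain ⟨rfl, rfl, h⟩ := he
    exact ⟨a, s, b, x', rfl, by rw [ho, if_pos h], hne⟩

theorem utility_decode {h : History} (hn : 1 ≤ n) (hh : (S.game n).Terminal h) (i : Fin 2) :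
    (S.game n).u i h = envelopeGame.u i (S.decode n h) := by
  simp only [game, envelopeGame, firstWins_iff_decode hn hh]

theorem finite_envelope : envelopeGame.H.Finite := by
  refine ((List.finite_length_le Bool 3).image (List.map fun b => [b])).subset fun h hh => ?_
  refine ⟨h.map (List.headD · false), by simpa using hh.1, ?_⟩
  rw [List.map_map]
  conv_rhs => rw [← List.map_id h]
  exact List.map_congr_left fun a ha => (eq_singleton_headD (hh.2 a ha)).symm

theorem exists_decode_eq (hn : 1 ≤ n) {g : History} (hg : g ∈ envelopeGame.H) :
    ∃ h ∈ (S.game n).H, S.decode n h = g := by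
  obtain ⟨hl, h1⟩ := hg
  -- The honest committer with the single alternative `q = 1` realizes every pair consisting of a
  -- committed bit and a decision to open.
  have hex : ∀ b o : Bool, ∃ a s, S.IsFirstAction n b a ∧ s.length ≤ n ∧ S.opensWith n a s = o := by
    intro b o
    obtain ⟨ω, hω⟩ : ∃ ω : List Bool, n + S.senderTime n ≤ ω.length :=
      ⟨List.replicate (n + S.senderTime n) false, by simp⟩
    exact ⟨S.firstMove 1 (fun _ => b) n ω, S.lastMove 1 (fun _ => b) (fun _ _ => o) n ω false,
      isFirstAction_firstMove (q := 1) (β := fun _ => b) hn hω, length_lastMove hn hω false,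
      opensWith_lastMove hn hω false⟩
  match g, hl, h1 with
  | [], _, _ => exact ⟨[], (S.game n).nil_mem, rfl⟩
  | [b], _, h1 =>
    obtain ⟨a, s, ha, -⟩ := hex (b.headD false) true
    refine ⟨[a], ⟨_, ha⟩, ?_⟩
    rw [decode, ha.committedBit_eq, ← eq_singleton_headD (h1 b (by simp))]
  | [b, x], _, h1 =>
    obtain ⟨a, s, ha, -⟩ := hex (b.headD false) true
    refine ⟨[a, x], ⟨⟨_, ha⟩, h1 x (by simp)⟩, ?_⟩
    rw [decode, ha.committedBit_eq, ← eq_singleton_headD (h1 b (by simp))]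
  | [b, x, o], _, h1 =>
    obtain ⟨a, s, ha, hs, ho⟩ := hex (b.headD false) (o.headD false)
    refine ⟨[a, x, s], ⟨⟨_, ha⟩, h1 x (by simp), hs.trans (Nat.le_add_right _ _)⟩, ?_⟩
    rw [decode, ha.committedBit_eq, ho, ← eq_singleton_headD (h1 b (by simp)),
      ← eq_singleton_headD (h1 o (by simp))]
  | _ :: _ :: _ :: _ :: _, hl, _ =>
    simp only [List.length_cons] at hl
    omega

/-! ### The map on strategies and the representation -/

instance : Nonempty Strategy := (exists_isChooser one_pos fun _ => true).nonempty

variable (S) in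
/-- The strategies of the commitment game that represent mixed strategies of the envelope game. -/
def represent : ∀ i, envelopeGame.MixedStrategy i → Strategy
  | 0, σ => Classical.epsilon (S.RepresentsFirst σ)
  | 1, σ => Classical.epsilon (RepresentsSecond σ)

theorem representsFirst_represent {σ : envelopeGame.MixedStrategy 0} (hσ : RationalWeights σ) :
    S.RepresentsFirst σ (S.represent 0 σ) := Classical.epsilon_spec (exists_representsFirst hσ)

theorem representsSecond_represent {σ : envelopeGame.MixedStrategy 1} (hσ : RationalWeights σ) :
    RepresentsSecond σ (S.represent 1 σ) := Classical.epsilon_spec (exists_representsSecond hσ)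

theorem pushedWeight_eq {M : Fin 2 → Strategy} (hM : ∀ i, IsStrategyFor S.game i (M i)) (hn : 1 ≤ n)
    (h : History) : pushedWeight S.game S.decode M n h =
      (S.decodedLaw (M 0) (M 1) n h).toReal := by
  rw [pushedWeight, law_decode_eq hM hn, decodedLaw]

theorem exists_computes_first {σ : envelopeGame.MixedStrategy 0} {M : Strategy}
    (hM : S.RepresentsFirst σ M) : ∃ N : PPT, ∀ n, 1 ≤ n → ∀ h r,
      Reachable (S.game n) n M 0 h r → (S.game n).NonTerminal h → (S.game n).mover h = 0 →
      ∀ (ω : M.Coins n h r) (ω' : N.Coins (unary n :: r :: (M.act n h r ω).2 :: h)),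
        (S.decode n (h ++ [(M.act n h r ω).1])).getLast? = some (N.out _ ω') := by
  obtain ⟨q, hq, τ, -, hM⟩ := hM
  obtain ⟨N, hN⟩ := exists_committer_bit q (Nat.pos_of_ne_zero hq.out) (fun j => committed (τ j))
    fun j x => opened (τ j) (committed (τ j)) x
  refine ⟨N, fun n hn h r hR hT hm ω ω' => ?_⟩
  have hr := reachable_zero hR
  have hω : M.act n h r ω ∈ (M.move n h r).support :=
    M.machine.result_mem_support_law (M.input n h r) ω
  rcases cases_of_mem ((nonTerminal_iff hn).1 hT).1 with rfl | ⟨a, rfl⟩ | ⟨a, x, rfl⟩ | ⟨a, x, s, rfl⟩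
  · obtain rfl : r = [] := hr
    exact (congrArg (fun b => some [b]) (hM.isFirstAction hn hω).committedBit_eq).trans
      (congrArg some (hN n _ _ ω').1.symm)
  · exact absurd hm (by simp [game])
  · have hp : (a, r) ∈ (M.move n [] []).support := hr
    exact (congrArg (fun b => some [b]) (hM.opensWith_eq hn hp hω)).trans
      (congrArg some ((hN n _ _ fun _ => false).2 a x ω').symm)
  · exact absurd ((nonTerminal_iff hn).1 hT).2 (by simp)

theorem exists_computes_second {σ : envelopeGame.MixedStrategy 1} {M : Strategy}
    (hM : RepresentsSecond σ M) : ∃ N : PPT, ∀ n, 1 ≤ n → ∀ h r,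
      Reachable (S.game n) n M 1 h r → (S.game n).NonTerminal h → (S.game n).mover h = 1 →
      ∀ (ω : M.Coins n h r) (ω' : N.Coins (unary n :: r :: (M.act n h r ω).2 :: h)),
        (S.decode n (h ++ [(M.act n h r ω).1])).getLast? = some (N.out _ ω') := by
  obtain ⟨q, hq, τ, -, hM⟩ := hM
  obtain ⟨N, hN⟩ := exists_chooser_bit q (Nat.pos_of_ne_zero hq.out) fun j => chosen (τ j)
  refine ⟨N, fun n hn h r hR hT hm ω ω' => ?_⟩
  have hr := reachable_one hR
  have hω : M.act n h r ω ∈ (M.move n h r).support :=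
    M.machine.result_mem_support_law (M.input n h r) ω
  rcases cases_of_mem ((nonTerminal_iff hn).1 hT).1 with rfl | ⟨a, rfl⟩ | ⟨a, x, rfl⟩ | ⟨a, x, s, rfl⟩
  · exact absurd hm (by simp [game])
  · obtain rfl : r = [] := hr le_rfl
    exact (congrArg some (hM.index_of_mem n a _ hω)).trans (congrArg some (hN n _ _ _ ω').symm)
  · exact absurd hm (by simp [game])
  · exact absurd hm (by simp [game])

theorem isStrategyFor_represent (i : Fin 2) (σ : envelopeGame.MixedStrategy i)
    (hσ : RationalWeights σ) : IsStrategyFor S.game i (S.represent i σ) := by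
  revert i
  refine Fin.forall_fin_two.2 ⟨fun σ hσ => ?_, fun σ hσ => ?_⟩
  · exact (representsFirst_represent hσ).isStrategyFor
  · exact (representsSecond_represent hσ).isStrategyFor

theorem isStrategyFor_update {M : Fin 2 → Strategy} (hM : ∀ i, IsStrategyFor S.game i (M i))
    {i : Fin 2} {M' : Strategy} (hM' : IsStrategyFor S.game i M') (j : Fin 2) :
    IsStrategyFor S.game j (Function.update M i M' j) := by
  by_cases h : j = i
  · subst h
    rwa [Function.update_self]
  · rw [Function.update_of_ne h]
    exact hM j

variable (S) in
theorem represents : Represents S.game envelopeGame := by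
  refine ⟨S.decode, S.represent, ?_⟩
  constructor
  · exact finite_envelope
  · exact fun n hn h hh => decode_mem hh
  · exact fun n hn g hg => exists_decode_eq hn hg
  · exact fun n hn h hh => length_decode hh
  · intro n hn h hh
    have hh' := (nonTerminal_iff hn).1 hh
    refine ⟨Envelope.nonTerminal_iff.2 ⟨decode_mem hh'.1, (length_decode hh'.1).trans_lt hh'.2⟩, ?_⟩
    simp only [envelopeGame, game, length_decode hh'.1]
  · intro n hn h hh h' hh' hp
    rw [List.prefix_iff_eq_take.1 hp, decode_take hh]
    exact List.take_prefix _ _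
  · rintro n hn h h' hh hh' hm rfl
    rfl
  · rintro n hn h h' hh hh' hm rfl a ha
    rfl
  · intro n hn h hh
    refine ⟨⟨decode_mem hh.1, fun hN => ?_⟩, utility_decode hn hh⟩
    obtain ⟨a, x, s, rfl, -⟩ := (terminal_iff hn).1 hh
    exact absurd (Envelope.nonTerminal_iff.1 hN).2 (by simp [decode])
  · exact isStrategyFor_represent
  · intro σ hσ
    obtain ⟨ε, hε, hε0, h⟩ := (representsFirst_represent (S := S) (hσ 0)).close_of_second
      (representsSecond_represent (S := S) (hσ 1))
    refine ⟨fun n => 2 * ε n, hε.const_mul 2, fun n hn => ?_⟩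
    have hM : ∀ i, IsStrategyFor S.game i (S.represent i (σ i)) :=
      fun i => isStrategyFor_represent i _ (hσ i)
    simp only [pushedWeight_eq hM hn, mixedWeight_eq]
    exact (h n hn).tsum_abs_sub_le (hε0 n)
  · refine Fin.forall_fin_two.2 ⟨fun σ hσ => ?_, fun σ hσ => ?_⟩
    · exact exists_computes_first (representsFirst_represent hσ)
    · exact exists_computes_second (representsSecond_represent hσ)
  · intro σ hσ
    have hM : ∀ i, IsStrategyFor S.game i (S.represent i (σ i)) :=
      fun i => isStrategyFor_represent i _ (hσ i)
    refine Fin.forall_fin_two.2 ⟨fun M' hM' => ?_, fun M' hM' => ?_⟩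
    · obtain ⟨ε, σ', hε, hε0, h⟩ :=
        (representsSecond_represent (S := S) (hσ 1)).exists_close S M'
      refine ⟨σ', compIndist_of_close (fun n hn h => pushedWeight_eq
        (isStrategyFor_update hM hM') hn h) (fun n hn h => mixedWeight_eq _ h) hε hε0
        fun n hn => ?_⟩
      exact h n
    · obtain ⟨ε, σ', hε, hε0, h⟩ := (representsFirst_represent (S := S) (hσ 0)).exists_close hM'
      refine ⟨σ', compIndist_of_close (fun n hn h => pushedWeight_eq
        (isStrategyFor_update hM hM') hn h) (fun n hn h => mixedWeight_eq _ h) hε hε0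
        fun n hn => ?_⟩
      exact h n hn

end CommitmentScheme

end

section

open scoped ENNReal
open Envelope

/-! ## Equilibria of the commitment games -/

theorem PMF.mean_mul_const {α : Type*} (p : PMF α) (g : α → ℝ≥0∞) (c : ℝ≥0∞) :
    (p.mean fun a => g a * c) = p.mean g * c := by
  simp only [mean, ← mul_assoc, ENNReal.tsum_mul_right]

theorem ENNReal.mul_le_inv_four {x y : ℝ≥0∞} (h : x + y = 1) : x * y ≤ 4⁻¹ := by
  lift x to NNReal using ne_top_of_le_ne_top one_ne_top (h ▸ le_self_add)
  lift y to NNReal using ne_top_of_le_ne_top one_ne_top (h ▸ le_add_self)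
  have h : (x : ℝ) + y = 1 := by exact_mod_cast h
  have h4 : (4⁻¹ : ℝ≥0∞) = ((4⁻¹ : NNReal) : ℝ≥0∞) := by
    rw [ENNReal.coe_inv (by norm_num)]
    rfl
  rw [h4, ← ENNReal.coe_mul, ENNReal.coe_le_coe, ← NNReal.coe_le_coe]
  push_cast
  nlinarith [sq_nonneg ((x : ℝ) - y)]

namespace CommitmentScheme

variable {S : CommitmentScheme} {n : ℕ} {M : Fin 2 → Strategy}

variable (S) in
/-- The probability that player `0` wins the `n`-th game. -/
def winProb (M M' : Strategy) (n : ℕ) : ℝ := ((S.decodedLaw M M' n).mean win).toReal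

theorem terminal_of_mem_terminalLaw (hM : ∀ i, IsStrategyFor S.game i (M i)) (hn : 1 ≤ n)
    {h : History} (hh : h ∈ ((S.game n).terminalLaw n M).support) : (S.game n).Terminal h := by
  rw [terminalLaw_eq hM hn, PMF.mem_support_bind_iff] at hh
  obtain ⟨p, hp, hh⟩ := hh
  obtain ⟨p', hp', hh⟩ := (PMF.mem_support_bind_iff _ _ _).1 hh
  obtain ⟨p'', hp'', rfl⟩ := (PMF.mem_support_map_iff _ _ _).1 hh
  exact (terminal_iff hn).2 ⟨_, _, _, rfl, mem_of_third (hM 0) hn hp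
    (mem_of_second (hM 1) hn (mem_of_first (hM 0) hn hp) hp') hp''⟩

theorem expectedUtility_eq (hM : ∀ i, IsStrategyFor S.game i (M i)) (hn : 1 ≤ n) {i : Fin 2}
    {c d : ℝ} (hu : ∀ h, envelopeGame.u i h = c + d * (win h).toReal) :
    (S.game n).expectedUtility n M i = c + d * S.winProb (M 0) (M 1) n := by
  set P := (S.game n).terminalLaw n M with hP
  have hle : ∀ h, (win ∘ S.decode n) h ≤ 1 := fun h => win_le_one _
  have e : ∀ h, (P h).toReal * (S.game n).u i h =
      c * (P h).toReal + d * ((P h).toReal * ((win ∘ S.decode n) h).toReal) := fun h => by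
    by_cases hh : P h = 0
    · simp [hh]
    · rw [utility_decode hn (terminal_of_mem_terminalLaw hM hn hh), hu, Function.comp_apply]
      ring
  have hs : Summable fun h => (P h).toReal * ((win ∘ S.decode n) h).toReal :=
    P.summable_toReal.of_nonneg_of_le (fun h => by positivity) fun h =>
      mul_le_of_le_one_right ENNReal.toReal_nonneg (ENNReal.toReal_mono ENNReal.one_ne_top (hle h))
  rw [ExtGame.expectedUtility, ← hP, tsum_congr e,
    Summable.tsum_add (P.summable_toReal.mul_left c) (hs.mul_left d), tsum_mul_left, tsum_mul_left,
    P.tsum_toReal, mul_one, P.mean_toReal hle, ← PMF.mean_map, hP, law_decode_eq hM hn]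
  rfl

theorem expectedUtility_zero (hM : ∀ i, IsStrategyFor S.game i (M i)) (hn : 1 ≤ n) :
    (S.game n).expectedUtility n M 0 = 2 * S.winProb (M 0) (M 1) n - 1 := by
  rw [expectedUtility_eq hM hn (c := -1) (d := 2) fun h => by rw [utility_zero]; ring]
  ring

theorem expectedUtility_one (hM : ∀ i, IsStrategyFor S.game i (M i)) (hn : 1 ≤ n) :
    (S.game n).expectedUtility n M 1 = 1 - 2 * S.winProb (M 0) (M 1) n := by
  rw [expectedUtility_eq hM hn (c := 1) (d := -2) fun h => by rw [utility_one]; ring]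
  ring

/-- A uniform bit that stays hidden until the end is guessed correctly only with probability `1/2`,
up to a negligible error, by any polynomial-time opponent. -/
theorem winProb_uniformCommitter {M₀ M₁ : Strategy} (h₀ : S.RepresentsFirst uniformCommitter M₀)
    (h₁ : IsStrategyFor S.game 1 M₁) : ∃ ε : ℕ → ℝ, Negligible ε ∧ ∀ n, 1 ≤ n →
      |S.winProb M₀ M₁ n - 2⁻¹| ≤ ε n := by
  obtain ⟨ε, σ', hε, hε0, h⟩ := h₀.exists_close h₁
  refine ⟨ε, hε, fun n hn => ?_⟩
  have := (h n hn).abs_sub_le (hε0 n) win_le_one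
  rwa [win_uniformCommitter, ENNReal.toReal_inv, ENNReal.toReal_ofNat] at this

/-- The guess ignores the commitment, so this holds against every machine and relies on sampling
alone; only an upper bound is possible as player 0 may refuse to open. -/
theorem winProb_uniformChooser {M₁ : Strategy} (h₁ : RepresentsSecond uniformChooser M₁)
    (M₀ : Strategy) : ∃ ε : ℕ → ℝ, Negligible ε ∧ ∀ n, S.winProb M₀ M₁ n ≤ 2⁻¹ + ε n := by
  obtain ⟨ε, σ', hε, hε0, h⟩ := h₁.exists_close S M₀
  refine ⟨ε, hε, fun n => ?_⟩
  have h2 := (abs_le.1 ((h n).abs_sub_le (hε0 n) win_le_one)).2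
  have h3 := ENNReal.toReal_mono (by simp) (win_uniformChooser (σ' n))
  rw [ENNReal.toReal_inv, ENNReal.toReal_ofNat] at h3
  rw [winProb]
  linarith

variable (S) in
-- The uniform committer keeps the winning probability at `1/2` against all opponents and the
-- uniform chooser keeps it from exceeding `1/2`, both up to negligible errors, so neither side can
-- gain more than that.
theorem exists_isCompNash_stateful :
    ∃ M : Fin 2 → Strategy, (∀ i, (M i).stateful = true) ∧ IsCompNash S.game M := by
  have h₀ := representsFirst_represent (S := S) rationalWeights_uniformCommitter
  have h₁ := representsSecond_represent (S := S) rationalWeights_uniformChooser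
  set M₀ := S.represent 0 uniformCommitter
  set M₁ := S.represent 1 uniformChooser
  have hM : ∀ i, IsStrategyFor S.game i (![M₀, M₁] i) :=
    Fin.forall_fin_two.2 ⟨h₀.isStrategyFor, h₁.isStrategyFor⟩
  refine ⟨![M₀, M₁], Fin.forall_fin_two.2 ⟨?_, ?_⟩, hM, Fin.forall_fin_two.2
    ⟨fun M' hM' => ?_, fun M' hM' => ?_⟩⟩
  · obtain ⟨q, hq, τ, -, h⟩ := h₀
    exact h.stateful
  · obtain ⟨q, hq, τ, -, h⟩ := h₁
    exact h.stateful
  · obtain ⟨ε, hε, h⟩ := winProb_uniformCommitter h₀ h₁.isStrategyFor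
    obtain ⟨ε', hε', h'⟩ := winProb_uniformChooser (S := S) h₁ M'
    refine ⟨fun n => 2 * (ε n + ε' n), (hε.add hε').const_mul 2, fun n hn => ?_⟩
    rw [expectedUtility_zero hM hn, expectedUtility_zero (isStrategyFor_update hM hM') hn]
    change 2 * S.winProb M₀ M₁ n - 1 ≥ 2 * S.winProb M' M₁ n - 1 - _
    have h1 := (abs_le.1 (h n hn)).1
    have h2 := h' n
    linarith
  · obtain ⟨ε, hε, h⟩ := winProb_uniformCommitter h₀ h₁.isStrategyFor
    obtain ⟨ε', hε', h'⟩ := winProb_uniformCommitter h₀ hM'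
    refine ⟨fun n => 2 * (ε n + ε' n), (hε.add hε').const_mul 2, fun n hn => ?_⟩
    rw [expectedUtility_one hM hn, expectedUtility_one (isStrategyFor_update hM hM') hn]
    change 1 - 2 * S.winProb M₀ M₁ n ≥ 1 - 2 * S.winProb M₀ M' n - _
    have h1 := (abs_le.1 (h n hn)).2
    have h2 := (abs_le.1 (h' n hn)).1
    linarith

/-- Against a stateless strategy of player `0`, player `1` can reduce the probability of losing to
`1/4` by simulating the last move of player `0`. -/
theorem exists_winProb_le {M₀ : Strategy} (hs : M₀.stateful = false)
    (h₀ : IsStrategyFor S.game 0 M₀) : ∃ M₁, IsStrategyFor S.game 1 M₁ ∧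
      ∀ n, 1 ≤ n → S.winProb M₀ M₁ n ≤ 4⁻¹ := by
  obtain ⟨T, hT⟩ := S.exists_predictor M₀.machine
  refine ⟨⟨T, false⟩, fun n hn h r hR hN hm ω => ?_, fun n hn => ?_⟩
  · have hlt := (nonTerminal_iff hn).1 hN
    rcases cases_of_mem hlt.1 with rfl | ⟨a, rfl⟩ | ⟨a, x, rfl⟩ | ⟨a, x, s, rfl⟩
    · exact absurd hm (by simp [game])
    · have hmem : (T.result [unary n, a] ω).1 ∈ ((T.law [unary n, a]).map Prod.fst).support :=
        (PMF.mem_support_map_iff _ _ _).2 ⟨_, T.result_mem_support_law _ ω, rfl⟩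
      rw [hT, PMF.mem_support_map_iff] at hmem
      obtain ⟨p, -, hp⟩ := hmem
      exact mem_two.2 ⟨hlt.1, (congrArg List.length hp).symm⟩
    · exact absurd hm (by simp [game])
    · exact absurd hlt.2 (by simp)
  · have key : (S.decodedLaw M₀ ⟨T, false⟩ n).mean win ≤ 4⁻¹ := by
      rw [decodedLaw, PMF.mean_bind, ← PMF.mean_const (M₀.move n [] []) 4⁻¹]
      refine PMF.mean_mono _ fun p hp => ?_
      obtain ⟨b, hb⟩ := mem_one.1 (mem_of_first h₀ hn hp)
      set a := p.1
      set g : List Bool → ℝ≥0∞ := fun x => (M₀.machine.law [unary n, a, x]).mean fun p' =>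
        win [[b], x, [S.opensWith n a p'.1]] with hg
      -- Statelessness enters here: the law of the last move does not involve the coins `p.2`, so
      -- player 1 can sample from it.
      have hmove : ∀ x, M₀.move n [a, x] p.2 = M₀.machine.law [unary n, a, x] := fun x => by
        rw [Strategy.move, Strategy.input, hs]
        rfl
      have hTmove : Strategy.move ⟨T, false⟩ n [a] [] = T.law [unary n, a] := rfl
      have e : (((T.law [unary n, a]).bind fun p' => (M₀.move n [a, p'.1] p.2).map fun p'' =>
          [[S.committedBit n a], p'.1, [S.opensWith n a p''.1]]).mean win) =
          ((T.law [unary n, a]).map Prod.fst).mean g := by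
        rw [PMF.mean_bind, PMF.mean_map]
        refine congrArg _ (funext fun p' => ?_)
        rw [PMF.mean_map, hmove, hb.committedBit_eq]
        rfl
      rw [hTmove, e, hT, PMF.mean_map]
      simp only [hb.openWith_eq, Function.comp_def]
      set P := M₀.machine.law [unary n, a, [false]] with hP
      cases b with
      -- A commitment to `0` never opens to `1`, so player 1 answers `0` and the bits coincide.
      | false =>
        have h0 : ∀ o, (decide ((if o = true then some false else none) = some true)) = false := by
          intro o
          cases o <;> rfl
        have hz : g [false] = 0 := by
          simp only [hg, win_apply, ne_eq, not_true_eq_false, and_false, if_false, PMF.mean_const]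
        simp only [h0, hz, PMF.mean_const, zero_le]
      -- The prediction is whether the simulated move opens. The answer `1` coincides with the
      -- committed bit and is safe; after the answer `0`, player 0 wins if the real move opens.
      | true =>
        have h0 : ∀ o, (decide ((if o = true then some true else none) = some true)) = o := by
          intro o
          cases o <;> rfl
        have h1 : g [true] = 0 := by
          simp only [hg, win_apply, ne_eq, not_true_eq_false, and_false, if_false, PMF.mean_const]
        have h2 : g [false] = P.mean fun p => if S.opensWith n a p.1 then 1 else 0 := by
          simp [hg, win_apply, hP]
        have h3 : ∀ o, g [o] = (if o then 0 else 1) * g [false] := by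
          rintro (_ | _)
          · simp
          · simp [h1]
        simp only [h0]
        simp only [fun p : List Bool × List Bool => h3 (S.opensWith n a p.1)]
        rw [PMF.mean_mul_const]
        -- The factors are the probabilities that the simulated move fails to open and that the real
        -- move opens. Both moves follow the same law `P` with independent coins, so the factors add
        -- up to `1`.
        refine ENNReal.mul_le_inv_four ?_
        rw [h2, ← PMF.mean_add, ← PMF.mean_const P 1]
        refine PMF.mean_congr _ fun p _ => ?_
        split_ifs <;> simp [PMF.mean_const]
    have := ENNReal.toReal_mono (by simp) key
    rwa [ENNReal.toReal_inv, ENNReal.toReal_ofNat] at this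

variable (S) in
-- Player 0's deviation to the stateful uniform committer forces the equilibrium winning probability
-- up to about `1/2`, player 1's predicting deviation forces it down to about `1/4`.
theorem not_exists_isCompNash_stateless :
    ¬ ∃ M : Fin 2 → Strategy, (∀ i, (M i).stateful = false) ∧ IsCompNash S.game M := by
  rintro ⟨M, hs, hM, hN⟩
  have h₀ := representsFirst_represent (S := S) rationalWeights_uniformCommitter
  obtain ⟨M₁, h₁, hle⟩ := exists_winProb_le (hs 0) (hM 0)
  obtain ⟨ε₀, hε₀, hN₀⟩ := hN 0 _ h₀.isStrategyFor
  obtain ⟨ε₁, hε₁, hN₁⟩ := hN 1 _ h₁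
  obtain ⟨ε, hε, h⟩ := winProb_uniformCommitter h₀ (hM 1)
  -- Adding the two equilibrium inequalities cancels the equilibrium utilities and leaves a gap `2 *
  -- (1/2) - 2 * (1/4) = 1/2`, which would have to be at most the sum of the negligible errors.
  obtain ⟨n, hn, hlt⟩ := ((hε.const_mul 2).add (hε₀.add hε₁)).not_le (C := 2⁻¹) (by norm_num)
  have e₀ := hN₀ n hn
  have e₁ := hN₁ n hn
  rw [expectedUtility_zero hM hn,
    expectedUtility_zero (isStrategyFor_update hM h₀.isStrategyFor) hn] at e₀
  rw [expectedUtility_one hM hn, expectedUtility_one (isStrategyFor_update hM h₁) hn] at e₁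
  change _ ≥ 2 * S.winProb (S.represent 0 uniformCommitter) (M 1) n - 1 - _ at e₀
  change _ ≥ 1 - 2 * S.winProb (M 0) M₁ n - _ at e₁
  have h2 := (abs_le.1 (h n hn)).1
  have h3 := hle n hn
  linarith

end CommitmentScheme

end

end

theorem mainTheorem4 (S : CommitmentScheme) (hS : S.ExponentiallyHard) :
    (¬ ∃ M : Fin 2 → Strategy, (∀ i, (M i).stateful = false) ∧ IsCompNash S.game M) ∧
    Represents S.game envelopeGame ∧
    (S.Recognizable → IsComputableUniform S.game) ∧
    (∃ M : Fin 2 → Strategy, (∀ i, (M i).stateful = true) ∧ IsCompNash S.game M) :=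
  ⟨S.not_exists_isCompNash_stateless, S.represents, S.isComputableUniform,
    S.exists_isCompNash_stateful⟩
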